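/- **Equivocation resistance of the USV (Unique Structure Verification) instantiation.** *Setting.* Let $\lambda$ be the security parameter. Let $\mathbb G=\mathbb G_\lambda$ be a family of additive groups of prime order $p=p(\lambda)>3$ with $\lceil\log_2 p\rceil=\Theta(\lambda)$, generator $G$, canonical encodings of polynomial length and uniform polynomial-time addition and negation. PPT means (uniform, strict) probabilistic polynomial time. All parties share a lazily sampled random oracle $\mathsf{Query}(\mathsf{ctx},x)\in\{0,1\}^\lambda$, indexed by contexts $\mathsf{ctx}$; a query made under $\mathsf{ctx}$ is answered independently of the other contexts. Public parameters are $\mathsf{pp}=(\mathbb G,p,G,H)$, where a seed $s$ is drawn from a public beacon (of min-entropy at least $\lambda$) and $H$ is the first of the candidates $\mathsf{H2G}(\texttt{USV.H}\|s\|1^k)$, $k=0,1,2,\dots$, outside $\{0,G\}$ (and $H=2G$ if there is none). It is assumed that $\mathsf{H2G}(\texttt{USV.H}\|s)$, for random $s$, is computationally indistinguishable from a uniform element of $\mathbb G\setminus\{0\}$. *The proof system $\Pi_{\mathsf{DLEQ}}$.* It is for the relation of pairs $((\mathsf{pp},A,B),r)$ with $A,B\in\mathbb G\setminus\{0\}$,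 $r\in\mathbb Z_p^*$, $A=rG$, $B=rH$, and it is the Fischlin transform, in a context $\mathsf{ctx}_{\mathsf{DLEQ}}$, of the Chaum–Pedersen protocol. With parameters $t,b,\rho,S$ (functions of $\lambda$; $t,b,\rho=O(\log\lambda)$, $b\le t$, $b\le\lambda$, $b\rho=\omega(\log\lambda)$, $2^{t-b}=\omega(\log\lambda)$, $S=\Theta(\rho)$, $2^t<p$), a proof is a tuple $\pi=(J_{1,i},J_{2,i},e_i,z_i)_{i\le \rho}$ with $0\le e_i<2^t$ and $z_i\in\mathbb Z_p$; it is accepted iff $A,B\ne0$, $z_iG=J_{1,i}+e_iA$ and $z_iH=J_{2,i}+e_iB$ for all $i$, and $\sum_i h_i\le S$, where $h_i\in\{0,\dots,2^b-1\}$ consists of the $b$ lowest bits of $\mathsf{Query}(\mathsf{ctx}_{\mathsf{DLEQ}},\langle(\mathsf{pp},A,B),(J_{1,j},J_{2,j})_j,i,e_i,z_i\rangle)$. *The certificate scheme.* A tag is $\zeta=(\nu,\upsilon,\pi)\in\mathbb Z_p\times\mathbb G\times\{\text{proofs}\}$. For $C\in\mathbb G$ the derived opening of $(C,\zeta)$ is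 $\perp$ if $\nu=-1$, and otherwise $(M,R)$ with $M=\frac{\nu}{\nu+1}\upsilon$ and $R=C-M$. The pair $(C,\zeta)$ *verifies* iff the derived opening is not $\perp$ and $\pi$ is an accepted proof for $(A,B)=(\upsilon-M,\,C-M)$; then $\mathsf{Open}_M(\mathsf{pp},C,\zeta)=M$, and otherwise $\mathsf{Open}_M(\mathsf{pp},C,\zeta)=\perp$. *Statement.* Assume 1. (DL) for every PPT $\mathcal A$, the probability that $\mathcal A(1^\lambda,G,xG)=x$ for uniform $x\in\mathbb Z_p^*$ is negligible; 2. (argument of knowledge with online extractor) for every PPT prover $\mathcal P^*$ with access to $\mathsf{Query}$ there is a PPT extractor $\mathsf{Ext}$ such that, when $\mathsf{pp}$ is sampled as above, $(x,\pi)\leftarrow\mathcal P^{*\,\mathsf{Query}}(\mathsf{pp})$ and $w\leftarrow\mathsf{Ext}(\mathsf{pp},x,\pi;\mathsf{Log})$, where $\mathsf{Log}$ is the list of the queries of $\mathcal P^*$ under $\mathsf{ctx}_{\mathsf{DLEQ}}$ with their answers, the probability that $\Pi_{\mathsf{DLEQ}}$ accepts $(x,\pi)$ while $w$ is not a witness for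 $x$ is negligible. Then the scheme is *equivocation resistant*: for every PPT $\mathcal A$ with access to $\mathsf{Query}$, the probability that $\mathcal A^{\mathsf{Query}}(1^\lambda,\mathsf{pp})$ outputs $(C,\zeta,\zeta')$ such that $\zeta\neq\zeta'$, both $(C,\zeta)$ and $(C,\zeta')$ verify, and $\mathsf{Open}_M(\mathsf{pp},C,\zeta)\ne\mathsf{Open}_M(\mathsf{pp},C,\zeta')$, is negligible in $\lambda$. -/

import Mathlib

open Filter (atTop)
open scoped Asymptotics
open scoped ENNReal Polynomial

noncomputable section

/-! ## Data, the random oracle, and probabilistic polynomial time -/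

/-- Finite data handled by algorithms: natural numbers (in binary) and pairs. It plays the role of
`{0,1}*` together with a fixed injective self-delimiting encoding of mixed tuples. -/
inductive Val : Type
  | num (k : ℕ) : Val
  | pair (a b : Val) : Val
  deriving DecidableEq

namespace Val

/-- Bit length. -/
def size : Val → ℕ
  | num k => Nat.size k + 1
  | pair a b => a.size + b.size + 1

/-- Lists, with `num 0` as the empty list. -/
def ofList : List Val → Val
  | [] => num 0
  | a :: l => pair a (ofList l)

/-- The string `1ⁿ`. -/
def unary (n : ℕ) : Val := ofList (List.replicate n (num 0))

end Val

/-- The state of the global random oracle with range `{0,1}ⁿ`: all calls `(ctx, x)` made so far with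
their answers `y`, latest first. It is at the same time the lazy table and the query log.
Every `Val` is allowed as a context. Programming of fresh points is an interface for simulators only;
no algorithm that occurs in an experiment below has access to it. -/
abbrev OracleLog (n : ℕ) : Type := List (Val × Val × Fin (2 ^ n))

/-- Randomized computations with access to the global random oracle. -/
abbrev ROM (n : ℕ) (α : Type) : Type := StateT (OracleLog n) PMF α

/-- Lazy sampling: an old query gets its old answer, a fresh query gets a uniform `n`-bit answer. -/
def ROM.query {n : ℕ} (ctx x : Val) : ROM n (Fin (2 ^ n)) := fun s =>
  match s.find? (fun e => decide (e.1 = ctx ∧ e.2.1 = x)) with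
  | some e => pure (e.2.2, (ctx, x, e.2.2) :: s)
  | none => do
      let y ← PMF.uniformOfFintype (Fin (2 ^ n))
      pure (y, (ctx, x, y) :: s)

/-- Sampling from a distribution, without touching the oracle. -/
def ROM.sample {n : ℕ} {α : Type} (d : PMF α) : ROM n α := fun s => do
  let a ← d
  pure (a, s)

/-- Run a computation from the empty oracle. -/
def ROM.exec {n : ℕ} {α : Type} (c : ROM n α) : PMF α := do
  let r ← c []
  pure r.1

/-- The part of a log that belongs to the context `ctx`, as data. -/
def OracleLog.restrict {n : ℕ} (ctx : Val) (s : OracleLog n) : Val :=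
  Val.ofList ((s.filter (fun e => decide (e.1 = ctx))).map
    (fun e => Val.pair e.1 (Val.pair e.2.1 (Val.num e.2.2))))

/-- Primitive operations of the machine. -/
inductive Op : Type
  | id
  | const (v : Val)
  | fst | snd | isPair
  | eq
  | lt | add | sub | mul | div | mod
  | size

/-- Meaning of the primitive operations (`num 0` on inputs of the wrong shape; truth values are the
numbers `1` and `0`). -/
def Op.eval : Op → Val → Val
  | .id, x => x
  | .const v, _ => v
  | .fst, .pair a _ => a
  | .snd, .pair _ b => b
  | .isPair, .pair _ _ => .num 1
  | .eq, .pair a b => if a = b then .num 1 else .num 0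
  | .lt, .pair (.num a) (.num b) => if a < b then .num 1 else .num 0
  | .add, .pair (.num a) (.num b) => .num (a + b)
  | .sub, .pair (.num a) (.num b) => .num (a - b)
  | .mul, .pair (.num a) (.num b) => .num (a * b)
  | .div, .pair (.num a) (.num b) => .num (a / b)
  | .mod, .pair (.num a) (.num b) => .num (a % b)
  | .size, x => .num x.size
  | _, _ => .num 0

/-- Programs: the algorithms of the model. A program is a finite object that does not depend on the
security parameter. -/
inductive Prog : Type
  | prim (o : Op)
  | comp (g f : Prog)
  | pair (f g : Prog)
  | ite (c f g : Prog)
  | loop (f : Prog)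
  | coin
  | query

namespace Prog

/-- `k`-fold execution of a loop body, adding up the costs. -/
def iterate {n : ℕ} (body : Val → ROM n (Val × ℕ)) : ℕ → Val → ROM n (Val × ℕ)
  | 0, x => pure (x, 0)
  | k + 1, x => do
      let r ← body x
      let r' ← iterate body k r.1
      pure (r'.1, r.2 + r'.2 + 1)

/-- Execution of a program in the presence of the random oracle; returns the output and the number
of steps. An elementary step is charged the bit lengths of its input and output (logarithmic cost
criterion), so that the number of steps is polynomially related to Turing machine time.
The loop `loop f` on input `(k, x)` executes `f` exactly `k` times; since `Op.size` gives the input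
length, a program can run any procedure for a polynomial number of iterations, so bounded loops
express every strict polynomial-time algorithm. -/
def eval (n : ℕ) : Prog → Val → ROM n (Val × ℕ)
  | prim o, x => pure (o.eval x, 1 + x.size + (o.eval x).size)
  | comp g f, x => do
      let r ← eval n f x
      let r' ← eval n g r.1
      pure (r'.1, r.2 + r'.2 + 1)
  | pair f g, x => do
      let r ← eval n f x
      let r' ← eval n g x
      pure (Val.pair r.1 r'.1, r.2 + r'.2 + 1)
  | ite c f g, x => do
      let b ← eval n c x
      let r ← if b.1 = Val.num 0 then eval n g x else eval n f x
      pure (r.1, b.2 + r.2 + 1)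
  | loop f, x =>
      match x with
      | .pair (.num k) y => do
          let r ← iterate (eval n f) k y
          pure (r.1, r.2 + x.size + 1)
      | _ => pure (x, 1 + 2 * x.size)
  | coin, x => do
      let b ← ROM.sample (PMF.uniformOfFintype Bool)
      pure (Val.num b.toNat, 3 + x.size)
  | query, x =>
      match x with
      | .pair ctx q => do
          let y ← ROM.query ctx q
          pure (Val.num y, 1 + x.size + (Val.num y).size)
      | _ => pure (Val.num 0, 2 + x.size)

/-- The program never calls the random oracle. -/
def OracleFree : Prog → Prop
  | prim _ => True
  | comp g f => g.OracleFree ∧ f.OracleFree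
  | pair f g => f.OracleFree ∧ g.OracleFree
  | ite c f g => c.OracleFree ∧ f.OracleFree ∧ g.OracleFree
  | loop f => f.OracleFree
  | coin => True
  | query => False

/-- Probabilistic polynomial time: on every input, whatever the coins and the oracle answers, the
number of steps is at most a polynomial in the security parameter and the input length. -/
def PPT (P : Prog) : Prop :=
  ∃ q : ℕ[X], ∀ (n : ℕ) (x : Val) (s : OracleLog n),
    ∀ o ∈ (P.eval n x s).support, o.1.2 ≤ q.eval (n + x.size)

end Prog

/-- Negligible functions of the security parameter. -/
def Negligible (f : ℕ → ℝ) : Prop :=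
  Asymptotics.SuperpolynomialDecay atTop (fun n : ℕ => (n : ℝ)) f

/-- The probability that a random bit is `1`. -/
def probTrue (d : PMF Bool) : ℝ := (d true).toReal

/-! ## Prime-order groups and the discrete logarithm assumption -/

/-- A family of prime-order groups, one for each value `n` of the security parameter, with generator
`gen n`, public description `desc n`, canonical encodings of polynomial length and polynomial-time
group operations. -/
structure GroupFamily where
  carrier : ℕ → Type
  [grp : ∀ n, AddCommGroup (carrier n)]
  order : ℕ → ℕ
  order_prime : ∀ n, (order n).Prime
  three_lt_order : ∀ n, 3 < order n
  card_eq : ∀ n, Nat.card (carrier n) = order n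
  gen : ∀ n, carrier n
  gen_generates : ∀ n (a : carrier n), a ∈ AddSubgroup.zmultiples (gen n)
  /-- the bit length of the order is linear in the security parameter -/
  order_size : (fun n => (Nat.clog 2 (order n) : ℝ)) =Θ[atTop] (fun n => (n : ℝ))
  enc : ∀ n, carrier n → Val
  enc_injective : ∀ n, Function.Injective (enc n)
  desc : ℕ → Val
  size_le : ∃ q : ℕ[X], ∀ n, (desc n).size ≤ q.eval n ∧ ∀ a, (enc n a).size ≤ q.eval n
  add_polytime : ∃ P : Prog, P.PPT ∧ P.OracleFree ∧ ∀ n (a b : carrier n) (s : OracleLog n),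
    ∀ o ∈ (P.eval n
      (.pair (.pair (.unary n) (.pair (desc n) (.pair (.num (order n)) (enc n (gen n)))))
        (.pair (enc n a) (enc n b))) s).support, o.1.1 = enc n (a + b)
  neg_polytime : ∃ P : Prog, P.PPT ∧ P.OracleFree ∧ ∀ n (a : carrier n) (s : OracleLog n),
    ∀ o ∈ (P.eval n
      (.pair (.pair (.unary n) (.pair (desc n) (.pair (.num (order n)) (enc n (gen n)))))
        (enc n a)) s).support, o.1.1 = enc n (-a)

namespace GroupFamily

variable (𝒢 : GroupFamily)

instance (n : ℕ) : AddCommGroup (𝒢.carrier n) := 𝒢.grp n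

instance (n : ℕ) : Fact (𝒢.order n).Prime := ⟨𝒢.order_prime n⟩

/-- Scalars: the field with `p = order n` elements. -/
abbrev Scalar (n : ℕ) : Type := ZMod (𝒢.order n)

/-- Scalar multiplication `c · a`. -/
def smul {n : ℕ} (c : 𝒢.Scalar n) (a : 𝒢.carrier n) : 𝒢.carrier n := c.val • a

/-- `(1ⁿ, 𝔾, p, G)` as data. -/
def encParams (n : ℕ) : Val :=
  .pair (.unary n) (.pair (𝒢.desc n) (.pair (.num (𝒢.order n)) (𝒢.enc n (𝒢.gen n))))

/-- `(1ⁿ, pp)` as data, where `pp = (𝔾, p, G, H)`. Only the second generator `H` of the public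
parameters is not determined by `n`, and so `pp` is represented by `H`. -/
def encPP {n : ℕ} (H : 𝒢.carrier n) : Val := .pair (𝒢.encParams n) (𝒢.enc n H)

def encScalar {n : ℕ} (c : 𝒢.Scalar n) : Val := .num c.val

theorem nonzero_nonempty (n : ℕ) : (Finset.univ.filter (fun x : 𝒢.Scalar n => x ≠ 0)).Nonempty :=
  ⟨1, by simp⟩

/-- Uniform distribution on the nonzero scalars. -/
def uniformNonzero (n : ℕ) : PMF (𝒢.Scalar n) :=
  PMF.uniformOfFinset (Finset.univ.filter (fun x : 𝒢.Scalar n => x ≠ 0)) (𝒢.nonzero_nonempty n)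

/-- The DL experiment. -/
def dlExp (A : Prog) (n : ℕ) : PMF Bool := ROM.exec (n := n) do
  let x ← ROM.sample (𝒢.uniformNonzero n)
  let X : 𝒢.carrier n := 𝒢.smul x (𝒢.gen n)
  let r ← A.eval n (.pair (𝒢.encParams n) (𝒢.enc n X))
  pure (decide (r.1 = 𝒢.encScalar x))

/-- The DL assumption. -/
def DLHard : Prop :=
  ∀ A : Prog, A.PPT → A.OracleFree → Negligible (fun n => probTrue (𝒢.dlExp A n))

end GroupFamily

/-! ## Transparent setup -/

/-- A public randomness beacon (with min-entropy at least `n`) and a deterministic public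
hash-to-group map. -/
structure TransparentSetup (𝒢 : GroupFamily) where
  beacon : ℕ → PMF (List Bool)
  minEntropy : ∀ n s, beacon n s ≤ ((2 : ℝ≥0∞)⁻¹) ^ n
  h2g : ∀ n, List Bool → 𝒢.carrier n

/-- The ASCII bits of the domain-separation label `USV.H`. -/
def usvLabel : List Bool :=
  [0x55, 0x53, 0x56, 0x2E, 0x48].flatMap
    (fun c : ℕ => (List.range 8).map (fun i => c.testBit (7 - i)))

namespace TransparentSetup

variable {𝒢 : GroupFamily} (𝒮 : TransparentSetup 𝒢)

/-- The `k`-th candidate for the second generator; the first one is `H2G(USV.H ‖ £)`. -/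
def candidate (n : ℕ) (seed : List Bool) (k : ℕ) : 𝒢.carrier n :=
  𝒮.h2g n (usvLabel ++ seed ++ List.replicate k true)

open Classical in
/-- The deterministic setup: the first candidate outside `{0, G}` (and, should all candidates fail,
the element `2G`, which is also outside `{0, G}`). -/
def setup (n : ℕ) (seed : List Bool) : 𝒢.carrier n :=
  if h : ∃ k, 𝒮.candidate n seed k ≠ 0 ∧ 𝒮.candidate n seed k ≠ 𝒢.gen n then
    𝒮.candidate n seed (Nat.find h)
  else 2 • 𝒢.gen n

/-- Sample the beacon and run the setup. -/
def samplePP (n : ℕ) : PMF (𝒢.carrier n) := do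
  let seed ← 𝒮.beacon n
  pure (𝒮.setup n seed)

/-- A distinguisher `D` run on a random group element. -/
def distExp (D : Prog) (n : ℕ) (d : PMF (𝒢.carrier n)) : PMF Bool := ROM.exec (n := n) do
  let X ← ROM.sample d
  let r ← D.eval n (.pair (𝒢.encParams n) (𝒢.enc n X))
  pure (decide (r.1 = .num 1))

/-- Over a random seed, the output of the hash-to-group map is computationally indistinguishable
from a uniform nonzero group element. -/
def HashIndist : Prop :=
  ∀ D : Prog, D.PPT → D.OracleFree → Negligible (fun n =>
    |probTrue (distExp D n ((𝒮.beacon n).map (fun seed => 𝒮.h2g n (usvLabel ++ seed))))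
      - probTrue (distExp D n ((𝒢.uniformNonzero n).map (fun x => 𝒢.smul x (𝒢.gen n))))|)

end TransparentSetup

/-! ## Non-interactive proof systems in the random oracle model -/

/-- A non-interactive proof system for a relation that may depend on the public parameters. -/
structure ProofSystem (𝒢 : GroupFamily) where
  Stmt : ℕ → Type
  Wit : ℕ → Type
  Proof : ℕ → Type
  encStmt : ∀ n, Stmt n → Val
  encWit : ∀ n, Wit n → Val
  encProof : ∀ n, Proof n → Val
  rel : ∀ {n}, 𝒢.carrier n → Stmt n → Wit n → Prop
  prove : ∀ {n}, 𝒢.carrier n → Stmt n → Wit n → ROM n (Proof n)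
  verify : ∀ {n}, 𝒢.carrier n → Stmt n → Proof n → ROM n Bool

namespace ProofSystem

variable {𝒢 : GroupFamily} (Pi : ProofSystem 𝒢)

def encClaim (n : ℕ) (c : Pi.Stmt n × Pi.Proof n) : Val :=
  .pair (Pi.encStmt n c.1) (Pi.encProof n c.2)

open Classical in
/-- The extraction experiment: the prover `P` outputs a statement and a proof, the extractor `E` gets
these, the public parameters and the prover's query log under the proof context `ctx`. The outcome is
`true` if the proof is accepted and `E` does not output a witness. Outputs of `P` that do not encode
a statement and a proof are rejected. -/
def extractExp (𝒮 : TransparentSetup 𝒢) (ctx : Val) (P E : Prog) (n : ℕ) : PMF Bool :=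
  ROM.exec (n := n) do
    let H ← ROM.sample (𝒮.samplePP n)
    let out ← P.eval n (𝒢.encPP H)
    let log ← get
    let w ← E.eval n (.pair (𝒢.encPP H) (.pair out.1 (log.restrict ctx)))
    match Function.partialInv (Pi.encClaim n) out.1 with
    | none => pure false
    | some (x, π) => do
        let b ← Pi.verify H x π
        pure (b && decide (¬ ∃ w', Pi.encWit n w' = w.1 ∧ Pi.rel H x w'))

/-- Argument of knowledge with an online (straight-line) extractor: for every polynomial-time prover
with oracle access there is a polynomial-time extractor, which has no oracle access and does not
rewind, that fails on an accepted proof only with negligible probability. -/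
def IsAoK (𝒮 : TransparentSetup 𝒢) (ctx : Val) : Prop :=
  ∀ P : Prog, P.PPT → ∃ E : Prog, E.PPT ∧ E.OracleFree ∧
    Negligible (fun n => probTrue (Pi.extractExp 𝒮 ctx P E n))

end ProofSystem

/-! ## The Fischlin transform of the Chaum–Pedersen protocol -/

/-- Admissible Fischlin parameters: challenge length `t`, rarity length `b`, number of repetitions
`r` and slack `S`. -/
structure FischlinParams (𝒢 : GroupFamily) where
  t : ℕ → ℕ
  b : ℕ → ℕ
  r : ℕ → ℕ
  S : ℕ → ℕ
  t_log : (fun n => (t n : ℝ)) =O[atTop] (fun n : ℕ => Real.log n)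
  b_log : (fun n => (b n : ℝ)) =O[atTop] (fun n : ℕ => Real.log n)
  r_log : (fun n => (r n : ℝ)) =O[atTop] (fun n : ℕ => Real.log n)
  b_le_t : ∀ n, b n ≤ t n
  b_le : ∀ n, b n ≤ n
  br_large : (fun n : ℕ => Real.log n) =o[atTop] (fun n => (b n * r n : ℝ))
  gap_large : (fun n : ℕ => Real.log n) =o[atTop] (fun n => (2 : ℝ) ^ (t n - b n))
  S_theta : (fun n => (S n : ℝ)) =Θ[atTop] (fun n => (r n : ℝ))
  challenge_lt : ∀ n, 2 ^ t n < 𝒢.order n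

namespace FischlinParams

variable {𝒢 : GroupFamily} (F : FischlinParams 𝒢)

/-- One repetition of the Chaum–Pedersen protocol: first message `(J₁, J₂)`, challenge `e`,
response `z`. -/
structure Round (n : ℕ) where
  J₁ : 𝒢.carrier n
  J₂ : 𝒢.carrier n
  e : Fin (2 ^ F.t n)
  z : 𝒢.Scalar n

/-- A challenge as a scalar. -/
def challenge {n : ℕ} (e : Fin (2 ^ F.t n)) : 𝒢.Scalar n := (e : ℕ)

/-- The Chaum–Pedersen verifier for the claim that `A = r G` and `B = r H`. -/
def SigmaAccepts {n : ℕ} (H : 𝒢.carrier n) (x : 𝒢.carrier n × 𝒢.carrier n)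
    (ρ : F.Round n) : Prop :=
  x.1 ≠ 0 ∧ x.2 ≠ 0 ∧
    𝒢.smul ρ.z (𝒢.gen n) = ρ.J₁ + 𝒢.smul (F.challenge ρ.e) x.1 ∧
    𝒢.smul ρ.z H = ρ.J₂ + 𝒢.smul (F.challenge ρ.e) x.2

def encStmt {n : ℕ} (x : 𝒢.carrier n × 𝒢.carrier n) : Val :=
  .pair (𝒢.enc n x.1) (𝒢.enc n x.2)

def encRound {n : ℕ} (ρ : F.Round n) : Val :=
  .pair (.pair (𝒢.enc n ρ.J₁) (𝒢.enc n ρ.J₂)) (.pair (.num ρ.e) (𝒢.encScalar ρ.z))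

/-- A proof consists of `r` repetitions. -/
def encProof {n : ℕ} (π : Fin (F.r n) → F.Round n) : Val :=
  .ofList (List.ofFn (fun i => F.encRound (π i)))

/-- The hash value `H_b(ctx, ⟨x, a, i, e, z⟩)`: the `b` lowest bits of the oracle's answer. The
statement `x = (pp, A, B)` includes the public parameters; `a` is the vector of first messages. -/
def score {n : ℕ} (ctx : Val) (H : 𝒢.carrier n) (x : 𝒢.carrier n × 𝒢.carrier n)
    (a : Fin (F.r n) → 𝒢.carrier n × 𝒢.carrier n) (i : Fin (F.r n))
    (e : Fin (2 ^ F.t n)) (z : 𝒢.Scalar n) : ROM n ℕ := do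
  let y ← ROM.query ctx (.ofList
    [.pair (𝒢.encPP H) (encStmt x),
      .ofList (List.ofFn (fun j => encStmt (a j))),
      .num (i + 1), .num e, 𝒢.encScalar z])
  pure ((y : ℕ) % 2 ^ F.b n)

open Classical in
/-- The Fischlin verifier. -/
def verify (ctx : Val) {n : ℕ} (H : 𝒢.carrier n) (x : 𝒢.carrier n × 𝒢.carrier n)
    (π : Fin (F.r n) → F.Round n) : ROM n Bool := do
  let scores ← (List.finRange (F.r n)).mapM
    (fun i => F.score ctx H x (fun j => ((π j).J₁, (π j).J₂)) i (π i).e (π i).z)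
  pure (decide ((∀ i, F.SigmaAccepts H x (π i)) ∧ scores.sum ≤ F.S n))

/-- The prover's search through the challenges: stop at the first one with hash value `0`, else
take the last one with the least hash value. `best` is the least value so far and its challenge. -/
def search {n : ℕ} (hash : Fin (2 ^ F.t n) → ROM n ℕ) :
    List (Fin (2 ^ F.t n)) → ℕ × Fin (2 ^ F.t n) → ROM n (Fin (2 ^ F.t n))
  | [], best => pure best.2
  | e :: es, best => do
      let v ← hash e
      if v = 0 then pure e
      else if v ≤ best.1 then search hash es (v, e)
      else search hash es best

/-- The Fischlin prover. -/
def prove (ctx : Val) {n : ℕ} (H : 𝒢.carrier n) (x : 𝒢.carrier n × 𝒢.carrier n)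
    (w : 𝒢.Scalar n) : ROM n (Fin (F.r n) → F.Round n) := do
  let j ← ROM.sample (PMF.uniformOfFintype (Fin (F.r n) → 𝒢.Scalar n))
  let a : Fin (F.r n) → 𝒢.carrier n × 𝒢.carrier n :=
    fun i => (𝒢.smul (j i) (𝒢.gen n), 𝒢.smul (j i) H)
  let resp : Fin (F.r n) → Fin (2 ^ F.t n) → 𝒢.Scalar n :=
    fun i e => j i + F.challenge e * w
  let es ← (List.finRange (F.r n)).mapM (fun i =>
    F.search (fun e => F.score ctx H x a i e (resp i e))
      (List.finRange (2 ^ F.t n)) (2 ^ F.b n - 1, 0))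
  pure (fun i =>
    let e := es.getD i 0
    ⟨(a i).1, (a i).2, e, resp i e⟩)

/-- The Fischlin proof system for `R_DLEQ`: statements `(A, B)` of nonzero group elements, witnesses
`r ≠ 0` with `A = r G` and `B = r H`. -/
def dleqProofSystem (ctx : Val) : ProofSystem 𝒢 where
  Stmt n := 𝒢.carrier n × 𝒢.carrier n
  Wit n := 𝒢.Scalar n
  Proof n := Fin (F.r n) → F.Round n
  encStmt _ := encStmt
  encWit _ := 𝒢.encScalar
  encProof _ := F.encProof
  rel {n} H x r := x.1 ≠ 0 ∧ x.2 ≠ 0 ∧ r ≠ 0 ∧ x.1 = 𝒢.smul r (𝒢.gen n) ∧ x.2 = 𝒢.smul r H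
  prove := F.prove ctx
  verify := F.verify ctx

end FischlinParams

/-! ## Unique structure verification certificates -/

/-- The algorithms of a USV certificate scheme (besides the setup): certification, derivation of the
opening, verification, and the projection to the public opening. `none` stands for `⊥`. -/
structure USVScheme (𝒢 : GroupFamily) where
  Tag : ℕ → Type
  Opening : ℕ → Type
  encTag : ∀ n, Tag n → Val
  cert : ∀ {n}, 𝒢.carrier n → 𝒢.Scalar n → ROM n (𝒢.carrier n × Tag n)
  derive : ∀ {n}, 𝒢.carrier n → 𝒢.carrier n → Tag n → Option (Opening n)
  vcert : ∀ {n}, 𝒢.carrier n → 𝒢.carrier n → Tag n → ROM n Bool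
  pubOpen : ∀ {n}, 𝒢.carrier n → Opening n → Option (𝒢.carrier n)

namespace USVScheme

variable {𝒢 : GroupFamily} (U : USVScheme 𝒢)

/-- The verified opening, where `accepted` is the value of `vcert` on `(pp, C, ζ)`. -/
def verifiedOpen {n : ℕ} (accepted : Bool) (H C : 𝒢.carrier n) (ζ : U.Tag n) :
    Option (U.Opening n) :=
  if accepted then U.derive H C ζ else none

/-- The public opening `Open_M(pp, C, ζ)`, where `accepted` is the value of `vcert`. -/
def openM {n : ℕ} (accepted : Bool) (H C : 𝒢.carrier n) (ζ : U.Tag n) : Option (𝒢.carrier n) :=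
  (U.verifiedOpen accepted H C ζ).bind (U.pubOpen H)

/-- The adversary's output `(C, ζ, ζ')` as data. -/
def encOutput (n : ℕ) (o : 𝒢.carrier n × U.Tag n × U.Tag n) : Val :=
  .pair (𝒢.enc n o.1) (.pair (U.encTag n o.2.1) (U.encTag n o.2.2))

open Classical in
/-- The equivocation experiment. The verifications use the same random oracle as the adversary.
Outputs of the adversary that do not encode a triple `(C, ζ, ζ')` lose. -/
def eqvExp (𝒮 : TransparentSetup 𝒢) (A : Prog) (n : ℕ) : PMF Bool := ROM.exec (n := n) do
  let H ← ROM.sample (𝒮.samplePP n)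
  let out ← A.eval n (𝒢.encPP H)
  match Function.partialInv (U.encOutput n) out.1 with
  | none => pure false
  | some (C, ζ, ζ') => do
      let b ← U.vcert H C ζ
      let b' ← U.vcert H C ζ'
      pure (decide (ζ ≠ ζ' ∧ b = true ∧ b' = true ∧ U.openM b H C ζ ≠ U.openM b' H C ζ'))

/-- Equivocation resistance. -/
def EquivocationResistant (𝒮 : TransparentSetup 𝒢) : Prop :=
  ∀ A : Prog, A.PPT → Negligible (fun n => probTrue (U.eqvExp 𝒮 A n))

end USVScheme

namespace FischlinParams

variable {𝒢 : GroupFamily} (F : FischlinParams 𝒢)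

/-- The tags `ζ = (ν, υ, π)` of the instantiation. -/
structure USVTag (n : ℕ) where
  ν : 𝒢.Scalar n
  υ : 𝒢.carrier n
  π : Fin (F.r n) → F.Round n

theorem certScalar_nonempty (n : ℕ) (m : 𝒢.Scalar n) :
    (Finset.univ.filter (fun r : 𝒢.Scalar n => r ≠ 0 ∧ r ≠ -m)).Nonempty := by
  by_contra h
  rw [Finset.not_nonempty_iff_eq_empty, Finset.filter_eq_empty_iff] at h
  have hsub : (Finset.univ : Finset (𝒢.Scalar n)) ⊆ {0, -m} := by
    intro r hr
    have := h hr
    simp only [Finset.mem_insert, Finset.mem_singleton]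
    tauto
  have h1 := (Finset.card_le_card hsub).trans Finset.card_le_two
  rw [Finset.card_univ, ZMod.card] at h1
  have := 𝒢.three_lt_order n
  omega

open Classical in
/-- `Derive`: `⊥` if `ν = -1`, else `(M, R)` with `M = (ν / (ν + 1)) υ` and `R = C - M`. -/
def usvDerive {n : ℕ} (C : 𝒢.carrier n) (ζ : F.USVTag n) :
    Option (𝒢.carrier n × 𝒢.carrier n) :=
  if ζ.ν = -1 then none
  else
    let M := 𝒢.smul (ζ.ν / (ζ.ν + 1)) ζ.υ
    some (M, C - M)

/-- The instantiation of USV certificates, with the Fischlin proof for DLEQ in the context `ctx`. -/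
def usvScheme (ctx : Val) : USVScheme 𝒢 where
  Tag n := F.USVTag n
  Opening n := 𝒢.carrier n × 𝒢.carrier n
  encTag n ζ := .pair (𝒢.encScalar ζ.ν) (.pair (𝒢.enc n ζ.υ) (F.encProof ζ.π))
  cert {n} H m := do
    let r ← ROM.sample (PMF.uniformOfFinset _ (certScalar_nonempty n m))
    let M := 𝒢.smul m (𝒢.gen n)
    let C := M + 𝒢.smul r H
    let υ := 𝒢.smul (m + r) (𝒢.gen n)
    let π ← (F.dleqProofSystem ctx).prove H (υ - M, C - M) r
    pure (C, ⟨m * r⁻¹, υ, π⟩)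
  derive _ C ζ := F.usvDerive C ζ
  vcert H C ζ :=
    match F.usvDerive C ζ with
    | none => pure false
    | some (M, _) => (F.dleqProofSystem ctx).verify H (ζ.υ - M, C - M) ζ.π
  pubOpen _ o := some o.1

end FischlinParams

end

/-!
An adversary `A` that equivocates outputs `C` with two accepted tags `(ν, υ, π)` and `(ν', υ', π')`
whose openings `M = ν / (ν + 1) υ` and `M' = ν' / (ν' + 1) υ'` differ. A witness `r` for the first
proof satisfies `υ - M = r G` and `C - M = r H`, hence `M = ν r G` and `C = ν r G + r H`; likewise
`C = ν' r' G + r' H` for a witness `r'` for the second one. If `r = r'`, the openings agree;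
otherwise `H = ((ν' r' - ν r) / (r - r')) G`, and the discrete logarithm of `H` is known
(`FischlinParams.solves_of_rel`).

*The reduction.* "Run `A` and output the claim of the first (second) tag" is a prover, so that there
are extractors `E` and `E'` for these two provers. The algorithm `Prog.attack` runs `A`, then both
extractors, and solves for the discrete logarithm. The extractors have no oracle, but `A` has, and a
discrete logarithm algorithm must do without one. Therefore `A` is simulated by an oracle-free
program `Prog.simStart` that samples the oracle lazily and carries the table and the query log in
its state. This simulation reproduces the joint distribution of output and log exactly
(`Prog.run_sim`), and its cost exceeds that of `A` by a polynomial factor only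
(`Prog.exists_simBound`).

*The probabilities.* For fixed `H` and a fixed outcome of the run of `A`, let the proofs be accepted
with probabilities `p` and `p'`, and let the extractors succeed with probabilities `g` and `g'`;
their coins are independent. An equivocation has probability at most `min p p'`, which is at most
`(1 - g) p + (1 - g') p' + g g'`: two extraction errors and the success of the attack. In the
equivocation experiment the second proof is verified after the oracle calls of the first
verification. That its acceptance probability is nevertheless `p'` is the standard fact about lazy
sampling, `ROM.QueryComp.expect_after`.

*The second generator.* The attack succeeds with negligible probability against a uniform nonzero
element. The test "`H = 0`, or `H = G`, or the attack finds the discrete logarithm of `H`" is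
polynomial-time (`Prog.tester`), so by indistinguishability it succeeds with negligible probability
against a hashed seed as well. The actual setup agrees with the hashed seed unless the latter is `0`
or `G`, and then the test succeeds anyway. The case `H = G` costs the probability that `x = 1`,
which is the success probability of the algorithm that always answers `1`.

*Polynomial time.* Strict polynomial time is required on all inputs, including malformed ones on
which the given group operations may return anything. All auxiliary loops are therefore instances
of `Prog.clipLoop`, which replaces oversized intermediate results by `0` and is polynomial-time for
every polynomial-time body. On well-formed inputs nothing is clipped.
-/

noncomputable section

/-! ### Semantics and cost of programs -/

theorem Val.one_le_size (v : Val) : 1 ≤ v.size := by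
  cases v <;> simp [Val.size]

@[simp] theorem Val.size_num (k : ℕ) : (Val.num k).size = k.size + 1 := rfl

@[simp] theorem Val.size_pair (a b : Val) : (Val.pair a b).size = a.size + b.size + 1 := rfl

theorem Val.size_unary (n : ℕ) : (Val.unary n).size = 2 * n + 1 := by
  induction n with
  | zero => simp [Val.unary, Val.ofList]
  | succ k ih =>
    have h : Val.unary (k + 1) = .pair (.num 0) (Val.unary k) := rfl
    rw [h, Val.size_pair, ih, Val.size_num, Nat.size_zero]
    ring

namespace ROM

variable {n : ℕ} {α β : Type}

theorem bind_apply (m : ROM n α) (k : α → ROM n β) (s : OracleLog n) :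
    (m >>= k) s = (m s).bind (fun r => k r.1 r.2) := rfl

theorem pure_apply (a : α) (s : OracleLog n) : (pure a : ROM n α) s = PMF.pure (a, s) := rfl

theorem sample_apply (d : PMF α) (s : OracleLog n) :
    (ROM.sample d : ROM n α) s = d.bind (fun a => PMF.pure (a, s)) := rfl

theorem map_apply (f : α → β) (m : ROM n α) (s : OracleLog n) :
    (f <$> m) s = (m s).map (fun r => (f r.1, r.2)) := rfl

theorem sample_pure (a : α) : (ROM.sample (PMF.pure a) : ROM n α) = pure a := by
  funext s
  rw [sample_apply, PMF.pure_bind, pure_apply]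

theorem sample_bind_apply (d : PMF α) (k : α → ROM n β) (s : OracleLog n) :
    (ROM.sample d >>= k) s = d.bind (fun a => k a s) := by
  rw [bind_apply, sample_apply, PMF.bind_bind]
  simp only [PMF.pure_bind]

theorem sample_bind_sample (d : PMF α) (k : α → PMF β) :
    (ROM.sample d >>= fun a => (ROM.sample (k a) : ROM n β)) = ROM.sample (d.bind k) := by
  funext s
  rw [sample_bind_apply, sample_apply, PMF.bind_bind]
  rfl

theorem map_sample (f : α → β) (d : PMF α) :
    f <$> (ROM.sample d : ROM n α) = ROM.sample (d.map f) := by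
  funext s
  rw [map_apply, sample_apply, sample_apply, PMF.map_bind, PMF.bind_map]
  simp only [PMF.pure_map]
  rfl

end ROM

namespace Prog

variable {n : ℕ}

/-- The randomized function computed by a program, without its cost. -/
def run (n : ℕ) (P : Prog) (x : Val) : ROM n Val := Prod.fst <$> P.eval n x

theorem eval_bind_fst {α : Type} (P : Prog) (x : Val) (k : Val → ROM n α) :
    (P.eval n x >>= fun r => k r.1) = P.run n x >>= k := by
  simp [run]

@[simp] theorem run_prim (o : Op) (x : Val) : (prim o).run n x = pure (o.eval x) := by
  simp [run, eval]

@[simp] theorem run_comp (g f : Prog) (x : Val) :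
    (comp g f).run n x = f.run n x >>= g.run n := by
  simp [run, eval]

@[simp] theorem run_pair (f g : Prog) (x : Val) :
    (pair f g).run n x = f.run n x >>= fun a => g.run n x >>= fun b => pure (.pair a b) := by
  simp [run, eval]

theorem run_ite (c f g : Prog) (x : Val) :
    (ite c f g).run n x =
      c.run n x >>= fun b => if b = .num 0 then g.run n x else f.run n x := by
  simp only [run, eval, map_bind, bind_map_left]
  congr 1
  funext b
  split_ifs <;> simp

@[simp] theorem run_coin (x : Val) :
    coin.run n x = ROM.sample ((PMF.uniformOfFintype Bool).map (fun b => .num b.toNat)) := by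
  rw [← ROM.map_sample]
  simp [run, eval]

/-- `k`-fold iteration of a randomized function. -/
def iterRun (f : Val → ROM n Val) : ℕ → Val → ROM n Val
  | 0, x => pure x
  | k + 1, x => f x >>= iterRun f k

theorem fst_map_iterate (f : Prog) (k : ℕ) (x : Val) :
    Prod.fst <$> iterate (f.eval n) k x = iterRun (f.run n) k x := by
  induction k generalizing x with
  | zero => simp [iterate, iterRun]
  | succ k ih =>
    simp only [iterate, iterRun, map_bind, map_pure, ← eval_bind_fst, ← ih]
    simp

@[simp] theorem run_loop (f : Prog) (k : ℕ) (y : Val) :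
    (loop f).run n (.pair (.num k) y) = iterRun (f.run n) k y := by
  rw [← fst_map_iterate]
  simp [run, eval]

theorem run_loop_of_ne (f : Prog) (x : Val) (h : ∀ k y, x ≠ .pair (.num k) y) :
    (loop f).run n x = pure x := by
  match x, h with
  | .pair (.num k) y, h => exact absurd rfl (h k y)
  | .num k, _ => simp [run, eval]
  | .pair (.pair _ _) _, _ => simp [run, eval]

@[simp] theorem run_query_pair (ctx q : Val) :
    query.run n (.pair ctx q) =
      (fun y : Fin (2 ^ n) => Val.num y) <$> ROM.query ctx q := by
  simp [run, eval]

@[simp] theorem run_query_num (k : ℕ) : query.run n (.num k) = pure (.num 0) := by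
  simp [run, eval]

/-- Without access to the oracle, a program computes the same randomized function for all oracle
ranges and leaves the log unchanged. -/
theorem OracleFree.exists_run_eq_sample {P : Prog} (hP : P.OracleFree) (x : Val) :
    ∃ d : PMF Val, ∀ n, P.run n x = ROM.sample d := by
  induction P generalizing x with
  | prim o => exact ⟨PMF.pure (o.eval x), fun n => by rw [ROM.sample_pure, run_prim]⟩
  | comp g f ihg ihf =>
    obtain ⟨d, hd⟩ := ihf hP.2 x
    choose e he using ihg hP.1
    refine ⟨d.bind e, fun n => ?_⟩
    rw [run_comp, hd, ← ROM.sample_bind_sample]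
    exact congrArg _ (funext fun a => he a n)
  | pair f g ihf ihg =>
    obtain ⟨d, hd⟩ := ihf hP.1 x
    obtain ⟨e, he⟩ := ihg hP.2 x
    refine ⟨d.bind fun a => e.bind fun b => PMF.pure (.pair a b), fun n => ?_⟩
    rw [run_pair, hd, he, ← ROM.sample_bind_sample]
    refine congrArg _ (funext fun a => ?_)
    rw [← ROM.sample_bind_sample]
    simp only [ROM.sample_pure]
  | ite c f g ihc ihf ihg =>
    obtain ⟨d, hd⟩ := ihc hP.1 x
    obtain ⟨e, he⟩ := ihf hP.2.1 x
    obtain ⟨e', he'⟩ := ihg hP.2.2 x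
    refine ⟨d.bind fun b => if b = .num 0 then e' else e, fun n => ?_⟩
    rw [run_ite, hd, ← ROM.sample_bind_sample]
    congr 1
    funext b
    split_ifs
    · exact he' n
    · exact he n
  | loop f ih =>
    by_cases h : ∃ k y, x = .pair (.num k) y
    · obtain ⟨k, y, rfl⟩ := h
      have key : ∀ k y, ∃ d : PMF Val, ∀ n, iterRun (f.run n) k y = ROM.sample d := by
        intro k
        induction k with
        | zero => exact fun y => ⟨PMF.pure y, fun n => by rw [ROM.sample_pure]; rfl⟩
        | succ k ihk =>
          intro y
          obtain ⟨d, hd⟩ := ih hP y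
          choose e he using ihk
          refine ⟨d.bind e, fun n => ?_⟩
          rw [iterRun, hd, ← ROM.sample_bind_sample]
          exact congrArg _ (funext fun a => he a n)
      obtain ⟨d, hd⟩ := key k y
      exact ⟨d, fun n => by rw [run_loop, hd]⟩
    · push Not at h
      exact ⟨PMF.pure x, fun n => by rw [run_loop_of_ne f x h, ROM.sample_pure]⟩
  | coin => exact ⟨_, fun n => run_coin x⟩
  | query => exact hP.elim

/-- `P.Steps n x s y t s'`: with positive probability, `P` started on input `x` with log `s` halts
after `t` steps with output `y` and log `s'`. -/
def Steps (n : ℕ) (P : Prog) (x : Val) (s : OracleLog n) (y : Val) (t : ℕ) (s' : OracleLog n) :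
    Prop :=
  ((y, t), s') ∈ (P.eval n x s).support

theorem mem_support_bind {α β : Type} {m : ROM n α} {k : α → ROM n β} {s : OracleLog n}
    {b : β} {s' : OracleLog n} :
    (b, s') ∈ ((m >>= k) s).support ↔
      ∃ a s₁, (a, s₁) ∈ (m s).support ∧ (b, s') ∈ (k a s₁).support := by
  rw [ROM.bind_apply, PMF.mem_support_bind_iff]
  simp

theorem mem_support_pure {α : Type} {a b : α} {s s' : OracleLog n} :
    (b, s') ∈ ((pure a : ROM n α) s).support ↔ b = a ∧ s' = s := by
  rw [ROM.pure_apply, PMF.mem_support_pure_iff, Prod.mk.injEq]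

variable {x y : Val} {t : ℕ} {s s' : OracleLog n}

theorem steps_prim {o : Op} : (prim o).Steps n x s y t s' ↔
    y = o.eval x ∧ t = 1 + x.size + y.size ∧ s' = s := by
  rw [Steps, eval, mem_support_pure, Prod.mk.injEq, and_assoc]
  constructor <;> rintro ⟨rfl, rfl, rfl⟩ <;> simp

theorem steps_comp {g f : Prog} : (comp g f).Steps n x s y t s' ↔
    ∃ y₁ t₁ s₁ t₂, f.Steps n x s y₁ t₁ s₁ ∧ g.Steps n y₁ s₁ y t₂ s' ∧ t = t₁ + t₂ + 1 := by
  simp only [Steps, eval, mem_support_bind, mem_support_pure, Prod.exists, Prod.mk.injEq]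
  constructor
  · rintro ⟨y₁, t₁, s₁, h₁, y₂, t₂, s₂, h₂, ⟨rfl, rfl⟩, rfl⟩
    exact ⟨y₁, t₁, s₁, t₂, h₁, h₂, rfl⟩
  · rintro ⟨y₁, t₁, s₁, t₂, h₁, h₂, rfl⟩
    exact ⟨y₁, t₁, s₁, h₁, y, t₂, s', h₂, ⟨rfl, rfl⟩, rfl⟩

theorem steps_pair {f g : Prog} : (pair f g).Steps n x s y t s' ↔
    ∃ y₁ t₁ s₁ y₂ t₂, f.Steps n x s y₁ t₁ s₁ ∧ g.Steps n x s₁ y₂ t₂ s' ∧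
      y = .pair y₁ y₂ ∧ t = t₁ + t₂ + 1 := by
  simp only [Steps, eval, mem_support_bind, mem_support_pure, Prod.exists, Prod.mk.injEq]
  constructor
  · rintro ⟨y₁, t₁, s₁, h₁, y₂, t₂, s₂, h₂, ⟨rfl, rfl⟩, rfl⟩
    exact ⟨y₁, t₁, s₁, y₂, t₂, h₁, h₂, rfl, rfl⟩
  · rintro ⟨y₁, t₁, s₁, y₂, t₂, h₁, h₂, rfl, rfl⟩
    exact ⟨y₁, t₁, s₁, h₁, y₂, t₂, s', h₂, ⟨rfl, rfl⟩, rfl⟩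

theorem steps_ite {c f g : Prog} : (ite c f g).Steps n x s y t s' ↔
    ∃ b t₁ s₁ t₂, c.Steps n x s b t₁ s₁ ∧
      (if b = .num 0 then g else f).Steps n x s₁ y t₂ s' ∧ t = t₁ + t₂ + 1 := by
  simp only [Steps, eval, mem_support_bind, Prod.exists]
  constructor
  · rintro ⟨b, t₁, s₁, h₁, h₂⟩
    split_ifs at h₂ with hb
    all_goals
      simp only [mem_support_bind, mem_support_pure, Prod.exists, Prod.mk.injEq] at h₂
      obtain ⟨y₂, t₂, s₂, h₂, ⟨rfl, rfl⟩, rfl⟩ := h₂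
      exact ⟨b, t₁, s₁, t₂, h₁, by simpa only [hb, if_true, if_false] using h₂, rfl⟩
  · rintro ⟨b, t₁, s₁, t₂, h₁, h₂, rfl⟩
    refine ⟨b, t₁, s₁, h₁, ?_⟩
    split_ifs at h₂ ⊢
    all_goals
      simp only [mem_support_bind, mem_support_pure, Prod.exists, Prod.mk.injEq]
      exact ⟨y, t₂, s', h₂, ⟨rfl, rfl⟩, rfl⟩

theorem steps_coin : coin.Steps n x s y t s' ↔
    ∃ b : Bool, y = .num b.toNat ∧ t = 3 + x.size ∧ s' = s := by
  simp only [Steps, eval, mem_support_bind, mem_support_pure, Prod.mk.injEq]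
  constructor
  · rintro ⟨b, s₁, h, ⟨rfl, rfl⟩, rfl⟩
    rw [ROM.sample_apply, PMF.mem_support_bind_iff] at h
    obtain ⟨a, -, h⟩ := h
    rw [PMF.mem_support_pure_iff, Prod.mk.injEq] at h
    exact ⟨b, rfl, rfl, h.2⟩
  · rintro ⟨b, rfl, rfl, rfl⟩
    refine ⟨b, s', ?_, ⟨rfl, rfl⟩, rfl⟩
    rw [ROM.sample_apply, PMF.mem_support_bind_iff]
    exact ⟨b, by simp, by simp⟩

theorem steps_query_pair {ctx q : Val} : query.Steps n (.pair ctx q) s y t s' ↔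
    ∃ a : Fin (2 ^ n), (a, s') ∈ (ROM.query ctx q s).support ∧ y = .num a ∧
      t = 1 + (Val.pair ctx q).size + (Val.num a).size := by
  simp only [Steps, eval, mem_support_bind, mem_support_pure, Prod.mk.injEq]
  constructor
  · rintro ⟨b, s₁, h, ⟨rfl, rfl⟩, rfl⟩
    exact ⟨b, h, rfl, rfl⟩
  · rintro ⟨b, h, rfl, rfl⟩
    exact ⟨b, s', h, ⟨rfl, rfl⟩, rfl⟩

theorem steps_query_num {k : ℕ} : query.Steps n (.num k) s y t s' ↔
    y = .num 0 ∧ t = 2 + (Val.num k).size ∧ s' = s := by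
  simp only [Steps, eval, mem_support_pure, Prod.mk.injEq, and_assoc]

/-- `IterSteps f k x s y t s'`: the analogue of `Steps` for `k`-fold iteration of `f`. -/
def IterSteps (n : ℕ) (f : Prog) (k : ℕ) (x : Val) (s : OracleLog n) (y : Val) (t : ℕ)
    (s' : OracleLog n) : Prop :=
  ((y, t), s') ∈ (iterate (f.eval n) k x s).support

theorem iterSteps_zero {f : Prog} : IterSteps n f 0 x s y t s' ↔ y = x ∧ t = 0 ∧ s' = s := by
  rw [IterSteps, iterate, mem_support_pure, Prod.mk.injEq, and_assoc]

theorem iterSteps_succ {f : Prog} {k : ℕ} : IterSteps n f (k + 1) x s y t s' ↔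
    ∃ y₁ t₁ s₁ t₂, f.Steps n x s y₁ t₁ s₁ ∧ IterSteps n f k y₁ s₁ y t₂ s' ∧
      t = t₁ + t₂ + 1 := by
  simp only [Steps, IterSteps, iterate, mem_support_bind, mem_support_pure, Prod.exists,
    Prod.mk.injEq]
  constructor
  · rintro ⟨y₁, t₁, s₁, h₁, y₂, t₂, s₂, h₂, ⟨rfl, rfl⟩, rfl⟩
    exact ⟨y₁, t₁, s₁, t₂, h₁, h₂, rfl⟩
  · rintro ⟨y₁, t₁, s₁, t₂, h₁, h₂, rfl⟩
    exact ⟨y₁, t₁, s₁, h₁, y, t₂, s', h₂, ⟨rfl, rfl⟩, rfl⟩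

theorem steps_loop {f : Prog} {k : ℕ} {v : Val} :
    (loop f).Steps n (.pair (.num k) v) s y t s' ↔
      ∃ t₁, IterSteps n f k v s y t₁ s' ∧ t = t₁ + (Val.pair (.num k) v).size + 1 := by
  simp only [Steps, IterSteps, eval, mem_support_bind, mem_support_pure, Prod.exists,
    Prod.mk.injEq]
  constructor
  · rintro ⟨y₁, t₁, s₁, h₁, ⟨rfl, rfl⟩, rfl⟩
    exact ⟨t₁, h₁, rfl⟩
  · rintro ⟨t₁, h₁, rfl⟩
    exact ⟨y, t₁, s', h₁, ⟨rfl, rfl⟩, rfl⟩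

theorem steps_loop_of_ne {f : Prog} (h : ∀ k v, x ≠ .pair (.num k) v) :
    (loop f).Steps n x s y t s' ↔ y = x ∧ t = 1 + 2 * x.size ∧ s' = s := by
  match x, h with
  | .pair (.num k) y, h => exact absurd rfl (h k y)
  | .num k, _ => simp only [Steps, eval, mem_support_pure, Prod.mk.injEq, and_assoc]
  | .pair (.pair _ _) _, _ => simp only [Steps, eval, mem_support_pure, Prod.mk.injEq, and_assoc]

/-- Reading the input and writing the output are paid for. -/
theorem Steps.size_le {P : Prog} (h : P.Steps n x s y t s') : x.size ≤ t ∧ y.size ≤ t := by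
  induction P generalizing x y s t s' with
  | prim o =>
    obtain ⟨-, rfl, -⟩ := steps_prim.1 h
    omega
  | comp g f ihg ihf =>
    obtain ⟨y₁, t₁, s₁, t₂, h₁, h₂, rfl⟩ := steps_comp.1 h
    have := ihf h₁
    have := ihg h₂
    omega
  | pair f g ihf ihg =>
    obtain ⟨y₁, t₁, s₁, y₂, t₂, h₁, h₂, rfl, rfl⟩ := steps_pair.1 h
    have := ihf h₁
    have := ihg h₂
    simp only [Val.size_pair]
    omega
  | ite c f g ihc ihf ihg =>
    obtain ⟨b, t₁, s₁, t₂, h₁, h₂, rfl⟩ := steps_ite.1 h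
    have := ihc h₁
    split_ifs at h₂ with hb
    · have := ihg h₂
      omega
    · have := ihf h₂
      omega
  | loop f ih =>
    by_cases hx : ∃ k v, x = .pair (.num k) v
    · obtain ⟨k, v, rfl⟩ := hx
      obtain ⟨t₁, h₁, rfl⟩ := steps_loop.1 h
      have key : ∀ k v s t₁, IterSteps n f k v s y t₁ s' → y.size ≤ max t₁ v.size := by
        intro k
        induction k with
        | zero =>
          intro v s t₁ h
          obtain ⟨rfl, rfl, rfl⟩ := iterSteps_zero.1 h
          simp
        | succ k ihk =>
          intro v s t₁ h
          obtain ⟨y₁, t₁, s₁, t₂, h₁, h₂, rfl⟩ := iterSteps_succ.1 h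
          have := ihk _ _ _ h₂
          have := ih h₁
          omega
      have := key _ _ _ _ h₁
      simp only [Val.size_pair]
      omega
    · push Not at hx
      obtain ⟨rfl, rfl, rfl⟩ := (steps_loop_of_ne hx).1 h
      omega
  | coin =>
    obtain ⟨b, rfl, rfl, -⟩ := steps_coin.1 h
    cases b <;> simp <;> omega
  | query =>
    cases x with
    | num k =>
      obtain ⟨rfl, rfl, -⟩ := steps_query_num.1 h
      simp
      omega
    | pair a b =>
      obtain ⟨y, -, rfl, rfl⟩ := steps_query_pair.1 h
      omega

theorem Steps.one_le {P : Prog} (h : P.Steps n x s y t s') : 1 ≤ t :=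
  x.one_le_size.trans h.size_le.1

theorem exists_steps {P : Prog} (h : (y, s') ∈ (P.run n x s).support) :
    ∃ t, P.Steps n x s y t s' := by
  rw [run, ROM.map_apply, PMF.mem_support_map_iff] at h
  obtain ⟨⟨⟨y₁, t⟩, s₁⟩, h, he⟩ := h
  obtain ⟨rfl, rfl⟩ := Prod.mk.inj he
  exact ⟨t, h⟩

theorem Steps.mem_support_run {P : Prog} (h : P.Steps n x s y t s') :
    (y, s') ∈ (P.run n x s).support := by
  rw [run, ROM.map_apply, PMF.mem_support_map_iff]
  exact ⟨((y, t), s'), h, rfl⟩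

theorem Steps.eq_of_run_eq_pure {P : Prog} {v : Val} (h : P.Steps n x s y t s')
    (hr : P.run n x = pure v) : y = v ∧ s' = s := by
  have := h.mem_support_run
  rwa [hr, mem_support_pure] at this

/-- A program is deterministic on an input on which all its outputs agree. -/
theorem OracleFree.run_eq_pure {P : Prog} (hP : P.OracleFree) {v : Val}
    (h : ∀ s : OracleLog n, ∀ o ∈ (P.eval n x s).support, o.1.1 = v) : P.run n x = pure v := by
  obtain ⟨d, hd⟩ := hP.exists_run_eq_sample x
  have hsup : d.support = {v} := by
    refine Set.eq_singleton_iff_nonempty_unique_mem.2 ⟨d.support_nonempty, fun y hy => ?_⟩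
    have hm : (y, ([] : OracleLog n)) ∈ (P.run n x []).support := by
      rw [hd, ROM.sample_apply, PMF.mem_support_bind_iff]
      exact ⟨y, hy, by simp⟩
    obtain ⟨t, ht⟩ := exists_steps hm
    exact h _ _ ht
  have hv : d = PMF.pure v := by
    ext a
    by_cases ha : a = v
    · subst ha
      rw [PMF.pure_apply_self, (PMF.apply_eq_one_iff d a).2 hsup]
    · rw [PMF.pure_apply_of_ne _ _ ha, PMF.apply_eq_zero_iff, hsup]
      simpa using ha
  rw [hd, hv, ROM.sample_pure]

/-! ### Closure properties of polynomial time -/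

theorem eval_mono (q : ℕ[X]) {a b : ℕ} (h : a ≤ b) : q.eval a ≤ q.eval b := by
  induction q using Polynomial.induction_on' with
  | add p q hp hq => simpa using add_le_add hp hq
  | monomial k c =>
    simp only [Polynomial.eval_monomial]
    gcongr

theorem ppt_iff {P : Prog} : P.PPT ↔ ∃ q : ℕ[X], ∀ n x s y t s',
    P.Steps n x s y t s' → t ≤ q.eval (n + x.size) := by
  constructor
  · rintro ⟨q, hq⟩
    exact ⟨q, fun n x s y t s' h => hq n x s _ h⟩
  · rintro ⟨q, hq⟩
    exact ⟨q, fun n x s o ho => hq n x s o.1.1 o.1.2 o.2 ho⟩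


theorem PPT.comp {g f : Prog} (hg : g.PPT) (hf : f.PPT) : (comp g f).PPT := by
  obtain ⟨p, hp⟩ := ppt_iff.1 hf
  obtain ⟨q, hq⟩ := ppt_iff.1 hg
  refine ppt_iff.2 ⟨p + q.comp (.X + p) + 1, fun n x s y t s' hs => ?_⟩
  obtain ⟨y₁, t₁, s₁, t₂, h₁, h₂, rfl⟩ := steps_comp.1 hs
  have a := hp _ _ _ _ _ _ h₁
  have b := (hq _ _ _ _ _ _ h₂).trans
    (eval_mono q (show n + y₁.size ≤ n + x.size + p.eval (n + x.size) by
      have := h₁.size_le.2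
      omega))
  simp only [Polynomial.eval_add, Polynomial.eval_comp, Polynomial.eval_one, Polynomial.eval_X]
  omega

theorem PPT.pair {f g : Prog} (hf : f.PPT) (hg : g.PPT) : (pair f g).PPT := by
  obtain ⟨p, hp⟩ := ppt_iff.1 hf
  obtain ⟨q, hq⟩ := ppt_iff.1 hg
  refine ppt_iff.2 ⟨p + q + 1, fun n x s y t s' hs => ?_⟩
  obtain ⟨y₁, t₁, s₁, y₂, t₂, h₁, h₂, rfl, rfl⟩ := steps_pair.1 hs
  have a := hp _ _ _ _ _ _ h₁
  have b := hq _ _ _ _ _ _ h₂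
  simp only [Polynomial.eval_add, Polynomial.eval_one]
  omega

theorem PPT.ite {c f g : Prog} (hc : c.PPT) (hf : f.PPT) (hg : g.PPT) : (ite c f g).PPT := by
  obtain ⟨r, hr⟩ := ppt_iff.1 hc
  obtain ⟨p, hp⟩ := ppt_iff.1 hf
  obtain ⟨q, hq⟩ := ppt_iff.1 hg
  refine ppt_iff.2 ⟨r + p + q + 1, fun n x s y t s' hs => ?_⟩
  obtain ⟨b, t₁, s₁, t₂, h₁, h₂, rfl⟩ := steps_ite.1 hs
  have a := hr _ _ _ _ _ _ h₁
  simp only [Polynomial.eval_add, Polynomial.eval_one]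
  split_ifs at h₂
  · have b := hq _ _ _ _ _ _ h₂
    omega
  · have b := hp _ _ _ _ _ _ h₂
    omega

theorem ppt_coin : coin.PPT := by
  refine ppt_iff.2 ⟨.X + 3, fun n x s y t s' hs => ?_⟩
  obtain ⟨b, -, rfl, -⟩ := steps_coin.1 hs
  simp only [Polynomial.eval_add, Polynomial.eval_X, Polynomial.eval_ofNat]
  omega

theorem _root_.Nat.size_add_le (a b : ℕ) : (a + b).size ≤ a.size + b.size + 1 := by
  rw [Nat.size_le]
  have ha := Nat.lt_size_self a
  have hb := Nat.lt_size_self b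
  have h1 : 2 ^ a.size ≤ 2 ^ (a.size + b.size) := Nat.pow_le_pow_right (by norm_num) (by omega)
  have h2 : 2 ^ b.size ≤ 2 ^ (a.size + b.size) := Nat.pow_le_pow_right (by norm_num) (by omega)
  rw [pow_succ]
  omega

theorem _root_.Nat.size_mul_le (a b : ℕ) : (a * b).size ≤ a.size + b.size := by
  rw [Nat.size_le, pow_add]
  exact Nat.mul_lt_mul'' (Nat.lt_size_self a) (Nat.lt_size_self b)

theorem _root_.Nat.size_le_self (a : ℕ) : a.size ≤ a := Nat.size_le.2 a.lt_two_pow_self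

theorem _root_.Op.size_eval_le (o : Op) (h : ∀ v, o ≠ .const v) (x : Val) :
    (o.eval x).size ≤ 2 + x.size := by
  have h0 : Nat.size 1 = 1 := Nat.size_one
  have hx := x.one_le_size
  unfold Op.eval
  split
  any_goals simp only [Val.size_pair, Val.size_num, Nat.size_zero]
  any_goals omega
  · exact absurd rfl (h _)
  · split_ifs <;> simp only [Val.size_num, Nat.size_zero] <;> omega
  · split_ifs <;> simp only [Val.size_num, Nat.size_zero] <;> omega
  case h_8 a b =>
    have := Nat.size_add_le a b
    omega
  case h_9 a b =>
    have := Nat.size_le_size (Nat.sub_le a b)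
    omega
  case h_10 a b =>
    have := Nat.size_mul_le a b
    omega
  case h_11 a b =>
    have := Nat.size_le_size (Nat.div_le_self a b)
    omega
  case h_12 a b =>
    have := Nat.size_le_size (Nat.mod_le a b)
    omega
  case h_13 =>
    have := Nat.size_le_self x.size
    omega

theorem ppt_prim (o : Op) : (prim o).PPT := by
  obtain ⟨c, hc⟩ : ∃ c, ∀ x, (o.eval x).size ≤ c + x.size := by
    by_cases h : ∃ v, o = .const v
    · obtain ⟨v, rfl⟩ := h
      exact ⟨v.size, fun x => Nat.le_add_right _ _⟩
    · push Not at h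
      exact ⟨2, Op.size_eval_le o h⟩
  refine ppt_iff.2 ⟨1 + .C c + 2 * .X, fun n x s y t s' hs => ?_⟩
  obtain ⟨rfl, rfl, -⟩ := steps_prim.1 hs
  have := hc x
  simp only [Polynomial.eval_add, Polynomial.eval_mul, Polynomial.eval_one, Polynomial.eval_C,
    Polynomial.eval_X, Polynomial.eval_ofNat]
  omega

end Prog

/-! ### Programming in polynomial time -/

namespace Prog

variable {n : ℕ} {x y : Val}

def fst : Prog := prim .fst
def snd : Prog := prim .snd
def const (v : Val) : Prog := prim (.const v)

/-- The binary operation `o` applied to the results of `f` and `g`. -/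
def bin (o : Op) (f g : Prog) : Prog := comp (prim o) (pair f g)

@[simp] theorem run_fst (a b : Val) : fst.run n (.pair a b) = pure a := run_prim _ _
@[simp] theorem run_snd (a b : Val) : snd.run n (.pair a b) = pure b := run_prim _ _
@[simp] theorem run_const (v : Val) : (const v).run n x = pure v := run_prim _ _
@[simp] theorem run_id : (prim .id).run n x = pure x := run_prim _ _
@[simp] theorem run_size : (prim .size).run n x = pure (.num x.size) := run_prim _ _

@[simp] theorem run_bin (o : Op) (f g : Prog) : (bin o f g).run n x =
    f.run n x >>= fun a => g.run n x >>= fun b => pure (o.eval (.pair a b)) := by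
  simp [bin]

theorem ppt_fst : fst.PPT := ppt_prim _
theorem ppt_snd : snd.PPT := ppt_prim _
theorem ppt_const (v : Val) : (const v).PPT := ppt_prim _
theorem PPT.bin {f g : Prog} (hf : f.PPT) (hg : g.PPT) (o : Op) : (bin o f g).PPT :=
  (ppt_prim o).comp (hf.pair hg)

@[simp] theorem oracleFree_fst : fst.OracleFree := trivial
@[simp] theorem oracleFree_snd : snd.OracleFree := trivial
@[simp] theorem oracleFree_const (v : Val) : (const v).OracleFree := trivial
@[simp] theorem oracleFree_prim (o : Op) : (prim o).OracleFree := trivial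
@[simp] theorem oracleFree_coin : coin.OracleFree := trivial
@[simp] theorem oracleFree_comp {g f : Prog} :
    (comp g f).OracleFree ↔ g.OracleFree ∧ f.OracleFree := Iff.rfl
@[simp] theorem oracleFree_pair {g f : Prog} :
    (pair g f).OracleFree ↔ g.OracleFree ∧ f.OracleFree := Iff.rfl
@[simp] theorem oracleFree_ite {c g f : Prog} :
    (ite c g f).OracleFree ↔ c.OracleFree ∧ g.OracleFree ∧ f.OracleFree := Iff.rfl
@[simp] theorem oracleFree_loop {f : Prog} : (loop f).OracleFree ↔ f.OracleFree := Iff.rfl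
@[simp] theorem oracleFree_bin {o : Op} {g f : Prog} :
    (bin o g f).OracleFree ↔ g.OracleFree ∧ f.OracleFree := by simp [bin]

/-- Computes `(|x| + c) ^ k`. -/
def powSize (c : ℕ) : ℕ → Prog
  | 0 => const (.num 1)
  | k + 1 => bin .mul (powSize c k) (bin .add (prim .size) (const (.num c)))

@[simp] theorem run_powSize (c k : ℕ) :
    (powSize c k).run n x = pure (.num ((x.size + c) ^ k)) := by
  induction k with
  | zero => simp [powSize]
  | succ k ih => simp [powSize, ih, Op.eval, pow_succ]

theorem ppt_powSize (c k : ℕ) : (powSize c k).PPT := by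
  induction k with
  | zero => exact ppt_const _
  | succ k ih => exact ih.bin ((ppt_prim _).bin (ppt_const _) _) _

@[simp] theorem oracleFree_powSize (c k : ℕ) : (powSize c k).OracleFree := by
  induction k with
  | zero => simp [powSize]
  | succ k ih => simp [powSize, ih]

/-- Replace values of more than `B` bits by `0`. -/
def clip (B : ℕ) (v : Val) : Val := if B < v.size then .num 0 else v

theorem clip_of_le {B : ℕ} {v : Val} (h : v.size ≤ B) : clip B v = v := if_neg (by omega)

theorem size_clip_le (B : ℕ) (v : Val) : (clip B v).size ≤ max B 1 := by
  unfold clip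
  split_ifs
  · simp
  · omega

/-- On `(B, y)`: apply `f` to `y` and clip the result to `B` bits. -/
def clipBody (f : Prog) : Prog :=
  comp (pair fst (ite (bin .lt fst (comp (prim .size) snd)) (const (.num 0)) snd))
    (pair fst (comp f snd))

theorem run_clipBody (f : Prog) (B : ℕ) : (clipBody f).run n (.pair (.num B) y) =
    (fun v => Val.pair (.num B) (clip B v)) <$> f.run n y := by
  rw [map_eq_bind_pure_comp]
  simp only [clipBody, run_comp, run_pair, run_fst, run_snd, pure_bind, bind_assoc, run_ite,
    run_bin, run_size, run_const]
  congr 1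
  funext v
  by_cases h : B < v.size <;> simp [h, Op.eval, clip]

theorem PPT.clipBody {f : Prog} (hf : f.PPT) : (clipBody f).PPT :=
  (ppt_fst.pair ((ppt_fst.bin ((ppt_prim _).comp ppt_snd) _).ite (ppt_const _) ppt_snd)).comp
    (ppt_fst.pair (hf.comp ppt_snd))

/-- Iterate `f` as often as `cnt` says, starting from `init`, where intermediate results of more
than `(|x| + c) ^ k` bits are replaced by `0`. The clipping makes the loop run in polynomial time on
every input, whatever `f` does. -/
def clipLoop (cnt init f : Prog) (c k : ℕ) : Prog :=
  comp snd (comp (loop (clipBody f)) (pair cnt (pair (powSize c k) init)))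

theorem iterRun_clipBody (f : Prog) (B j : ℕ) :
    iterRun ((clipBody f).run n) j (.pair (.num B) y) =
      (fun v => Val.pair (.num B) v) <$> iterRun (fun v => clip B <$> f.run n v) j y := by
  induction j generalizing y with
  | zero => simp [iterRun]
  | succ j ih => simp [iterRun, run_clipBody, ih]

theorem run_clipLoop {cnt init f : Prog} {c k j : ℕ} (hcnt : cnt.run n x = pure (.num j)) :
    (clipLoop cnt init f c k).run n x =
      init.run n x >>= iterRun (fun v => clip ((x.size + c) ^ k) <$> f.run n v) j := by
  simp [clipLoop, hcnt, iterRun_clipBody]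

@[simp] theorem oracleFree_clipLoop {cnt init f : Prog} {c k : ℕ} :
    (clipLoop cnt init f c k).OracleFree ↔
      cnt.OracleFree ∧ init.OracleFree ∧ f.OracleFree := by
  simp [clipLoop, clipBody]
  tauto

/-- The clipped values stay below the bound `Z`, hence so does the cost of one iteration. -/
theorem IterSteps.clipBody_le {f : Prog} {q : ℕ[X]}
    (hq : ∀ n x s y t s', (clipBody f).Steps n x s y t s' → t ≤ q.eval (n + x.size))
    {B Z j : ℕ} (hB : B < Z) (hy : y.size ≤ Z) {s s' : OracleLog n} {v : Val} {t : ℕ}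
    (h : IterSteps n (clipBody f) j (.pair (.num B) y) s v t s') :
    t ≤ j * (q.eval (n + (2 * Z + 2)) + 1) ∧ v.size ≤ 2 * Z + 2 := by
  have hBs := Nat.size_le_self B
  induction j generalizing y s t with
  | zero =>
    obtain ⟨rfl, rfl, rfl⟩ := iterSteps_zero.1 h
    simp only [Val.size_pair, Val.size_num]
    omega
  | succ j ih =>
    obtain ⟨y₁, t₁, s₁, t₂, h₁, h₂, rfl⟩ := iterSteps_succ.1 h
    have hm := h₁.mem_support_run
    rw [run_clipBody, ROM.map_apply, PMF.mem_support_map_iff] at hm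
    obtain ⟨r, -, hr⟩ := hm
    obtain ⟨rfl, -⟩ := Prod.mk.inj hr
    have hc := size_clip_le B r.1
    obtain ⟨i₁, i₂⟩ := ih (by omega) h₂
    have i₃ := (hq _ _ _ _ _ _ h₁).trans (eval_mono q (b := n + (2 * Z + 2)) (by
      simp only [Val.size_pair, Val.size_num]
      omega))
    refine ⟨?_, i₂⟩
    rw [add_mul]
    omega

theorem PPT.clipLoop {cnt init f : Prog} {c k : ℕ} (hc : cnt.PPT) (hi : init.PPT) (hf : f.PPT)
    (hcnt : ∀ n x, ∃ j ≤ (x.size + c) ^ k, cnt.run n x = pure (.num j)) :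
    (clipLoop cnt init f c k).PPT := by
  obtain ⟨p, hp⟩ := ppt_iff.1 (hc.pair ((ppt_powSize c k).pair hi))
  obtain ⟨q, hq⟩ := ppt_iff.1 hf.clipBody
  let z : ℕ[X] := p + (.X + .C c) ^ k + 1
  refine ppt_iff.2 ⟨p + z * (q.comp (.X + (2 * z + 2)) + 1) + 4 * z + p + 10,
    fun n x s y t s' hs => ?_⟩
  obtain ⟨y₁, t₁, s₁, t₂, h, h₂, rfl⟩ := steps_comp.1 hs
  obtain ⟨y₀, t₀, s₀, t₃, h₀, h₁, rfl⟩ := steps_comp.1 h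
  have b₀ := hp _ _ _ _ _ _ h₀
  have e₀ := h₀.size_le.2
  obtain ⟨yc, tc, sc, yr, tr, hc', hr', rfl, -⟩ := steps_pair.1 h₀
  obtain ⟨yp, tp, sp, yi, ti, hp', hi', rfl, -⟩ := steps_pair.1 hr'
  obtain ⟨j, hj, hrun⟩ := hcnt n x
  obtain ⟨rfl, -⟩ := hc'.eq_of_run_eq_pure hrun
  obtain ⟨rfl, -⟩ := hp'.eq_of_run_eq_pure (run_powSize c k)
  obtain ⟨t₄, h₄, rfl⟩ := steps_loop.1 h₁
  have hle : (x.size + c) ^ k ≤ (n + x.size + c) ^ k := Nat.pow_le_pow_left (by omega) k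
  have hz : z.eval (n + x.size) = p.eval (n + x.size) + (n + x.size + c) ^ k + 1 := by
    simp [z]
  simp only [Val.size_pair, Val.size_num] at e₀
  obtain ⟨b₄, b₅⟩ := h₄.clipBody_le hq (Z := z.eval (n + x.size)) (by omega) (by omega)
  obtain ⟨rfl, rfl, -⟩ := steps_prim.1 h₂
  have b₆ := Op.size_eval_le .snd (by simp) y₁
  have b₇ := b₄.trans (Nat.mul_le_mul (show j ≤ z.eval (n + x.size) by omega)
    (Nat.add_le_add_right (eval_mono q (show n + (2 * z.eval (n + x.size) + 2) ≤
      n + x.size + (2 * z.eval (n + x.size) + 2) by omega)) 1))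
  simp only [Polynomial.eval_add, Polynomial.eval_mul, Polynomial.eval_comp, Polynomial.eval_one,
    Polynomial.eval_X, Polynomial.eval_ofNat, Val.size_pair, Val.size_num]
  omega

/-- Every polynomial is bounded by one of the form `(m + c) ^ k`. -/
theorem exists_eval_le_pow (q : ℕ[X]) : ∃ c k, ∀ m, q.eval m ≤ (m + c) ^ k := by
  induction q using Polynomial.induction_on' with
  | add p q hp hq =>
    obtain ⟨c, k, h⟩ := hp
    obtain ⟨c', k', h'⟩ := hq
    refine ⟨c + c' + 2, k + k' + 1, fun m => ?_⟩
    have h₁ : (m + c) ^ k ≤ (m + (c + c' + 2)) ^ (k + k') :=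
      (Nat.pow_le_pow_left (by omega) k).trans (Nat.pow_le_pow_right (by omega) (by omega))
    have h₂ : (m + c') ^ k' ≤ (m + (c + c' + 2)) ^ (k + k') :=
      (Nat.pow_le_pow_left (by omega) k').trans (Nat.pow_le_pow_right (by omega) (by omega))
    have := h m
    have := h' m
    rw [Polynomial.eval_add, pow_succ]
    nlinarith
  | monomial k a =>
    refine ⟨a, k + 1, fun m => ?_⟩
    rw [Polynomial.eval_monomial, pow_succ, mul_comm]
    exact Nat.mul_le_mul (Nat.pow_le_pow_left (by omega) k) (by omega)

/-! ### Modular arithmetic and scalar multiplication -/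

/-- One step of double-and-add on `(params, (acc, (base, e)))`, where `op` computes the sum of `a`
and `b` from `(params, (a, b))`. -/
def dblAddStep (op : Prog) : Prog :=
  let par := fst
  let acc := comp fst snd
  let base := comp fst (comp snd snd)
  let e := comp snd (comp snd snd)
  pair par (pair
    (ite (bin .mod e (const (.num 2))) (comp op (pair par (pair acc base))) acc)
    (pair (comp op (pair par (pair base base))) (bin .div e (const (.num 2)))))

/-- Double-and-add: from `(params, (acc, (base, e)))` to `acc + e • base`. -/
def dblAdd (op : Prog) (c k : ℕ) : Prog :=
  comp (comp fst snd) (clipLoop (powSize c k) (prim .id) (dblAddStep op) c k)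

theorem PPT.dblAdd {op : Prog} (h : op.PPT) (c k : ℕ) : (dblAdd op c k).PPT := by
  have hs := ppt_snd
  have hf := ppt_fst
  have hss := hs.comp hs
  refine (hf.comp hs).comp ((ppt_powSize c k).clipLoop (ppt_prim _) (hf.pair (PPT.pair
    (PPT.ite ((hs.comp hss).bin (ppt_const _) _) (h.comp (hf.pair ((hf.comp hs).pair
      (hf.comp hss)))) (hf.comp hs)) (PPT.pair (h.comp (hf.pair ((hf.comp hss).pair
      (hf.comp hss)))) ((hs.comp hss).bin (ppt_const _) _)))) fun n x => ?_)
  exact ⟨_, le_rfl, run_powSize c k⟩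

theorem OracleFree.dblAdd {op : Prog} (h : op.OracleFree) (c k : ℕ) :
    (dblAdd op c k).OracleFree := by
  simp [Prog.dblAdd, dblAddStep, h]

theorem run_dblAddStep {M : Type} [AddMonoid M] {enc : M → Val} {op : Prog} {par : Val}
    (hop : ∀ a b, op.run n (.pair par (.pair (enc a) (enc b))) = pure (enc (a + b)))
    (a b : M) (e : ℕ) :
    (dblAddStep op).run n (.pair par (.pair (enc a) (.pair (enc b) (.num e)))) =
      pure (.pair par (.pair (enc (if e % 2 = 0 then a else a + b))
        (.pair (enc (b + b)) (.num (e / 2))))) := by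
  by_cases h : e % 2 = 0 <;> simp [dblAddStep, run_ite, Op.eval, h, hop]

/-- Double-and-add is correct as soon as the clipping bound `(m + c) ^ k`, which is also the number
of iterations, leaves room for two encoded elements besides the input. Iterations after the exponent
has reached `0` do not change the result. -/
theorem run_dblAdd {M : Type} [AddMonoid M] {enc : M → Val} {op : Prog} {par : Val}
    (hop : ∀ a b, op.run n (.pair par (.pair (enc a) (enc b))) = pure (enc (a + b)))
    {D : ℕ} (hD : ∀ a, (enc a).size ≤ D) {c k : ℕ} (a b : M) (e : ℕ)
    (hB : ∀ m, par.size + e.size ≤ m → m + 2 * D + 10 ≤ (m + c) ^ k) :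
    (dblAdd op c k).run n (.pair par (.pair (enc a) (.pair (enc b) (.num e)))) =
      pure (enc (a + e • b)) := by
  have key : ∀ (B j : ℕ) (a b : M) (e : ℕ), e < 2 ^ j → par.size + 2 * D + e.size + 4 ≤ B →
      ∃ b', iterRun (fun v => clip B <$> (dblAddStep op).run n v) j
        (.pair par (.pair (enc a) (.pair (enc b) (.num e)))) =
          pure (.pair par (.pair (enc (a + e • b)) b')) := by
    intro B j
    induction j with
    | zero =>
      intro a b e he hB
      obtain rfl : e = 0 := by simpa using he
      exact ⟨.pair (enc b) (.num 0), by simp [iterRun]⟩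
    | succ j ih =>
      intro a b e he hB
      have hs := Nat.size_le_size (Nat.div_le_self e 2)
      obtain ⟨b', hb'⟩ := ih (if e % 2 = 0 then a else a + b) (b + b) (e / 2)
        (by rw [pow_succ] at he; omega) (by omega)
      have hsum : (if e % 2 = 0 then a else a + b) + (e / 2) • (b + b) = a + e • b := by
        rw [← two_nsmul, ← mul_nsmul]
        conv_rhs => rw [← Nat.mod_add_div e 2]
        split_ifs with h
        · rw [h, zero_add]
        · rw [show e % 2 = 1 by omega, add_nsmul, one_nsmul, add_assoc]
      refine ⟨b', ?_⟩
      rw [iterRun, run_dblAddStep hop, map_pure, pure_bind, clip_of_le, hb', hsum]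
      have h₁ := hD (if e % 2 = 0 then a else a + b)
      have h₂ := hD (b + b)
      simp only [Val.size_pair, Val.size_num]
      omega
  set x := Val.pair par (.pair (enc a) (.pair (enc b) (.num e))) with hx
  have hxs : par.size + e.size ≤ x.size := by
    simp only [hx, Val.size_pair, Val.size_num]
    omega
  have hBx := hB x.size hxs
  obtain ⟨b', hb'⟩ := key ((x.size + c) ^ k) ((x.size + c) ^ k) a b e
    ((Nat.lt_size_self e).trans_le (Nat.pow_le_pow_right (by norm_num) (by omega))) (by omega)
  rw [dblAdd, run_comp, run_clipLoop (run_powSize c k), run_id, pure_bind, hb', pure_bind]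
  simp

/-- The product modulo `p`, from `(p, (a, b))`. -/
def mulOp : Prog := bin .mod (comp (prim .mul) snd) fst

/-- `a ^ e` modulo `p`, from `(p, (1, (a, e)))`. -/
def powModProg : Prog := dblAdd mulOp 10 2

/-- `f * g` modulo `pp`. -/
def mulMod (pp f g : Prog) : Prog := bin .mod (bin .mul f g) pp

/-- `f + g` modulo `pp`. -/
def addMod (pp f g : Prog) : Prog := bin .mod (bin .add f g) pp

/-- `f - g` modulo `pp`, for `g` reduced modulo `pp`. -/
def subMod (pp f g : Prog) : Prog := bin .mod (bin .add f (bin .sub pp g)) pp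

/-- The inverse of `f` modulo the prime `pp`, by Fermat's theorem. -/
def invMod (pp f : Prog) : Prog :=
  comp powModProg (pair pp (pair (const (.num 1)) (pair f (bin .sub pp (const (.num 2))))))

theorem ppt_powModProg : powModProg.PPT :=
  PPT.dblAdd (((ppt_prim _).comp ppt_snd).bin ppt_fst _) _ _

theorem oracleFree_powModProg : powModProg.OracleFree :=
  OracleFree.dblAdd (by simp [mulOp]) _ _

section Mod

variable {pp f g : Prog}

theorem PPT.mulMod (hp : pp.PPT) (hf : f.PPT) (hg : g.PPT) : (mulMod pp f g).PPT :=
  (hf.bin hg _).bin hp _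

theorem PPT.addMod (hp : pp.PPT) (hf : f.PPT) (hg : g.PPT) : (addMod pp f g).PPT :=
  (hf.bin hg _).bin hp _

theorem PPT.subMod (hp : pp.PPT) (hf : f.PPT) (hg : g.PPT) : (subMod pp f g).PPT :=
  (hf.bin (hp.bin hg _) _).bin hp _

theorem PPT.invMod (hp : pp.PPT) (hf : f.PPT) : (invMod pp f).PPT :=
  ppt_powModProg.comp (hp.pair ((ppt_const _).pair (hf.pair (hp.bin (ppt_const _) _))))

variable {p : ℕ} [Fact p.Prime] {a b : ZMod p}

theorem run_mulMod (hp : pp.run n x = pure (.num p)) (hf : f.run n x = pure (.num a.val))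
    (hg : g.run n x = pure (.num b.val)) :
    (mulMod pp f g).run n x = pure (.num (a * b).val) := by
  simp [mulMod, hp, hf, hg, Op.eval, ZMod.val_mul]

theorem run_addMod (hp : pp.run n x = pure (.num p)) (hf : f.run n x = pure (.num a.val))
    (hg : g.run n x = pure (.num b.val)) :
    (addMod pp f g).run n x = pure (.num (a + b).val) := by
  simp [addMod, hp, hf, hg, Op.eval, ZMod.val_add]

theorem run_subMod (hp : pp.run n x = pure (.num p)) (hf : f.run n x = pure (.num a.val))
    (hg : g.run n x = pure (.num b.val)) :
    (subMod pp f g).run n x = pure (.num (a - b).val) := by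
  have h : (a.val + (p - b.val)) % p = (a - b).val := by
    rw [← ZMod.val_natCast, Nat.cast_add, Nat.cast_sub (ZMod.val_lt b).le]
    simp [sub_eq_add_neg]
  simp [subMod, hp, hf, hg, Op.eval, h]

theorem run_invMod (hp : pp.run n x = pure (.num p)) (hf : f.run n x = pure (.num a.val))
    (ha : a ≠ 0) : (invMod pp f).run n x = pure (.num a⁻¹.val) := by
  have hp2 := (Fact.out : p.Prime).two_le
  have h1 : (1 : ZMod p).val = 1 := ZMod.val_one p
  have hinv : a ^ (p - 2) = a⁻¹ := by
    refine eq_inv_of_mul_eq_one_left ?_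
    rw [← pow_succ, show p - 2 + 1 = p - 1 by omega, ZMod.pow_card_sub_one_eq_one ha]
  let enc : Additive (ZMod p) → Val := fun a => .num a.toMul.val
  have hop : ∀ a b, mulOp.run n (.pair (.num p) (.pair (enc a) (enc b))) = pure (enc (a + b)) := by
    intro a b
    simp [mulOp, enc, Op.eval, ZMod.val_mul]
  have hD : ∀ a, (enc a).size ≤ (Val.num p).size := fun a => by
    have := Nat.size_le_size (ZMod.val_lt a.toMul).le
    simp only [enc, Val.size_num]
    omega
  have := run_dblAdd hop hD (c := 10) (k := 2) (Additive.ofMul 1) (Additive.ofMul a) (p - 2)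
    (fun m hm => by nlinarith)
  simp only [enc, toMul_add, toMul_nsmul, toMul_ofMul, one_mul, h1, hinv] at this
  simp [invMod, hp, hf, Op.eval, powModProg, this]

end Mod

end Prog

/-! ### Lazy sampling inside a program -/

theorem ROM.sample_map_bind {n : ℕ} {α β γ : Type} (d : PMF α) (f : α → β) (k : β → ROM n γ) :
    ROM.sample (d.map f) >>= k = ROM.sample d >>= fun a => k (f a) := by
  rw [← ROM.map_sample, bind_map_left]

/-- If `f` is a bijection from `α × β` to `γ`, it turns independent uniform values into a uniform
value. -/
theorem PMF.uniformOfFintype_bind_map {α β γ : Type} [Fintype α] [Nonempty α] [Fintype β]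
    [Nonempty β] [Fintype γ] [Nonempty γ] (f : α → β → γ)
    (hf : Function.Bijective (Function.uncurry f)) :
    ((PMF.uniformOfFintype α).bind fun a => (PMF.uniformOfFintype β).map (f a)) =
      PMF.uniformOfFintype γ := by
  classical
  have hcard : Fintype.card γ = Fintype.card α * Fintype.card β := by
    rw [← Fintype.card_prod, Fintype.card_of_bijective hf]
  ext c
  obtain ⟨⟨a, b⟩, rfl⟩ := hf.2 c
  have hinj : ∀ a' b', f a b = f a' b' → a = a' ∧ b = b' := fun a' b' h =>
    Prod.mk.inj (hf.1 (a₁ := (a, b)) (a₂ := (a', b')) h)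
  rw [PMF.bind_apply, tsum_fintype, Finset.sum_eq_single a, PMF.map_apply, tsum_fintype,
    Finset.sum_eq_single b]
  · simp only [Function.uncurry, if_true, PMF.uniformOfFintype_apply, hcard, Nat.cast_mul]
    rw [ENNReal.mul_inv] <;> simp
  · intro b' _ hb
    exact if_neg fun h => hb (hinj _ _ h).2.symm
  · simp
  · intro a' _ ha
    rw [PMF.map_apply, ENNReal.tsum_eq_zero.2, mul_zero]
    exact fun b' => if_neg fun h => ha (hinj _ _ h).1.symm
  · simp

namespace Prog

variable {n : ℕ} {x : Val}

/-- On input `u`: a uniform natural number of `|u| / 2` bits. -/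
def sampleBits : Prog :=
  clipLoop (bin .div (prim .size) (const (.num 2))) (const (.num 0))
    (bin .add (bin .mul (const (.num 2)) (prim .id)) coin) 10 2

theorem iterRun_sampleBits {B j m : ℕ} (hB : m.size + j + 1 ≤ B) :
    iterRun (fun v => clip B <$> (bin .add (bin .mul (const (.num 2)) (prim .id)) coin).run n v)
      j (.num m) = ROM.sample ((PMF.uniformOfFintype (Fin (2 ^ j))).map
        fun r : Fin (2 ^ j) => Val.num (m * 2 ^ j + r)) := by
  induction j generalizing m with
  | zero =>
    have : (PMF.uniformOfFintype (Fin (2 ^ 0))).map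
        (fun r : Fin (2 ^ 0) => Val.num (m * 2 ^ 0 + r)) =
        PMF.pure (.num m) := by
      rw [show (fun r : Fin (2 ^ 0) => Val.num (m * 2 ^ 0 + r)) = fun _ => Val.num m by
        funext r
        have : (r : ℕ) < 2 ^ 0 := r.2
        rw [show (r : ℕ) = 0 by omega]
        simp]
      exact PMF.map_const _ _
    rw [this, ROM.sample_pure]
    rfl
  | succ j ih =>
    have hstep : clip B <$> (bin .add (bin .mul (const (.num 2)) (prim .id)) coin).run n (.num m) =
        ROM.sample ((PMF.uniformOfFintype Bool).map fun b => .num (2 * m + b.toNat)) := by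
      simp only [run_bin, run_const, run_id, pure_bind, Op.eval, run_coin, ROM.sample_map_bind]
      rw [← ROM.map_sample, ← bind_pure_comp, ← bind_pure_comp, bind_assoc]
      refine congrArg _ (funext fun b => ?_)
      rw [pure_bind, clip_of_le]
      have h₂ : (2 * m + b.toNat).size ≤ m.size + 1 := by
        rw [Nat.size_le, pow_succ]
        have := Nat.lt_size_self m
        cases b <;> simp <;> omega
      rw [Val.size_num]
      omega
    -- A uniform `(j + 1)`-bit number consists of a leading bit and a uniform `j`-bit number.
    have hbij : Function.Bijective (Function.uncurry fun (b : Bool) (r : Fin (2 ^ j)) =>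
        (⟨b.toNat * 2 ^ j + r, by
          have := r.2
          rw [pow_succ]
          cases b <;> simp <;> omega⟩ : Fin (2 ^ (j + 1)))) := by
      rw [Fintype.bijective_iff_injective_and_card]
      refine ⟨?_, by simp [pow_succ, mul_comm]⟩
      rintro ⟨b, r⟩ ⟨b', r'⟩ h
      have h' : b.toNat * 2 ^ j + (r : ℕ) = b'.toNat * 2 ^ j + r' := congrArg Fin.val h
      have := r.2
      have := r'.2
      rw [Prod.mk.injEq, Fin.ext_iff]
      cases b <;> cases b' <;> simp at h' ⊢ <;> omega
    rw [iterRun, hstep, ROM.sample_map_bind, ← PMF.uniformOfFintype_bind_map _ hbij,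
      PMF.map_bind, ← ROM.sample_bind_sample]
    refine congrArg _ (funext fun b => ?_)
    rw [ih, PMF.map_comp]
    · congr 2
      funext r
      simp only [Function.comp]
      congr 1
      ring
    · have h₂ : (2 * m + b.toNat).size ≤ m.size + 1 := by
        rw [Nat.size_le, pow_succ]
        have := Nat.lt_size_self m
        cases b <;> simp <;> omega
      omega

theorem run_sampleBits (u : Val) : sampleBits.run n u =
    ROM.sample ((PMF.uniformOfFintype (Fin (2 ^ (u.size / 2)))).map
      fun r : Fin (2 ^ (u.size / 2)) => Val.num r) := by
  rw [sampleBits, run_clipLoop (j := u.size / 2) (by simp [Op.eval]), run_const, pure_bind,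
    iterRun_sampleBits]
  · simp
  · rw [Nat.size_zero]
    nlinarith [Nat.div_le_self u.size 2]

theorem ppt_sampleBits : sampleBits.PPT :=
  PPT.clipLoop ((ppt_prim _).bin (ppt_const _) _) (ppt_const _)
    (((ppt_const _).bin (ppt_prim _) _).bin ppt_coin _) fun n x =>
    ⟨x.size / 2, by nlinarith [Nat.div_le_self x.size 2], by simp [Op.eval]⟩

/-- The oracle log as a lookup table of entries `((ctx, x), y)`. -/
def encTable {m : ℕ} (s : OracleLog m) : Val :=
  .ofList (s.map fun e => .pair (.pair e.1 e.2.1) (.num e.2.2))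

/-- One step of the search in a table, on `(L, (v, res))`. Past the end of the table, `L` and all
its projections are `0`, which is not the pair `v`, so that further steps change nothing. -/
def lookupStep : Prog :=
  let res := comp snd snd
  let v := comp fst snd
  let entry := comp fst fst
  pair (comp snd fst) (pair v (ite (comp (prim .isPair) res) res
    (ite (bin .eq (comp fst entry) v) (pair (const (.num 0)) (comp snd entry)) res)))

/-- On `(L, v)`: `(0, y)` if the table `L` has an entry `(v, y)`, and `0` otherwise. -/
def lookup : Prog :=
  comp (comp snd snd) (clipLoop (powSize 10 2) (pair fst (pair snd (const (.num 0))))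
    lookupStep 10 2)

theorem ppt_lookup : lookup.PPT := by
  have hs := ppt_snd
  have hf := ppt_fst
  refine (hs.comp hs).comp ((ppt_powSize 10 2).clipLoop (hf.pair (hs.pair (ppt_const _)))
    ((hs.comp hf).pair ((hf.comp hs).pair (((ppt_prim _).comp (hs.comp hs)).ite (hs.comp hs)
      (((hf.comp (hf.comp hf)).bin (hf.comp hs) _).ite
        ((ppt_const _).pair (hs.comp (hf.comp hf))) (hs.comp hs))))) fun n x => ?_)
  exact ⟨_, le_rfl, run_powSize _ _⟩

/-- The result of `lookup` in the table of the log `s` for the call `(c, q)`. -/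
def lookupVal {m : ℕ} (c q : Val) (s : OracleLog m) : Val :=
  match s.find? (fun e => decide (e.1 = c ∧ e.2.1 = q)) with
  | some e => .pair (.num 0) (.num e.2.2)
  | none => .num 0

theorem iterRun_lookupStep_found {m : ℕ} (s : OracleLog m) (v a b : Val) {B j : ℕ}
    (hB : (encTable s).size + v.size + (Val.pair a b).size + 2 ≤ B) :
    ∃ L, iterRun (fun v => clip B <$> lookupStep.run n v) j
      (.pair (encTable s) (.pair v (.pair a b))) = pure (.pair L (.pair v (.pair a b))) := by
  induction j generalizing s with
  | zero => exact ⟨_, rfl⟩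
  | succ j ih =>
    have hstep : ∀ L, lookupStep.run n (.pair L (.pair v (.pair a b))) =
        pure (.pair (Op.snd.eval L) (.pair v (.pair a b))) := by
      intro L
      simp [lookupStep, run_ite, Op.eval, snd]
    cases s with
    | nil =>
      obtain ⟨L, hL⟩ := ih [] hB
      refine ⟨L, ?_⟩
      rw [iterRun, hstep, map_pure, pure_bind, clip_of_le, ← hL]
      · rfl
      · simp only [encTable, List.map_nil, Val.ofList, Val.size_pair, Op.eval] at hB ⊢
        omega
    | cons e s =>
      obtain ⟨L, hL⟩ := ih s (by
        simp only [encTable, List.map_cons, Val.ofList, Val.size_pair] at hB ⊢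
        omega)
      refine ⟨L, ?_⟩
      rw [iterRun, hstep, map_pure, pure_bind, clip_of_le, ← hL]
      · rfl
      · simp only [encTable, List.map_cons, Val.ofList, Val.size_pair, Op.eval] at hB ⊢
        omega

theorem iterRun_lookupStep {m : ℕ} (s : OracleLog m) (c q : Val) {B j : ℕ}
    (hB : (encTable s).size + (Val.pair c q).size + 3 ≤ B) (hj : s.length ≤ j) :
    ∃ L, iterRun (fun v => clip B <$> lookupStep.run n v) j
      (.pair (encTable s) (.pair (.pair c q) (.num 0))) =
        pure (.pair L (.pair (.pair c q) (lookupVal c q s))) := by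
  induction j generalizing s with
  | zero =>
    obtain rfl := List.length_eq_zero_iff.1 (Nat.le_zero.1 hj)
    exact ⟨_, rfl⟩
  | succ j ih =>
    cases s with
    | nil =>
      obtain ⟨L, hL⟩ := ih [] hB (Nat.zero_le _)
      refine ⟨L, ?_⟩
      have hstep : lookupStep.run n (.pair (.num 0) (.pair (.pair c q) (.num 0))) =
          pure (.pair (.num 0) (.pair (.pair c q) (.num 0))) := by
        simp [lookupStep, run_ite, Op.eval, snd, fst]
      change iterRun _ (j + 1) (.pair (.num 0) _) = _
      rw [iterRun, hstep, map_pure, pure_bind, clip_of_le, ← hL]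
      · rfl
      · simp only [encTable, List.map_nil, Val.ofList, Val.size_pair, Val.size_num, Nat.size_zero] at hB ⊢
        omega
    | cons e s =>
      have hstep : lookupStep.run n (.pair (encTable (e :: s)) (.pair (.pair c q) (.num 0))) =
          pure (.pair (encTable s) (.pair (.pair c q)
            (if e.1 = c ∧ e.2.1 = q then .pair (.num 0) (.num e.2.2) else .num 0))) := by
        by_cases h : e.1 = c ∧ e.2.1 = q <;>
          simp [lookupStep, run_ite, Op.eval, encTable, Val.ofList, h]
      have hB' : (encTable s).size + e.1.size + e.2.1.size + (Val.num e.2.2).size + 3 +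
          (Val.pair c q).size + 3 ≤ B := by
        simp only [encTable, List.map_cons, Val.ofList, Val.size_pair] at hB ⊢
        omega
      by_cases h : e.1 = c ∧ e.2.1 = q
      · obtain ⟨L, hL⟩ := iterRun_lookupStep_found (n := n) s (.pair c q) (.num 0) (.num e.2.2)
          (B := B) (j := j) (by
            simp only [Val.size_pair, Val.size_num, Nat.size_zero] at hB' ⊢
            omega)
        refine ⟨L, ?_⟩
        rw [iterRun, hstep, map_pure, pure_bind, clip_of_le, if_pos h, hL]
        · simp [lookupVal, h]
        · rw [if_pos h]
          simp only [Val.size_pair, Val.size_num, Nat.size_zero] at hB' ⊢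
          omega
      · obtain ⟨L, hL⟩ := ih s (by omega) (by simpa using hj)
        refine ⟨L, ?_⟩
        rw [iterRun, hstep, map_pure, pure_bind, clip_of_le, if_neg h, hL]
        · simp only [lookupVal, List.find?_cons, h, decide_false]
        · rw [if_neg h]
          simp only [Val.size_pair, Val.size_num, Nat.size_zero] at hB' ⊢
          omega

theorem length_le_size_encTable {m : ℕ} (s : OracleLog m) : s.length ≤ (encTable s).size := by
  induction s with
  | nil => simp
  | cons e s ih =>
    simp only [encTable, List.map_cons, Val.ofList, Val.size_pair, List.length_cons] at ih ⊢
    omega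

theorem run_lookup {m : ℕ} (s : OracleLog m) (c q : Val) :
    lookup.run n (.pair (encTable s) (.pair c q)) = pure (lookupVal c q s) := by
  set x := Val.pair (encTable s) (.pair c q) with hx
  have hxs : x.size = (encTable s).size + (Val.pair c q).size + 1 := rfl
  have hB : x.size + 10 ≤ (x.size + 10) ^ 2 := by nlinarith
  have hl := length_le_size_encTable s
  obtain ⟨L, hL⟩ := iterRun_lookupStep (n := n) s c q (B := (x.size + 10) ^ 2)
    (j := (x.size + 10) ^ 2) (by omega) (by omega)
  rw [lookup, run_comp, run_clipLoop (run_powSize 10 2), run_pair]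
  simp [hx] at hL ⊢
  simp [hL]

/-- The state of a simulation: `u` determines the range of the oracle, which is `|u| / 2` bits; the
lookup table is followed by the log of the context `ctx` in the form in which it is handed to
an extractor. -/
def encState (ctx u : Val) {m : ℕ} (s : OracleLog m) : Val :=
  .pair u (.pair (encTable s) (s.restrict ctx))

/-- On `(state, w)`: the lazily sampled answer to the oracle call `w`, as `(state', y)`. -/
def simQuery (ctx : Val) : Prog :=
  let st := comp fst snd
  let w := comp snd snd
  let L := comp fst (comp snd st)
  let R := comp snd (comp snd st)
  -- The inner program computes the answer `y`; the outer one receives `(y, (state, w))`, extends the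
  -- table and, for calls under `ctx`, the restricted log.
  ite (comp (prim .isPair) snd)
    (comp
      (pair (pair (comp fst st) (pair (pair (pair w fst) L)
        (ite (bin .eq (comp fst w) (const ctx))
          (pair (pair (comp fst w) (pair (comp snd w) fst)) R) R))) fst)
      (pair (comp (ite (comp (prim .isPair) fst) (comp snd fst)
          (comp sampleBits (comp fst (comp fst snd))))
          (pair (comp lookup (pair (comp fst (comp snd fst)) snd)) (prim .id)))
        (prim .id)))
    (pair fst (const (.num 0)))

theorem ppt_simQuery (ctx : Val) : (simQuery ctx).PPT := by
  have hs := ppt_snd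
  have hf := ppt_fst
  have hst := hf.comp hs
  have hw := hs.comp hs
  exact ((ppt_prim _).comp hs).ite
    ((((hf.comp hst).pair (((hw.pair hf).pair (hf.comp (hs.comp hst))).pair
      (((hf.comp hw).bin (ppt_const _) _).ite
        (((hf.comp hw).pair ((hs.comp hw).pair hf)).pair (hs.comp (hs.comp hst)))
        (hs.comp (hs.comp hst))))).pair hf).comp
      (((((ppt_prim _).comp hf).ite (hs.comp hf) (ppt_sampleBits.comp (hf.comp hst))).comp
        ((ppt_lookup.comp ((hf.comp (hs.comp hf)).pair hs)).pair (ppt_prim _))).pair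
        (ppt_prim _)))
    (hf.pair (ppt_const _))

/-- Output and final log of a simulated program, as data. -/
def simOut (ctx u : Val) {m : ℕ} (r : Val × OracleLog m) : Val := .pair (encState ctx u r.2) r.1

theorem restrict_cons (ctx : Val) {m : ℕ} (c q : Val) (y : Fin (2 ^ m)) (s : OracleLog m) :
    OracleLog.restrict ctx ((c, q, y) :: s) = if c = ctx then
      .pair (.pair c (.pair q (.num y))) (s.restrict ctx) else s.restrict ctx := by
  by_cases h : c = ctx <;> simp [OracleLog.restrict, h, Val.ofList]

theorem run_simQuery (ctx u x : Val) (s : OracleLog (u.size / 2)) :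
    (simQuery ctx).run n (.pair (encState ctx u s) x) =
      ROM.sample ((query.run (u.size / 2) x s).map (simOut ctx u)) := by
  cases x with
  | num k =>
    rw [run_query_num, ROM.pure_apply, PMF.pure_map, ROM.sample_pure]
    simp [simQuery, run_ite, Op.eval, simOut]
  | pair c q =>
    have hout : ∀ y : Fin (2 ^ (u.size / 2)),
        simOut ctx u (Val.num y, ((c, q, y) :: s)) = .pair (.pair u (.pair
          (.pair (.pair (.pair c q) (.num y)) (encTable s)) (if c = ctx then
            .pair (.pair c (.pair q (.num y))) (s.restrict ctx) else s.restrict ctx))) (.num y) := by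
      intro y
      rw [simOut, encState, restrict_cons]
      rfl
    rw [run_query_pair, ROM.map_apply, PMF.map_comp]
    cases hfind : s.find? (fun e => decide (e.1 = c ∧ e.2.1 = q)) with
    | some e =>
      have hl : lookupVal c q s = .pair (.num 0) (.num e.2.2) := by rw [lookupVal, hfind]
      have hq : ROM.query c q s = PMF.pure (e.2.2, (c, q, e.2.2) :: s) := by
        rw [ROM.query, hfind]
        rfl
      rw [hq, PMF.pure_map, ROM.sample_pure, Function.comp, hout]
      rcases eq_or_ne c ctx with rfl | h
      · simp [simQuery, run_ite, Op.eval, encState, run_lookup, hl]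
      · simp [simQuery, run_ite, Op.eval, encState, run_lookup, hl, h]
    | none =>
      have hl : lookupVal c q s = .num 0 := by rw [lookupVal, hfind]
      have hq : ROM.query c q s = (PMF.uniformOfFintype (Fin (2 ^ (u.size / 2)))).map
          fun y => (y, (c, q, y) :: s) := by
        rw [ROM.query, hfind]
        rfl
      rw [hq, PMF.map_comp, ← ROM.map_sample]
      have hfun : (simOut ctx u ∘ fun r : Fin (2 ^ (u.size / 2)) × OracleLog (u.size / 2) =>
          (Val.num r.1, r.2)) ∘ (fun y => (y, (c, q, y) :: s)) = fun y => .pair (.pair u (.pair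
          (.pair (.pair (.pair c q) (.num y)) (encTable s)) (if c = ctx then
            .pair (.pair c (.pair q (.num y))) (s.restrict ctx) else s.restrict ctx)))
              (.num y) := by
        funext y
        exact hout y
      rw [hfun]
      rcases eq_or_ne c ctx with rfl | h
      · simp [simQuery, run_ite, Op.eval, encState, run_lookup, hl, run_sampleBits,
          ← ROM.map_sample]
      · simp [simQuery, run_ite, Op.eval, encState, run_lookup, hl, h, run_sampleBits,
          ← ROM.map_sample]

end Prog

/-! ### Simulation of programs with oracle access -/

namespace Prog

variable {n : ℕ} {x : Val}

/-- Whether the second component of the input is of the form `(k, y)` with a number `k`. -/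
def loopGuard : Prog :=
  ite (comp (prim .isPair) snd)
    (ite (comp (prim .isPair) (comp fst snd)) (const (.num 0)) (const (.num 1))) (const (.num 0))

/-- Oracle-free simulation of a program: on `(state, x)`, run the program on `x` and answer its
oracle calls by lazy sampling from the state; the result is `(state', y)`. -/
def sim (ctx : Val) : Prog → Prog
  | prim o => pair fst (comp (prim o) snd)
  | comp g f => comp (sim ctx g) (sim ctx f)
  | pair f g =>
      comp (pair (comp fst fst) (pair snd (comp snd fst)))
        (comp (pair (comp (sim ctx g) (pair (comp fst fst) snd)) (comp snd fst))
          (pair (sim ctx f) snd))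
  | ite c f g =>
      comp (ite (comp snd fst) (comp (sim ctx f) (pair (comp fst fst) snd))
          (comp (sim ctx g) (pair (comp fst fst) snd)))
        (pair (sim ctx c) snd)
  | loop f =>
      ite loopGuard
        (comp (loop (sim ctx f)) (pair (comp fst snd) (pair fst (comp snd snd)))) (prim .id)
  | coin => pair fst coin
  | query => simQuery ctx

theorem oracleFree_simQuery (ctx : Val) : (simQuery ctx).OracleFree := by
  simp [simQuery, sampleBits, lookup, lookupStep]

theorem oracleFree_sim (ctx : Val) (P : Prog) : (sim ctx P).OracleFree := by
  induction P with
  | prim o => simp [sim]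
  | comp g f hg hf => simp [sim, hg, hf]
  | pair f g hf hg => simp [sim, hg, hf]
  | ite c f g hc hf hg => simp [sim, hc, hf, hg]
  | loop f hf => simp [sim, loopGuard, hf]
  | coin => simp [sim]
  | query => exact oracleFree_simQuery ctx

theorem run_loopGuard (st : Val) (k : ℕ) (y : Val) :
    loopGuard.run n (.pair st (.pair (.num k) y)) = pure (.num 1) := by
  simp [loopGuard, run_ite, Op.eval]

theorem run_loopGuard_of_ne (st : Val) (h : ∀ k y, x ≠ .pair (.num k) y) :
    loopGuard.run n (.pair st x) = pure (.num 0) := by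
  match x, h with
  | .pair (.num k) y, h => exact absurd rfl (h k y)
  | .num k, _ => simp [loopGuard, run_ite, Op.eval]
  | .pair (.pair _ _) _, _ => simp [loopGuard, run_ite, Op.eval]

/-- The simulation is perfect: it has exactly the distribution of the program with access to a
random oracle, including the log. -/
theorem run_sim (ctx : Val) (P : Prog) (u x : Val) (s : OracleLog (u.size / 2)) :
    (sim ctx P).run n (.pair (encState ctx u s) x) =
      ROM.sample ((P.run (u.size / 2) x s).map (simOut ctx u)) := by
  induction P generalizing x s with
  | prim o =>
    rw [run_prim, ROM.pure_apply, PMF.pure_map, ROM.sample_pure]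
    simp [sim, simOut]
  | comp g f hg hf =>
    rw [sim, run_comp, hf, ROM.sample_map_bind, run_comp, ROM.bind_apply, PMF.map_bind,
      ← ROM.sample_bind_sample]
    exact congrArg _ (funext fun r => hg _ _)
  | pair f g hf hg =>
    simp only [sim, run_comp, run_pair, hf, ROM.sample_map_bind, bind_assoc, run_snd, pure_bind]
    rw [ROM.bind_apply, PMF.map_bind, ← ROM.sample_bind_sample]
    refine congrArg _ (funext fun r => ?_)
    simp only [simOut, run_fst, run_snd, pure_bind]
    rw [hg, ROM.sample_map_bind, ROM.bind_apply, PMF.map_bind, ← ROM.sample_bind_sample]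
    refine congrArg _ (funext fun r' => ?_)
    simp only [simOut, run_fst, run_snd, pure_bind]
    rw [ROM.pure_apply, PMF.pure_map, ROM.sample_pure]
    rfl
  | ite c f g hc hf hg =>
    simp only [sim, run_comp, run_pair, hc, ROM.sample_map_bind, bind_assoc, run_snd, pure_bind,
      run_ite]
    rw [ROM.bind_apply, PMF.map_bind, ← ROM.sample_bind_sample]
    refine congrArg _ (funext fun r => ?_)
    simp only [simOut, run_fst, run_snd, pure_bind]
    split_ifs
    · exact hg _ _
    · exact hf _ _
  | loop f hf =>
    by_cases hx : ∃ k y, x = .pair (.num k) y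
    · obtain ⟨k, y, rfl⟩ := hx
      have key : ∀ k y (s : OracleLog (u.size / 2)),
          iterRun ((sim ctx f).run n) k (.pair (encState ctx u s) y) =
            ROM.sample ((iterRun (f.run (u.size / 2)) k y s).map (simOut ctx u)) := by
        intro k
        induction k with
        | zero =>
          intro y s
          rw [iterRun, iterRun, ROM.pure_apply, PMF.pure_map, ROM.sample_pure]
          rfl
        | succ k ih =>
          intro y s
          rw [iterRun, iterRun, hf, ROM.sample_map_bind, ROM.bind_apply, PMF.map_bind,
            ← ROM.sample_bind_sample]
          exact congrArg _ (funext fun r => ih _ _)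
      rw [sim, run_ite, run_loopGuard, pure_bind, if_neg (by simp), run_loop, ← key]
      simp
    · push Not at hx
      rw [sim, run_ite, run_loopGuard_of_ne _ hx, pure_bind, if_pos rfl, run_loop_of_ne _ _ hx,
        ROM.pure_apply, PMF.pure_map, ROM.sample_pure, run_id]
      rfl
  | coin =>
    rw [sim, run_pair, run_fst, pure_bind, run_coin, run_coin, bind_pure_comp, ROM.map_sample,
      ROM.sample_apply, PMF.map_bind]
    simp only [PMF.pure_map]
    rfl
  | query => exact run_simQuery ctx u x s

theorem size_encState (ctx u : Val) {m : ℕ} (s : OracleLog m) :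
    (encState ctx u s).size = u.size + ((encTable s).size + (s.restrict ctx).size + 1) + 1 := rfl

/-- A query lengthens the state of the simulation by an amount that the query pays for. -/
theorem Steps.size_encState_query (ctx u : Val) {m : ℕ} {x y : Val} {s s' : OracleLog m} {t : ℕ}
    (h : query.Steps m x s y t s') : (encState ctx u s).size ≤ (encState ctx u s').size ∧
      (encState ctx u s').size ≤ (encState ctx u s).size + 4 * t := by
  cases x with
  | num k =>
    obtain ⟨-, -, rfl⟩ := steps_query_num.1 h
    omega
  | pair c q =>
    obtain ⟨a, ha, rfl, rfl⟩ := steps_query_pair.1 h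
    have hs' : s' = (c, q, a) :: s := by
      rw [ROM.query] at ha
      cases hfind : s.find? (fun e => decide (e.1 = c ∧ e.2.1 = q)) with
      | some e =>
        rw [hfind] at ha
        obtain ⟨rfl, rfl⟩ := Prod.mk.inj ((PMF.mem_support_pure_iff _ _).1 ha)
        rfl
      | none =>
        rw [hfind] at ha
        obtain ⟨b, -, hb⟩ := (PMF.mem_support_bind_iff _ _ _).1 ha
        obtain ⟨rfl, rfl⟩ := Prod.mk.inj ((PMF.mem_support_pure_iff _ _).1 hb)
        rfl
    subst hs'
    have ht : (encTable ((c, q, a) :: s)).size =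
        c.size + q.size + 1 + (Val.num a).size + 1 + (encTable s).size + 1 := rfl
    rw [size_encState, size_encState, ht, restrict_cons]
    split_ifs <;> simp only [Val.size_pair, Val.size_num] <;> omega

/-- `SimBound ctx f q F`: every run of `F` on an encoded state follows a run of `f` on the log, at a
cost that exceeds that of `f` by at most a factor `q W`, where `W` bounds the final state and the
number of steps. -/
def SimBound (ctx : Val) (q : ℕ[X])
    (F : (n : ℕ) → Val → OracleLog n → Val → ℕ → OracleLog n → Prop)
    (f : (n : ℕ) → Val → OracleLog n → Val → ℕ → OracleLog n → Prop) : Prop :=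
  ∀ (n : ℕ) (u x : Val) (s : OracleLog (u.size / 2)) (s₀ s₀' : OracleLog n) (y : Val) (t : ℕ),
    F n (.pair (encState ctx u s) x) s₀ y t s₀' → ∃ y' t' s', f (u.size / 2) x s y' t' s' ∧
      y = .pair (encState ctx u s') y' ∧ (encState ctx u s).size ≤ (encState ctx u s').size ∧
      (encState ctx u s').size ≤ (encState ctx u s).size + 4 * t' ∧
      ∀ W, n + (encState ctx u s').size + t' ≤ W → t ≤ t' * q.eval W

theorem SimBound.iterSteps {ctx : Val} {q : ℕ[X]} {F f : Prog}
    (h : SimBound ctx q (F.Steps ·) (f.Steps ·)) (k : ℕ) :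
    SimBound ctx (q + 1) (IterSteps · F k) (IterSteps · f k) := by
  induction k with
  | zero =>
    intro n u x s s₀ s₀' y t hs
    obtain ⟨rfl, rfl, rfl⟩ := iterSteps_zero.1 hs
    exact ⟨x, 0, s, iterSteps_zero.2 ⟨rfl, rfl, rfl⟩, rfl, by omega, by omega, fun W _ => by simp⟩
  | succ k ih =>
    intro n u x s s₀ s₀' y t hs
    obtain ⟨y₁, t₁, s₁, t₂, h₁, h₂, rfl⟩ := iterSteps_succ.1 hs
    obtain ⟨y₁', t₁', s₁', h₁', rfl, a₁, b₁, c₁⟩ := h _ _ _ _ _ _ _ _ h₁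
    obtain ⟨y₂', t₂', s₂', h₂', rfl, a₂, b₂, c₂⟩ := ih _ _ _ _ _ _ _ _ h₂
    refine ⟨y₂', t₁' + t₂' + 1, s₂', iterSteps_succ.2 ⟨_, _, _, _, h₁', h₂', rfl⟩, rfl,
      by omega, by omega, fun W hW => ?_⟩
    have d₁ := c₁ W (by omega)
    have d₂ := c₂ W (by omega)
    simp only [Polynomial.eval_add, Polynomial.eval_one] at d₂ ⊢
    nlinarith

/-- The cost of a polynomial-time program as a polynomial in a bound `W` for the parts of its
input. -/
theorem Steps.cost_le {P : Prog} {q : ℕ[X]}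
    (hq : ∀ n x s y t s', P.Steps n x s y t s' → t ≤ q.eval (n + x.size))
    {y : Val} {t : ℕ} {s s' : OracleLog n} (h : P.Steps n x s y t s') {W : ℕ}
    (hW : n + x.size ≤ 3 * W + 3) : t ≤ (q.comp (3 * .X + 3)).eval W := by
  refine (hq _ _ _ _ _ _ h).trans ((eval_mono q hW).trans_eq ?_)
  simp

theorem exists_simBound (ctx : Val) (P : Prog) :
    ∃ q, SimBound ctx q ((sim ctx P).Steps ·) (P.Steps ·) := by
  induction P with
  | prim o =>
    obtain ⟨p, hp⟩ := ppt_iff.1 (ppt_fst.pair ((ppt_prim o).comp ppt_snd))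
    refine ⟨p.comp (3 * .X + 3), fun n u x s s₀ s₀' y t h => ?_⟩
    obtain ⟨rfl, -⟩ := h.eq_of_run_eq_pure (v := .pair (encState ctx u s) (o.eval x))
      (by simp [sim])
    refine ⟨_, _, s, steps_prim.2 ⟨rfl, rfl, rfl⟩, rfl, by omega, by omega, fun W hW => ?_⟩
    have := Steps.cost_le hp h (W := W) (by simp only [Val.size_pair]; omega)
    nlinarith
  | comp g f ihg ihf =>
    obtain ⟨qg, hg⟩ := ihg
    obtain ⟨qf, hf⟩ := ihf
    refine ⟨qf + qg + 1, fun n u x s s₀ s₀' y t h => ?_⟩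
    obtain ⟨y₁, t₁, s₁, t₂, h₁, h₂, rfl⟩ := steps_comp.1 h
    obtain ⟨y₁', t₁', s₁', h₁', rfl, a₁, b₁, c₁⟩ := hf _ _ _ _ _ _ _ _ h₁
    obtain ⟨y₂', t₂', s₂', h₂', rfl, a₂, b₂, c₂⟩ := hg _ _ _ _ _ _ _ _ h₂
    refine ⟨_, _, _, steps_comp.2 ⟨_, _, _, _, h₁', h₂', rfl⟩, rfl, by omega, by omega,
      fun W hW => ?_⟩
    have d₁ := c₁ W (by omega)
    have d₂ := c₂ W (by omega)
    simp only [Polynomial.eval_add, Polynomial.eval_one]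
    nlinarith
  | pair f g ihf ihg =>
    obtain ⟨qf, hf⟩ := ihf
    obtain ⟨qg, hg⟩ := ihg
    obtain ⟨p₁, hp₁⟩ := ppt_iff.1 ppt_snd
    obtain ⟨p₂, hp₂⟩ := ppt_iff.1 ((ppt_fst.comp ppt_fst).pair ppt_snd)
    obtain ⟨p₃, hp₃⟩ := ppt_iff.1 (ppt_snd.comp ppt_fst)
    obtain ⟨p₄, hp₄⟩ := ppt_iff.1 ((ppt_fst.comp ppt_fst).pair (ppt_snd.pair
      (ppt_snd.comp ppt_fst)))
    refine ⟨qf + qg + (p₁ + p₂ + p₃ + p₄).comp (3 * .X + 3) + 10,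
      fun n u x s s₀ s₀' y t h => ?_⟩
    obtain ⟨y₃, t₃, s₃, t₄, h₃, h₄, rfl⟩ := steps_comp.1 h
    obtain ⟨y₁, t₁, s₁, t₂, h₁, h₂, rfl⟩ := steps_comp.1 h₃
    obtain ⟨z₁, r₁, e₁, z₂, r₂, k₁, k₂, rfl, rfl⟩ := steps_pair.1 h₁
    obtain ⟨z₃, r₃, e₃, z₄, r₄, k₃, k₄, rfl, rfl⟩ := steps_pair.1 h₂
    obtain ⟨z₅, r₅, e₅, r₆, k₅, k₆, rfl⟩ := steps_comp.1 k₃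
    obtain ⟨y₁', t₁', s₁', h₁', rfl, a₁, b₁, c₁⟩ := hf _ _ _ _ _ _ _ _ k₁
    obtain ⟨rfl, rfl⟩ := k₂.eq_of_run_eq_pure (run_snd _ _)
    obtain ⟨rfl, rfl⟩ := k₅.eq_of_run_eq_pure (v := .pair (encState ctx u s₁') z₂) (by simp)
    obtain ⟨y₂', t₂', s₂', h₂', rfl, a₂, b₂, c₂⟩ := hg _ _ _ _ _ _ _ _ k₆
    obtain ⟨rfl, rfl⟩ := k₄.eq_of_run_eq_pure (v := y₁') (by simp)
    obtain ⟨rfl, rfl⟩ := h₄.eq_of_run_eq_pure (v := .pair (encState ctx u s₂') (.pair z₄ y₂'))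
      (by simp)
    refine ⟨_, _, _, steps_pair.2 ⟨_, _, _, _, _, h₁', h₂', rfl, rfl⟩, rfl, by omega, by omega,
      fun W hW => ?_⟩
    have d₁ := c₁ W (by omega)
    have d₂ := c₂ W (by omega)
    have i₁ := h₁'.size_le
    have i₂ := h₂'.size_le
    have w₁ := Steps.cost_le hp₁ k₂ (W := W) (by simp only [Val.size_pair]; omega)
    have w₂ := Steps.cost_le hp₂ k₅ (W := W) (by simp only [Val.size_pair]; omega)
    have w₃ := Steps.cost_le hp₃ k₄ (W := W) (by simp only [Val.size_pair]; omega)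
    have w₄ := Steps.cost_le hp₄ h₄ (W := W) (by simp only [Val.size_pair]; omega)
    simp only [Polynomial.eval_add, Polynomial.add_comp, Polynomial.eval_ofNat] at w₁ w₂ w₃ w₄ ⊢
    nlinarith
  | ite c f g ihc ihf ihg =>
    obtain ⟨qc, hc⟩ := ihc
    obtain ⟨qf, hf⟩ := ihf
    obtain ⟨qg, hg⟩ := ihg
    obtain ⟨p₁, hp₁⟩ := ppt_iff.1 ppt_snd
    obtain ⟨p₂, hp₂⟩ := ppt_iff.1 ((ppt_fst.comp ppt_fst).pair ppt_snd)
    obtain ⟨p₃, hp₃⟩ := ppt_iff.1 (ppt_snd.comp ppt_fst)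
    refine ⟨qc + qf + qg + (p₁ + p₂ + p₃).comp (3 * .X + 3) + 10,
      fun n u x s s₀ s₀' y t h => ?_⟩
    obtain ⟨y₁, t₁, s₁, t₂, h₁, h₂, rfl⟩ := steps_comp.1 h
    obtain ⟨z₁, r₁, e₁, z₂, r₂, k₁, k₂, rfl, rfl⟩ := steps_pair.1 h₁
    obtain ⟨y₁', t₁', s₁', h₁', rfl, a₁, b₁, c₁⟩ := hc _ _ _ _ _ _ _ _ k₁
    obtain ⟨rfl, rfl⟩ := k₂.eq_of_run_eq_pure (run_snd _ _)
    obtain ⟨z₃, r₃, e₃, r₄, k₃, k₄, rfl⟩ := steps_ite.1 h₂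
    obtain ⟨rfl, rfl⟩ := k₃.eq_of_run_eq_pure (v := y₁') (by simp)
    have i₁ := h₁'.size_le
    have hsim : (if z₃ = .num 0 then comp (sim ctx g) (pair (comp fst fst) snd) else
        comp (sim ctx f) (pair (comp fst fst) snd)) =
          comp (if z₃ = .num 0 then sim ctx g else sim ctx f) (pair (comp fst fst) snd) := by
      split_ifs <;> rfl
    rw [hsim] at k₄
    obtain ⟨z₅, r₅, e₅, r₆, k₅, k₆, rfl⟩ := steps_comp.1 k₄
    obtain ⟨rfl, rfl⟩ := k₅.eq_of_run_eq_pure (v := .pair (encState ctx u s₁') z₂) (by simp)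
    obtain ⟨y₂', t₂', s₂', h₂', rfl, a₂, b₂, c₂⟩ : ∃ y' t' s',
        (if z₃ = .num 0 then g else f).Steps (u.size / 2) z₂ s₁' y' t' s' ∧
        y = .pair (encState ctx u s') y' ∧ (encState ctx u s₁').size ≤ (encState ctx u s').size ∧
        (encState ctx u s').size ≤ (encState ctx u s₁').size + 4 * t' ∧
        ∀ W, n + (encState ctx u s').size + t' ≤ W → r₆ ≤ t' * (qf.eval W + qg.eval W) := by
      split_ifs at k₆ ⊢
      · obtain ⟨y₂', t₂', s₂', h₂', e, a₂, b₂, c₂⟩ := hg _ _ _ _ _ _ _ _ k₆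
        exact ⟨y₂', t₂', s₂', h₂', e, a₂, b₂, fun W hW => (c₂ W hW).trans
          (Nat.mul_le_mul_left _ (by omega))⟩
      · obtain ⟨y₂', t₂', s₂', h₂', e, a₂, b₂, c₂⟩ := hf _ _ _ _ _ _ _ _ k₆
        exact ⟨y₂', t₂', s₂', h₂', e, a₂, b₂, fun W hW => (c₂ W hW).trans
          (Nat.mul_le_mul_left _ (by omega))⟩
    refine ⟨_, _, _, steps_ite.2 ⟨_, _, _, _, h₁', h₂', rfl⟩, rfl, by omega, by omega,
      fun W hW => ?_⟩
    have d₁ := c₁ W (by omega)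
    have d₂ := c₂ W (by omega)
    have i₂ := h₂'.size_le
    have w₁ := Steps.cost_le hp₁ k₂ (W := W) (by simp only [Val.size_pair]; omega)
    have w₂ := Steps.cost_le hp₂ k₅ (W := W) (by simp only [Val.size_pair]; omega)
    have w₃ := Steps.cost_le hp₃ k₃ (W := W) (by simp only [Val.size_pair]; omega)
    simp only [Polynomial.eval_add, Polynomial.add_comp, Polynomial.eval_ofNat] at w₁ w₂ w₃ ⊢
    nlinarith
  | loop f ihf =>
    obtain ⟨qf, hf⟩ := ihf
    obtain ⟨p₁, hp₁⟩ := ppt_iff.1 (show loopGuard.PPT from ((ppt_prim _).comp ppt_snd).ite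
      (((ppt_prim _).comp (ppt_fst.comp ppt_snd)).ite (ppt_const _) (ppt_const _)) (ppt_const _))
    obtain ⟨p₂, hp₂⟩ := ppt_iff.1 ((ppt_fst.comp ppt_snd).pair (ppt_fst.pair
      (ppt_snd.comp ppt_snd)))
    obtain ⟨p₃, hp₃⟩ := ppt_iff.1 (ppt_prim .id)
    refine ⟨qf + (p₁ + p₂ + p₃).comp (3 * .X + 3) + (3 * .X + 20),
      fun n u x s s₀ s₀' y t h => ?_⟩
    obtain ⟨z₁, r₁, e₁, r₂, k₁, k₂, rfl⟩ := steps_ite.1 h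
    by_cases hx : ∃ k v, x = .pair (.num k) v
    · obtain ⟨k, v, rfl⟩ := hx
      obtain ⟨rfl, rfl⟩ := k₁.eq_of_run_eq_pure (run_loopGuard _ _ _)
      rw [if_neg (by simp)] at k₂
      obtain ⟨z₅, r₅, e₅, r₆, k₅, k₆, rfl⟩ := steps_comp.1 k₂
      obtain ⟨rfl, rfl⟩ := k₅.eq_of_run_eq_pure
        (v := .pair (.num k) (.pair (encState ctx u s) v)) (by simp)
      obtain ⟨t₁, h₁, rfl⟩ := steps_loop.1 k₆
      obtain ⟨y₁', t₁', s₁', h₁', rfl, a₁, b₁, c₁⟩ := hf.iterSteps _ _ _ _ _ _ _ _ _ h₁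
      refine ⟨_, _, _, steps_loop.2 ⟨_, h₁', rfl⟩, rfl, by omega, by omega, fun W hW => ?_⟩
      simp only [Val.size_pair] at hW
      have d₁ := c₁ W (by omega)
      have w₁ := Steps.cost_le hp₁ k₁ (W := W) (by simp only [Val.size_pair]; omega)
      have w₂ := Steps.cost_le hp₂ k₅ (W := W) (by simp only [Val.size_pair]; omega)
      simp only [Polynomial.eval_add, Polynomial.add_comp, Polynomial.eval_ofNat,
        Polynomial.eval_mul, Polynomial.eval_X, Polynomial.eval_one, Val.size_pair] at d₁ w₁ w₂ ⊢
      have hin : (Val.num k).size + ((encState ctx u s).size + v.size + 1) + 1 + 1 ≤ 3 * W + 3 := by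
        omega
      nlinarith
    · push Not at hx
      obtain ⟨rfl, rfl⟩ := k₁.eq_of_run_eq_pure (run_loopGuard_of_ne _ hx)
      rw [if_pos rfl] at k₂
      obtain ⟨rfl, rfl⟩ := k₂.eq_of_run_eq_pure run_id
      refine ⟨_, _, _, (steps_loop_of_ne hx).2 ⟨rfl, rfl, rfl⟩, rfl, by omega, by omega,
        fun W hW => ?_⟩
      have w₁ := Steps.cost_le hp₁ k₁ (W := W) (by simp only [Val.size_pair]; omega)
      have w₃ := Steps.cost_le hp₃ k₂ (W := W) (by simp only [Val.size_pair]; omega)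
      simp only [Polynomial.eval_add, Polynomial.add_comp, Polynomial.eval_ofNat,
        Polynomial.eval_mul, Polynomial.eval_X] at w₁ w₃ ⊢
      nlinarith
  | coin =>
    obtain ⟨p, hp⟩ := ppt_iff.1 (ppt_fst.pair ppt_coin)
    refine ⟨p.comp (3 * .X + 3), fun n u x s s₀ s₀' y t h => ?_⟩
    have h' := h
    obtain ⟨z₁, r₁, e₁, z₂, r₂, k₁, k₂, rfl, -⟩ := steps_pair.1 h'
    obtain ⟨rfl, -⟩ := k₁.eq_of_run_eq_pure (run_fst _ _)
    obtain ⟨b, rfl, -, -⟩ := steps_coin.1 k₂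
    refine ⟨_, _, s, steps_coin.2 ⟨b, rfl, rfl, rfl⟩, rfl, by omega, by omega, fun W hW => ?_⟩
    have := Steps.cost_le hp h (W := W) (by simp only [Val.size_pair]; omega)
    nlinarith
  | query =>
    obtain ⟨p, hp⟩ := ppt_iff.1 (ppt_simQuery ctx)
    refine ⟨p.comp (3 * .X + 3), fun n u x s s₀ s₀' y t h => ?_⟩
    have hm := Steps.mem_support_run h
    rw [run_sim, ROM.sample_apply, PMF.mem_support_bind_iff] at hm
    obtain ⟨z, hz, hy⟩ := hm
    obtain ⟨rfl, -⟩ := Prod.mk.inj ((PMF.mem_support_pure_iff _ _).1 hy)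
    obtain ⟨⟨y', s'⟩, hr, rfl⟩ := (PMF.mem_support_map_iff _ _ _).1 hz
    obtain ⟨t', ht'⟩ := exists_steps hr
    obtain ⟨a, b⟩ := ht'.size_encState_query ctx u
    refine ⟨y', t', s', ht', rfl, a, b, fun W hW => ?_⟩
    have i := ht'.size_le
    have := Steps.cost_le hp h (W := W) (by simp only [Val.size_pair]; omega)
    have := ht'.one_le
    nlinarith

/-- Start the simulation with an empty log; the range of the oracle is given by the first component
`1ⁿ` of `x.1`. -/
def simStart (ctx : Val) (P : Prog) : Prog :=
  comp (sim ctx P)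
    (pair (pair (comp fst fst) (const (.pair (.num 0) (.num 0)))) (prim .id))

theorem oracleFree_simStart (ctx : Val) (P : Prog) : (simStart ctx P).OracleFree := by
  simp [simStart, oracleFree_sim]

theorem run_simStart (ctx : Val) (P : Prog) (m : ℕ) (a b : Val) :
    (simStart ctx P).run n (.pair (.pair (.unary m) a) b) =
      ROM.sample ((P.run m (.pair (.pair (.unary m) a) b) []).map (simOut ctx (.unary m))) := by
  have hm : (Val.unary m).size / 2 = m := by
    rw [Val.size_unary]
    omega
  -- `|1ᵐ| / 2` and `m` are equal but not definitionally so; the log type depends on them.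
  have key : ∀ m' (hm' : (Val.unary m).size / 2 = m'),
      (sim ctx P).run n (.pair (encState ctx (.unary m) ([] : OracleLog m'))
        (.pair (.pair (.unary m) a) b)) = ROM.sample
          ((P.run m' (.pair (.pair (.unary m) a) b) []).map (simOut ctx (.unary m))) := by
    rintro _ rfl
    exact run_sim _ _ _ _ _
  rw [← key m hm]
  simp [simStart, encState, encTable, OracleLog.restrict, Val.ofList]
  rfl

theorem PPT.simStart {P : Prog} (hP : P.PPT) (ctx : Val) : (simStart ctx P).PPT := by
  obtain ⟨q, hq⟩ := ppt_iff.1 hP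
  obtain ⟨p, hp⟩ := exists_simBound ctx P
  obtain ⟨r, hr⟩ := ppt_iff.1
    (((ppt_fst.comp ppt_fst).pair (ppt_const (.pair (.num 0) (.num 0)))).pair (ppt_prim .id))
  let T : ℕ[X] := q.comp (2 * .X)
  refine ppt_iff.2 ⟨r + T * p.comp (.X + (r + 4 * T) + T) + 1, fun n x s y t s' h => ?_⟩
  obtain ⟨y₁, t₁, s₁, t₂, h₁, h₂, rfl⟩ := steps_comp.1 h
  have b₁ := hr _ _ _ _ _ _ h₁
  have i₁ := h₁.size_le.2
  obtain ⟨u, hu, hux⟩ : ∃ u : Val, (Prog.comp fst fst).run n x = pure u ∧ u.size ≤ x.size := by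
    refine ⟨Op.fst.eval (Op.fst.eval x), by simp [fst], ?_⟩
    have key : ∀ v, (Op.fst.eval v).size ≤ v.size := by
      intro v
      cases v <;> simp [Op.eval]
      omega
    exact (key _).trans (key _)
  obtain ⟨rfl, -⟩ := h₁.eq_of_run_eq_pure
    (v := .pair (encState ctx u ([] : OracleLog (u.size / 2))) x)
    (by rw [run_pair, run_pair, hu]; simp; rfl)
  obtain ⟨y', t', s'', h', rfl, a₂, b₂, c₂⟩ := hp _ _ _ _ _ _ _ _ h₂
  have ht' : t' ≤ T.eval (n + x.size) := by
    refine (hq _ _ _ _ _ _ h').trans ((eval_mono q (b := 2 * (n + x.size)) (by omega)).trans_eq ?_)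
    simp [T]
  simp only [Val.size_pair] at i₁
  have hc := (c₂ _ le_rfl).trans (Nat.mul_le_mul ht' (eval_mono p
    (b := n + x.size + (r.eval (n + x.size) + 4 * T.eval (n + x.size)) + T.eval (n + x.size))
    (by omega)))
  simp only [Polynomial.eval_add, Polynomial.eval_mul, Polynomial.eval_comp, Polynomial.eval_one,
    Polynomial.eval_X, Polynomial.eval_ofNat]
  omega

end Prog

/-! ### Expectations of randomized computations -/

namespace ROM

variable {n : ℕ} {α β : Type}

/-- The expectation of `f`, evaluated at the result and the final log of a computation started with
log `s`. -/
def expect (m : ROM n α) (s : OracleLog n) (f : α → OracleLog n → ℝ≥0∞) : ℝ≥0∞ :=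
  ∑' r, m s r * f r.1 r.2

theorem _root_.PMF.tsum_bind_mul {γ δ : Type} (d : PMF γ) (k : γ → PMF δ) (f : δ → ℝ≥0∞) :
    ∑' b, d.bind k b * f b = ∑' a, d a * ∑' b, k a b * f b := by
  simp only [PMF.bind_apply, ← ENNReal.tsum_mul_right, ← ENNReal.tsum_mul_left, mul_assoc]
  exact ENNReal.tsum_comm

theorem _root_.PMF.tsum_pure_mul {γ : Type} (a : γ) (f : γ → ℝ≥0∞) :
    ∑' b, PMF.pure a b * f b = f a := by
  rw [tsum_eq_single a]
  · simp
  · intro b hb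
    simp [hb]

theorem expect_bind (m : ROM n α) (k : α → ROM n β) (s : OracleLog n)
    (f : β → OracleLog n → ℝ≥0∞) :
    (m >>= k).expect s f = m.expect s fun a s' => (k a).expect s' f := by
  rw [expect, bind_apply, PMF.tsum_bind_mul]
  rfl

@[simp] theorem expect_pure (a : α) (s : OracleLog n) (f : α → OracleLog n → ℝ≥0∞) :
    (pure a : ROM n α).expect s f = f a s := by
  rw [expect, pure_apply, PMF.tsum_pure_mul (a, s) fun r => f r.1 r.2]

theorem expect_sample (d : PMF α) (s : OracleLog n) (f : α → OracleLog n → ℝ≥0∞) :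
    (ROM.sample d).expect s f = ∑' a, d a * f a s := by
  rw [expect, sample_apply, PMF.tsum_bind_mul d _ fun r : α × OracleLog n => f r.1 r.2]
  simp only [PMF.tsum_pure_mul _ fun r : α × OracleLog n => f r.1 r.2]

theorem expect_get (s : OracleLog n) (f : OracleLog n → OracleLog n → ℝ≥0∞) :
    (get : ROM n (OracleLog n)).expect s f = f s s :=
  expect_pure s s f

theorem expect_mono (m : ROM n α) (s : OracleLog n) {f g : α → OracleLog n → ℝ≥0∞}
    (h : ∀ a s', f a s' ≤ g a s') : m.expect s f ≤ m.expect s g :=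
  ENNReal.tsum_le_tsum fun _ => mul_le_mul_right (h _ _) _

theorem expect_add (m : ROM n α) (s : OracleLog n) (f g : α → OracleLog n → ℝ≥0∞) :
    (m.expect s fun a s' => f a s' + g a s') = m.expect s f + m.expect s g := by
  simp only [expect, mul_add, ENNReal.tsum_add]

@[simp] theorem expect_const (m : ROM n α) (s : OracleLog n) (c : ℝ≥0∞) :
    (m.expect s fun _ _ => c) = c := by
  simp only [expect, ENNReal.tsum_mul_right, PMF.tsum_coe, one_mul]

theorem exec_apply (c : ROM n Bool) :
    ROM.exec c true = c.expect [] fun b _ => if b = true then 1 else 0 := by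
  change ((c []).bind fun r => PMF.pure r.1) true = _
  rw [PMF.bind_apply, expect]
  refine tsum_congr fun r => ?_
  simp only [PMF.pure_apply, eq_comm (a := true)]

/-! ### Lazy sampling: earlier queries are irrelevant -/

/-- The answer that the log prescribes for a call. -/
def answer (s : OracleLog n) (c q : Val) : Option (Fin (2 ^ n)) :=
  (s.find? (fun e => decide (e.1 = c ∧ e.2.1 = q))).map fun e => e.2.2

theorem answer_cons (s : OracleLog n) (c q c' q' : Val) (y : Fin (2 ^ n)) :
    answer ((c, q, y) :: s) c' q' = if c = c' ∧ q = q' then some y else answer s c' q' := by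
  by_cases h : c = c' ∧ q = q' <;> simp [answer, h]

theorem expect_query_of_some {s : OracleLog n} {c q : Val} {y : Fin (2 ^ n)}
    (h : answer s c q = some y) (f : Fin (2 ^ n) → OracleLog n → ℝ≥0∞) :
    (ROM.query c q).expect s f = f y ((c, q, y) :: s) := by
  obtain ⟨e, he, rfl⟩ := Option.map_eq_some_iff.1 h
  have hq : ROM.query c q s = PMF.pure (e.2.2, (c, q, e.2.2) :: s) := by
    rw [ROM.query, he]
    rfl
  rw [expect, hq, PMF.tsum_pure_mul _ fun r : Fin (2 ^ n) × OracleLog n => f r.1 r.2]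

theorem expect_query_of_none {s : OracleLog n} {c q : Val} (h : answer s c q = none)
    (f : Fin (2 ^ n) → OracleLog n → ℝ≥0∞) :
    (ROM.query c q).expect s f =
      ∑' y, PMF.uniformOfFintype (Fin (2 ^ n)) y * f y ((c, q, y) :: s) := by
  have hq : ROM.query c q s = (PMF.uniformOfFintype (Fin (2 ^ n))).bind
      fun y => PMF.pure (y, (c, q, y) :: s) := by
    rw [ROM.query, Option.map_eq_none_iff.1 h]
    rfl
  rw [expect, hq, PMF.tsum_bind_mul _ _ fun r : Fin (2 ^ n) × OracleLog n => f r.1 r.2]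
  simp only [PMF.tsum_pure_mul _ fun r : Fin (2 ^ n) × OracleLog n => f r.1 r.2]

/-- Computations that use nothing but oracle calls, in particular do not inspect the log. -/
inductive QueryComp : {α : Type} → ROM n α → Prop
  | pure {α : Type} (a : α) : QueryComp (Pure.pure a : ROM n α)
  | query {α : Type} (c q : Val) (k : Fin (2 ^ n) → ROM n α) (h : ∀ y, QueryComp (k y)) :
      QueryComp (ROM.query c q >>= k)

theorem QueryComp.bind {m : ROM n α} (hm : QueryComp m) {k : α → ROM n β}
    (hk : ∀ a, QueryComp (k a)) : QueryComp (m >>= k) := by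
  induction hm with
  | pure a => rw [pure_bind]; exact hk a
  | query c q k' h ih =>
    rw [bind_assoc]
    exact .query c q _ fun y => ih y

theorem QueryComp.mapM {l : List α} {k : α → ROM n β} (hk : ∀ a, QueryComp (k a)) :
    QueryComp (l.mapM k) := by
  induction l with
  | nil => exact .pure _
  | cons a l ih =>
    rw [List.mapM_cons]
    exact (hk a).bind fun b => ih.bind fun bs => .pure _

/-- The outcome depends on the log only through the answers it prescribes. -/
theorem QueryComp.expect_congr {m : ROM n α} (hm : QueryComp m) (f : α → ℝ≥0∞)
    {s s' : OracleLog n} (h : answer s = answer s') :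
    (m.expect s fun a _ => f a) = m.expect s' fun a _ => f a := by
  induction hm generalizing s s' with
  | pure a => simp
  | query c q k hk ih =>
    have hcons : ∀ y, answer ((c, q, y) :: s) = answer ((c, q, y) :: s') := fun y => by
      funext c' q'
      rw [answer_cons, answer_cons, h]
    rw [expect_bind, expect_bind]
    cases ha : answer s c q with
    | some y =>
      rw [expect_query_of_some ha, expect_query_of_some (h ▸ ha)]
      exact ih y (hcons y)
    | none =>
      rw [expect_query_of_none ha, expect_query_of_none (h ▸ ha)]
      exact tsum_congr fun y => by rw [ih y (hcons y)]

/-- Sampling the answer to a fresh call in advance does not change the outcome. -/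
theorem QueryComp.tsum_fresh {m : ROM n α} (hm : QueryComp m) (f : α → ℝ≥0∞) {s : OracleLog n}
    {c q : Val} (h : answer s c q = none) :
    ∑' y, PMF.uniformOfFintype (Fin (2 ^ n)) y * m.expect ((c, q, y) :: s) (fun a _ => f a) =
      m.expect s fun a _ => f a := by
  induction hm generalizing s with
  | pure a => simp only [expect_pure, ENNReal.tsum_mul_right, PMF.tsum_coe, one_mul]
  | query c' q' k hk ih =>
    simp only [expect_bind]
    by_cases hcq : c = c' ∧ q = q'
    · obtain ⟨rfl, rfl⟩ := hcq
      rw [expect_query_of_none h]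
      refine tsum_congr fun y => ?_
      rw [expect_query_of_some (y := y) (by rw [answer_cons, if_pos ⟨rfl, rfl⟩])]
      congr 1
      refine (hk y).expect_congr f ?_
      funext c'' q''
      simp only [answer_cons]
      split_ifs <;> rfl
    · have hcq' : ¬ (c' = c ∧ q' = q) := fun h => hcq ⟨h.1.symm, h.2.symm⟩
      have hswap : ∀ y y', answer ((c', q', y') :: (c, q, y) :: s) =
          answer ((c, q, y) :: (c', q', y') :: s) := by
        intro y y'
        funext c'' q''
        simp only [answer_cons]
        by_cases h₁ : c' = c'' ∧ q' = q''
        · obtain ⟨rfl, rfl⟩ := h₁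
          simp [hcq]
        · simp [h₁]
      have hfresh : ∀ y', answer ((c', q', y') :: s) c q = none := by
        intro y'
        rw [answer_cons, if_neg hcq', h]
      have hsame : ∀ y, answer ((c, q, y) :: s) c' q' = answer s c' q' := by
        intro y
        rw [answer_cons, if_neg hcq]
      cases ha : answer s c' q' with
      | some y' =>
        rw [expect_query_of_some ha, ← ih y' (hfresh y')]
        refine tsum_congr fun y => ?_
        rw [expect_query_of_some ((hsame y).trans ha), (hk y').expect_congr f (hswap y y')]
      | none =>
        rw [expect_query_of_none ha]
        have hl : ∀ y, (ROM.query c' q').expect ((c, q, y) :: s)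
            (fun a s' => (k a).expect s' fun a _ => f a) =
              ∑' y', PMF.uniformOfFintype (Fin (2 ^ n)) y' *
                (k y').expect ((c, q, y) :: (c', q', y') :: s) fun a _ => f a := by
          intro y
          rw [expect_query_of_none ((hsame y).trans ha)]
          exact tsum_congr fun y' => by rw [(hk y').expect_congr f (hswap y y')]
        simp only [hl, ← ENNReal.tsum_mul_left]
        rw [ENNReal.tsum_comm]
        refine tsum_congr fun y' => ?_
        rw [← ih y' (hfresh y'), ← ENNReal.tsum_mul_left]
        exact tsum_congr fun y => by ring

/-- Oracle calls made earlier do not change the distribution of the outcome. -/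
theorem QueryComp.expect_after {m' : ROM n β} (hm' : QueryComp m') {m : ROM n α}
    (hm : QueryComp m) (f : α → ℝ≥0∞) (s : OracleLog n) :
    (m'.expect s fun _ s' => m.expect s' fun a _ => f a) = m.expect s fun a _ => f a := by
  induction hm' generalizing s with
  | pure a => simp
  | query c q k hk ih =>
    rw [expect_bind]
    simp only [ih]
    cases ha : answer s c q with
    | none => rw [expect_query_of_none ha, hm.tsum_fresh f ha]
    | some y =>
      rw [expect_query_of_some ha]
      refine hm.expect_congr f ?_
      funext c' q'
      rw [answer_cons]
      split_ifs with h
      · rw [← h.1, ← h.2, ha]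
      · rfl

end ROM

/-! ### Scalars and group elements -/

namespace GroupFamily

variable (𝒢 : GroupFamily) {n : ℕ}

theorem order_nsmul (a : 𝒢.carrier n) : 𝒢.order n • a = 0 := by
  rw [← 𝒢.card_eq n]
  exact card_nsmul_eq_zero'

/-- The group as a vector space over the field of scalars. -/
instance (n : ℕ) : Module (𝒢.Scalar n) (𝒢.carrier n) := AddCommGroup.zmodModule 𝒢.order_nsmul

theorem smul_eq (c : 𝒢.Scalar n) (a : 𝒢.carrier n) : 𝒢.smul c a = c • a := by
  rw [smul, ← Nat.cast_smul_eq_nsmul (𝒢.Scalar n), ZMod.natCast_zmod_val]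

theorem addOrderOf_gen (n : ℕ) : addOrderOf (𝒢.gen n) = 𝒢.order n := by
  rw [← 𝒢.card_eq n]
  exact addOrderOf_eq_card_of_forall_mem_zmultiples (𝒢.gen_generates n)

theorem nsmul_gen_inj {a b : ℕ} (ha : a < 𝒢.order n) (hb : b < 𝒢.order n)
    (h : a • 𝒢.gen n = b • 𝒢.gen n) : a = b := by
  rw [← 𝒢.addOrderOf_gen n] at ha hb
  exact nsmul_injOn_Iio_addOrderOf ha hb h

theorem val_lt (a : 𝒢.Scalar n) : a.val < 𝒢.order n := ZMod.val_lt a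

theorem smul_gen_injective : Function.Injective fun c : 𝒢.Scalar n => 𝒢.smul c (𝒢.gen n) :=
  fun a b h => ZMod.val_injective _ (𝒢.nsmul_gen_inj (𝒢.val_lt a) (𝒢.val_lt b) h)

theorem smul_one (a : 𝒢.carrier n) : 𝒢.smul 1 a = a := by rw [smul_eq, _root_.one_smul]

theorem smul_zero' (a : 𝒢.carrier n) : 𝒢.smul 0 a = 0 := by rw [smul_eq, _root_.zero_smul]

theorem encScalar_injective : Function.Injective (𝒢.encScalar (n := n)) := fun a b h => by
  simpa [encScalar, ZMod.val_injective _ |>.eq_iff] using h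

/-- Computes `a + e • b` from `(params, (a, (b, e)))`. -/
def ComputesSMulAdd (S : Prog) : Prop :=
  ∀ (n m : ℕ) (a b : 𝒢.carrier n) (e : ℕ), S.run m (.pair (𝒢.encParams n)
    (.pair (𝒢.enc n a) (.pair (𝒢.enc n b) (.num e)))) = pure (𝒢.enc n (a + e • b))

/-- Computes `a + b` from `(params, (a, b))`. -/
def ComputesAdd (P : Prog) : Prop :=
  ∀ (n m : ℕ) (a b : 𝒢.carrier n), P.run m (.pair (𝒢.encParams n)
    (.pair (𝒢.enc n a) (𝒢.enc n b))) = pure (𝒢.enc n (a + b))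

/-- The addition program is specified for runs at security parameter `n`; being oracle-free, it
computes the same at every other one. -/
theorem exists_computesAdd : ∃ P : Prog, P.PPT ∧ P.OracleFree ∧ 𝒢.ComputesAdd P := by
  obtain ⟨P, hP, hfree, h⟩ := 𝒢.add_polytime
  refine ⟨P, hP, hfree, fun n m a b => ?_⟩
  obtain ⟨d, hd⟩ := hfree.exists_run_eq_sample
    (.pair (𝒢.encParams n) (.pair (𝒢.enc n a) (𝒢.enc n b)))
  rw [hd m]
  have hn : P.run n (.pair (𝒢.encParams n) (.pair (𝒢.enc n a) (𝒢.enc n b))) =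
      pure (𝒢.enc n (a + b)) := hfree.run_eq_pure (h n a b)
  have hpure : d = PMF.pure (𝒢.enc n (a + b)) := by
    have := congrArg (PMF.map Prod.fst) (congrFun ((hd n).symm.trans hn) [])
    rw [ROM.sample_apply, ROM.pure_apply, PMF.pure_map, PMF.map_bind] at this
    simpa only [PMF.pure_map, PMF.bind_pure] using this
  rw [hpure, ROM.sample_pure]

theorem exists_computesSMulAdd {P : Prog} (hP : P.PPT) (hfree : P.OracleFree)
    (h : 𝒢.ComputesAdd P) : ∃ S : Prog, S.PPT ∧ S.OracleFree ∧ 𝒢.ComputesSMulAdd S := by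
  obtain ⟨q, hq⟩ := 𝒢.size_le
  -- `1ⁿ` is part of the parameters, so a bound in terms of `n` is one in terms of the input length.
  obtain ⟨c, k, hck⟩ := Prog.exists_eval_le_pow (.X + 2 * q + 10)
  refine ⟨Prog.dblAdd P c k, hP.dblAdd c k, hfree.dblAdd c k, fun n m a b e => ?_⟩
  refine Prog.run_dblAdd (h n m) (hq n).2 a b e fun l hl => ?_
  have hpar : n ≤ (𝒢.encParams n).size := by
    rw [encParams, Val.size_pair, Val.size_unary]
    omega
  have h₁ := Prog.eval_mono q (show n ≤ l by omega)
  have h₂ := hck l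
  simp only [Polynomial.eval_add, Polynomial.eval_mul, Polynomial.eval_X,
    Polynomial.eval_ofNat] at h₂
  omega

end GroupFamily

/-! ### The programs of the reduction -/

namespace Prog

/-- `(1ⁿ, 𝔾, p, G)` in an input `(v, (1ⁿ, pp))`. -/
def getParams : Prog := comp fst snd

/-- `p` in an input `(v, (1ⁿ, pp))`. -/
def getOrder : Prog := comp fst (comp snd (comp snd getParams))

/-- `G` in an input `(v, (1ⁿ, pp))`. -/
def getGen : Prog := comp snd (comp snd (comp snd getParams))

/-- The tag `ζ` in an input `((C, (ζ, ζ')), (1ⁿ, pp))`. -/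
def getTag₁ : Prog := comp fst (comp snd fst)

/-- The tag `ζ'` in an input `((C, (ζ, ζ')), (1ⁿ, pp))`. -/
def getTag₂ : Prog := comp snd (comp snd fst)

/-- On `((C, (ζ, ζ')), (1ⁿ, pp))`: the claim `((υ - M, C - M), π)` of the selected tag `(ν, υ, π)`,
where `M = c υ` for `c = ν / (ν + 1)`. With a program `S` for `a + e • b`, subtraction of `M` is
addition of `(p - c) • υ`. -/
def claim (S tag : Prog) : Prog :=
  let ν := comp fst tag
  let υ := comp fst (comp snd tag)
  let e := bin .sub getOrder (mulMod getOrder ν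
    (invMod getOrder (addMod getOrder ν (const (.num 1)))))
  pair (pair (comp S (pair getParams (pair υ (pair υ e))))
    (comp S (pair getParams (pair (comp fst fst) (pair υ e))))) (comp snd (comp snd tag))

/-- On `((w, w'), ((C, (ζ, ζ')), (1ⁿ, pp)))`: the scalar `(ν' w' - ν w) / (w - w')`. -/
def solve : Prog :=
  let p := comp getOrder snd
  let w := comp fst fst
  let w' := comp snd fst
  let ν := comp fst (comp getTag₁ snd)
  let ν' := comp fst (comp getTag₂ snd)
  mulMod p (subMod p (mulMod p ν' w') (mulMod p ν w)) (invMod p (subMod p w w'))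

/-- On `(v, (1ⁿ, pp))`: `1` if `H = G`, `H + G = G`, or `v` is a scalar with `v G = H`. The
scalar multiple `v G` is computed as `G + (v + p - 1) G`. -/
def check (P S : Prog) : Prog :=
  let H := comp snd snd
  ite (bin .eq H getGen) (const (.num 1))
    (ite (bin .eq (comp P (pair getParams (pair H getGen))) getGen) (const (.num 1))
      (ite (bin .lt fst getOrder)
        (bin .eq (comp S (pair getParams (pair getGen (pair getGen
          (bin .sub (bin .add fst getOrder) (const (.num 1))))))) H)
        (const (.num 0))))

theorem ppt_getParams : getParams.PPT := ppt_fst.comp ppt_snd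
theorem ppt_getOrder : getOrder.PPT := ppt_fst.comp (ppt_snd.comp (ppt_snd.comp ppt_getParams))
theorem ppt_getGen : getGen.PPT := ppt_snd.comp (ppt_snd.comp (ppt_snd.comp ppt_getParams))
theorem ppt_getTag₁ : getTag₁.PPT := ppt_fst.comp (ppt_snd.comp ppt_fst)
theorem ppt_getTag₂ : getTag₂.PPT := ppt_snd.comp (ppt_snd.comp ppt_fst)

theorem PPT.claim {S tag : Prog} (hS : S.PPT) (ht : tag.PPT) : (claim S tag).PPT := by
  have hν := ppt_fst.comp ht
  have hυ := ppt_fst.comp (ppt_snd.comp ht)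
  have he := ppt_getOrder.bin (ppt_getOrder.mulMod hν
    (ppt_getOrder.invMod (ppt_getOrder.addMod hν (ppt_const (.num 1))))) .sub
  exact ((hS.comp (ppt_getParams.pair (hυ.pair (hυ.pair he)))).pair
    (hS.comp (ppt_getParams.pair ((ppt_fst.comp ppt_fst).pair (hυ.pair he))))).pair
    (ppt_snd.comp (ppt_snd.comp ht))

theorem ppt_solve : solve.PPT := by
  have hp := ppt_getOrder.comp ppt_snd
  have hw := ppt_fst.comp ppt_fst
  have hw' := ppt_snd.comp ppt_fst
  have hν := ppt_fst.comp (ppt_getTag₁.comp ppt_snd)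
  have hν' := ppt_fst.comp (ppt_getTag₂.comp ppt_snd)
  exact hp.mulMod (hp.subMod (hp.mulMod hν' hw') (hp.mulMod hν hw)) (hp.invMod (hp.subMod hw hw'))

theorem PPT.check {P S : Prog} (hP : P.PPT) (hS : S.PPT) : (check P S).PPT := by
  have hH := ppt_snd.comp ppt_snd
  have hG := ppt_getGen
  refine (hH.bin hG _).ite (ppt_const _) (((hP.comp (ppt_getParams.pair (hH.pair hG))).bin hG
    _).ite (ppt_const _) ((ppt_fst.bin ppt_getOrder _).ite ((hS.comp (ppt_getParams.pair (hG.pair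
      (hG.pair ((ppt_fst.bin ppt_getOrder _).bin (ppt_const _) _))))).bin hH _) (ppt_const _)))

@[simp] theorem oracleFree_getParams : getParams.OracleFree := by simp [getParams]
@[simp] theorem oracleFree_getOrder : getOrder.OracleFree := by simp [getOrder]
@[simp] theorem oracleFree_getGen : getGen.OracleFree := by simp [getGen]
@[simp] theorem oracleFree_getTag₁ : getTag₁.OracleFree := by simp [getTag₁]
@[simp] theorem oracleFree_getTag₂ : getTag₂.OracleFree := by simp [getTag₂]

theorem OracleFree.claim {S tag : Prog} (hS : S.OracleFree) (ht : tag.OracleFree) :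
    (claim S tag).OracleFree := by
  simp [Prog.claim, mulMod, invMod, addMod, oracleFree_powModProg, hS, ht]

theorem oracleFree_solve : solve.OracleFree := by
  simp [solve, mulMod, invMod, subMod, oracleFree_powModProg]

theorem OracleFree.check {P S : Prog} (hP : P.OracleFree) (hS : S.OracleFree) :
    (check P S).OracleFree := by
  simp [Prog.check, hP, hS]

variable {𝒢 : GroupFamily} {n m : ℕ} (v : Val) (H : 𝒢.carrier n)

@[simp] theorem run_getParams : getParams.run m (.pair v (𝒢.encPP H)) = pure (𝒢.encParams n) := by
  simp [getParams, GroupFamily.encPP]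

@[simp] theorem run_getOrder :
    getOrder.run m (.pair v (𝒢.encPP H)) = pure (.num (𝒢.order n)) := by
  simp [getOrder, GroupFamily.encParams]

@[simp] theorem run_getGen :
    getGen.run m (.pair v (𝒢.encPP H)) = pure (𝒢.enc n (𝒢.gen n)) := by
  simp [getGen, GroupFamily.encParams]

theorem run_claim {F : FischlinParams 𝒢} {S tag : Prog} (hS : 𝒢.ComputesSMulAdd S) {ctx x : Val}
    {C : 𝒢.carrier n} {ζ : F.USVTag n} (hν : ζ.ν ≠ -1)
    (htag : tag.run m (.pair (.pair (𝒢.enc n C) x) (𝒢.encPP H)) =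
      pure ((F.usvScheme ctx).encTag n ζ)) :
    (claim S tag).run m (.pair (.pair (𝒢.enc n C) x) (𝒢.encPP H)) =
      pure ((F.dleqProofSystem ctx).encClaim n
        ((ζ.υ - 𝒢.smul (ζ.ν / (ζ.ν + 1)) ζ.υ, C - 𝒢.smul (ζ.ν / (ζ.ν + 1)) ζ.υ), ζ.π)) := by
  set X := Val.pair (.pair (𝒢.enc n C) x) (𝒢.encPP H) with hX
  have hp : getOrder.run m X = pure (.num (𝒢.order n)) := run_getOrder _ _
  have hpar : getParams.run m X = pure (𝒢.encParams n) := run_getParams _ _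
  have hνr : (comp fst tag).run m X = pure (.num ζ.ν.val) := by
    rw [run_comp, htag, pure_bind]
    exact run_fst _ _
  have hυ : (comp fst (comp snd tag)).run m X = pure (𝒢.enc n ζ.υ) := by
    rw [run_comp, run_comp, htag, pure_bind]
    exact (congrArg (· >>= fst.run m) (run_snd _ _)).trans (by simp)
  have hπ : (comp snd (comp snd tag)).run m X = pure (F.encProof ζ.π) := by
    rw [run_comp, run_comp, htag, pure_bind]
    exact (congrArg (· >>= snd.run m) (run_snd _ _)).trans (by simp)
  have h1 : (const (.num 1)).run m X = pure (.num (1 : 𝒢.Scalar n).val) := by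
    rw [run_const, ZMod.val_one]
  have hc := run_mulMod hp hνr (run_invMod hp (run_addMod hp hνr h1)
    (fun h => hν (eq_neg_of_add_eq_zero_left h)))
  rw [← div_eq_mul_inv] at hc
  -- Subtracting `c υ` amounts to adding `p - c` times `υ`.
  have hsub : ∀ a : 𝒢.carrier n, a + (𝒢.order n - (ζ.ν / (ζ.ν + 1)).val) • ζ.υ =
      a - 𝒢.smul (ζ.ν / (ζ.ν + 1)) ζ.υ := by
    intro a
    rw [sub_nsmul _ (𝒢.val_lt _).le, 𝒢.order_nsmul, zero_add, sub_eq_add_neg]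
    rfl
  have hC : (comp fst fst).run m X = pure (𝒢.enc n C) := by simp [hX]
  simp only [claim, run_pair, run_comp S, run_bin, hp, hpar, hυ, hC, hc, hπ,
    pure_bind, Op.eval, hS n m, hsub]
  rfl

theorem run_solve {F : FischlinParams 𝒢} {ctx : Val} {C : 𝒢.carrier n} {ζ ζ' : F.USVTag n}
    {r r' : 𝒢.Scalar n} (hr : r ≠ r') :
    solve.run m (.pair (.pair (𝒢.encScalar r) (𝒢.encScalar r'))
      (.pair ((F.usvScheme ctx).encOutput n (C, ζ, ζ')) (𝒢.encPP H))) =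
        pure (.num ((ζ'.ν * r' - ζ.ν * r) * (r - r')⁻¹).val) := by
  set X := Val.pair (.pair (𝒢.encScalar r) (𝒢.encScalar r'))
    (.pair ((F.usvScheme ctx).encOutput n (C, ζ, ζ')) (𝒢.encPP H)) with hX
  have hp : (comp getOrder snd).run m X = pure (.num (𝒢.order n)) := by simp [hX]
  have hw : (comp fst fst).run m X = pure (.num r.val) := by simp [hX, GroupFamily.encScalar]
  have hw' : (comp snd fst).run m X = pure (.num r'.val) := by simp [hX, GroupFamily.encScalar]
  have hν : (comp fst (comp getTag₁ snd)).run m X = pure (.num ζ.ν.val) := by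
    simp [hX, getTag₁, GroupFamily.encScalar, USVScheme.encOutput, FischlinParams.usvScheme]
  have hν' : (comp fst (comp getTag₂ snd)).run m X = pure (.num ζ'.ν.val) := by
    simp [hX, getTag₂, GroupFamily.encScalar, USVScheme.encOutput, FischlinParams.usvScheme]
  exact run_mulMod hp (run_subMod hp (run_mulMod hp hν' hw') (run_mulMod hp hν hw))
    (run_invMod hp (run_subMod hp hw hw') (sub_ne_zero.2 hr))

/-- The condition tested by `check`. -/
def Solves (v : Val) (H : 𝒢.carrier n) : Prop :=
  H = 𝒢.gen n ∨ H = 0 ∨ ∃ k < 𝒢.order n, v = .num k ∧ k • 𝒢.gen n = H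

open Classical in
theorem run_check {P S : Prog} (hP : 𝒢.ComputesAdd P) (hS : 𝒢.ComputesSMulAdd S) :
    (check P S).run m (.pair v (𝒢.encPP H)) = pure (.num (if Solves v H then 1 else 0)) := by
  have hinj : ∀ {a b}, 𝒢.enc n a = 𝒢.enc n b ↔ a = b := (𝒢.enc_injective n).eq_iff
  have hH : (comp snd snd).run m (.pair v (𝒢.encPP H)) = pure (𝒢.enc n H) := by
    simp [GroupFamily.encPP]
  have hadd : (comp P (pair getParams (pair (comp snd snd) getGen))).run m
      (.pair v (𝒢.encPP H)) = pure (𝒢.enc n (H + 𝒢.gen n)) := by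
    rw [run_comp, run_pair, run_pair, hH]
    simp [hP n m]
  by_cases h₁ : H = 𝒢.gen n
  · have hs : Solves v H := .inl h₁
    have : (𝒢.enc n H = 𝒢.enc n (𝒢.gen n)) = True := by simp [h₁]
    simp only [check, run_ite, run_bin, hH, run_getGen, pure_bind, Op.eval, this, if_true,
      run_const, if_pos hs]
    simp
  by_cases h₂ : H = 0
  · have hs : Solves v H := .inr (.inl h₂)
    have : (𝒢.enc n H = 𝒢.enc n (𝒢.gen n)) = False := by simp [hinj, h₁]
    have h' : H + 𝒢.gen n = 𝒢.gen n := by rw [h₂, zero_add]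
    simp only [check, run_ite, run_bin, hH, run_getGen, hadd, pure_bind, Op.eval, this, if_true,
      run_const, if_false, h', if_pos hs]
    simp
  have e₁ : (𝒢.enc n H = 𝒢.enc n (𝒢.gen n)) = False := by simp [hinj, h₁]
  have e₂ : (𝒢.enc n (H + 𝒢.gen n) = 𝒢.enc n (𝒢.gen n)) = False := by simp [hinj, h₂]
  simp only [check, run_ite, run_bin, hH, run_getGen, hadd, pure_bind, Op.eval, e₁, e₂, if_true,
    run_const, if_false, run_getOrder, run_fst]
  cases v with
  | pair a b => simp [Solves, h₁, h₂]
  | num k =>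
    by_cases hk : k < 𝒢.order n
    · have hsum : 𝒢.gen n + (k + 𝒢.order n - 1) • 𝒢.gen n = k • 𝒢.gen n := by
        rw [← succ_nsmul', show k + 𝒢.order n - 1 + 1 = k + 𝒢.order n by omega, add_nsmul,
          𝒢.order_nsmul, add_zero]
      have hs : Solves (.num k) H ↔ k • 𝒢.gen n = H := by
        simp [Solves, h₁, h₂, hk]
      simp only [hk, if_true, run_comp S, run_pair, run_getParams, run_getGen, run_bin, run_fst,
        run_getOrder, run_const, pure_bind, Op.eval, hS n m, hsum, hinj, hs]
      split_ifs <;> simp_all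
    · have hs : ¬ Solves (.num k) H := by
        rintro (h | h | ⟨_, h, h', -⟩)
        · exact h₁ h
        · exact h₂ h
        · exact hk (Val.num.inj h' ▸ h)
      simp [hk, hs]

end Prog

/-! ### Two openings of a commitment reveal the discrete logarithm -/

theorem Val.ofList_injective : Function.Injective Val.ofList := by
  intro l l' h
  induction l generalizing l' with
  | nil =>
    cases l' with
    | nil => rfl
    | cons => simp [Val.ofList] at h
  | cons a l ih =>
    cases l' with
    | nil => simp [Val.ofList] at h
    | cons b l' =>
      simp only [Val.ofList, Val.pair.injEq] at h
      rw [h.1, ih h.2]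

namespace FischlinParams

variable {𝒢 : GroupFamily} (F : FischlinParams 𝒢) {n : ℕ}

theorem encRound_injective : Function.Injective (F.encRound (n := n)) := by
  rintro ⟨J₁, J₂, e, z⟩ ⟨J₁', J₂', e', z'⟩ h
  simp only [encRound, Val.pair.injEq, Val.num.injEq, (𝒢.enc_injective n).eq_iff,
    𝒢.encScalar_injective.eq_iff, Fin.val_inj] at h
  obtain ⟨⟨rfl, rfl⟩, rfl, rfl⟩ := h
  rfl

theorem encProof_injective : Function.Injective (F.encProof (n := n)) := by
  intro π π' h
  have := List.ofFn_injective (Val.ofList_injective h)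
  exact funext fun i => F.encRound_injective (congrFun this i)

theorem encClaim_injective (ctx : Val) :
    Function.Injective ((F.dleqProofSystem ctx).encClaim n) := by
  rintro ⟨⟨A, B⟩, π⟩ ⟨⟨A', B'⟩, π'⟩ h
  simp only [ProofSystem.encClaim, dleqProofSystem, encStmt, Val.pair.injEq,
    (𝒢.enc_injective n).eq_iff] at h
  obtain ⟨⟨rfl, rfl⟩, h⟩ := h
  rw [F.encProof_injective h]

theorem encOutput_injective (ctx : Val) :
    Function.Injective ((F.usvScheme ctx).encOutput n) := by
  rintro ⟨C, ⟨ν₁, υ₁, π₁⟩, ⟨ν₂, υ₂, π₂⟩⟩ ⟨C', ⟨ν₁', υ₁', π₁'⟩, ⟨ν₂', υ₂', π₂'⟩⟩ h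
  simp only [USVScheme.encOutput, usvScheme, Val.pair.injEq, (𝒢.enc_injective n).eq_iff,
    F.encProof_injective.eq_iff, 𝒢.encScalar_injective.eq_iff] at h
  obtain ⟨rfl, ⟨rfl, rfl, rfl⟩, rfl, rfl, rfl⟩ := h
  rfl

/-- The opening `M` derived from a tag with `ν ≠ -1`. -/
def message (ζ : F.USVTag n) : 𝒢.carrier n := 𝒢.smul (ζ.ν / (ζ.ν + 1)) ζ.υ

/-- The statement `(υ - M, C - M)` proved by a tag. -/
def stmt (C : 𝒢.carrier n) (ζ : F.USVTag n) : 𝒢.carrier n × 𝒢.carrier n :=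
  (ζ.υ - F.message ζ, C - F.message ζ)

/-- A witness `r` for the statement of a tag yields `M = ν r G`. -/
theorem message_eq {C H : 𝒢.carrier n} {ζ : F.USVTag n} {ctx : Val} {r : 𝒢.Scalar n}
    (hν : ζ.ν ≠ -1) (h : (F.dleqProofSystem ctx).rel H (F.stmt C ζ) r) :
    F.message ζ = (ζ.ν * r) • 𝒢.gen n ∧ C = (ζ.ν * r) • 𝒢.gen n + r • H := by
  have hν' : ζ.ν + 1 ≠ 0 := fun h => hν (eq_neg_of_add_eq_zero_left h)
  obtain ⟨-, -, -, h₁, h₂⟩ := h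
  rw [stmt, 𝒢.smul_eq] at h₁ h₂
  have hM : F.message ζ = (ζ.ν * r) • 𝒢.gen n := by
    have h₃ : F.message ζ = ζ.ν • (ζ.υ - F.message ζ) := by
      rw [message, 𝒢.smul_eq, smul_sub, smul_smul, ← sub_smul]
      congr 1
      field_simp
      ring
    rw [h₃, show ζ.υ - F.message ζ = _ from h₁, smul_smul]
  refine ⟨hM, ?_⟩
  rw [← hM, ← show C - F.message ζ = _ from h₂]
  abel

/-- Witnesses for two tags of the same `C` with different openings satisfy
`(r - r') H = (ν' r' - ν r) G` with `r ≠ r'`. -/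
theorem solves_of_rel {C H : 𝒢.carrier n} {ζ ζ' : F.USVTag n} {ctx : Val} {r r' : 𝒢.Scalar n}
    (hν : ζ.ν ≠ -1) (hν' : ζ'.ν ≠ -1) (hM : F.message ζ ≠ F.message ζ')
    (h : (F.dleqProofSystem ctx).rel H (F.stmt C ζ) r)
    (h' : (F.dleqProofSystem ctx).rel H (F.stmt C ζ') r') :
    r ≠ r' ∧ Prog.Solves (.num ((ζ'.ν * r' - ζ.ν * r) * (r - r')⁻¹).val) H := by
  obtain ⟨h₁, h₂⟩ := F.message_eq hν h
  obtain ⟨h₁', h₂'⟩ := F.message_eq hν' h'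
  rw [h₂] at h₂'
  have hr : r ≠ r' := by
    rintro rfl
    exact hM (by rw [h₁, h₁', add_right_cancel h₂'])
  refine ⟨hr, .inr (.inr ⟨_, 𝒢.val_lt _, rfl, ?_⟩)⟩
  have key : (r - r') • H = (ζ'.ν * r' - ζ.ν * r) • 𝒢.gen n := by
    rw [sub_smul, sub_smul, sub_eq_sub_iff_add_eq_add, add_comm, h₂', add_comm]
  have := 𝒢.smul_eq ((ζ'.ν * r' - ζ.ν * r) * (r - r')⁻¹) (𝒢.gen n)
  rw [GroupFamily.smul] at this
  rw [this, mul_comm, ← smul_smul, ← key, smul_smul, inv_mul_cancel₀ (sub_ne_zero.2 hr), one_smul]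

theorem queryComp_verify (ctx : Val) (H : 𝒢.carrier n) (x : 𝒢.carrier n × 𝒢.carrier n)
    (π : Fin (F.r n) → F.Round n) : (F.verify ctx H x π).QueryComp :=
  (ROM.QueryComp.mapM fun _ => .query _ _ _ fun _ => .pure _).bind fun _ => .pure _

theorem vcert_eq (ctx : Val) (H C : 𝒢.carrier n) {ζ : F.USVTag n} (hν : ζ.ν ≠ -1) :
    (F.usvScheme ctx).vcert H C ζ = F.verify ctx H (F.stmt C ζ) ζ.π := by
  simp only [usvScheme, usvDerive, if_neg hν]
  rfl

theorem vcert_eq_pure (ctx : Val) (H C : 𝒢.carrier n) {ζ : F.USVTag n} (hν : ζ.ν = -1) :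
    (F.usvScheme ctx).vcert H C ζ = pure false := by
  simp only [usvScheme, usvDerive, if_pos hν]

theorem openM_eq (ctx : Val) (H C : 𝒢.carrier n) {ζ : F.USVTag n} (hν : ζ.ν ≠ -1) :
    (F.usvScheme ctx).openM true H C ζ = some (F.message ζ) := by
  simp only [USVScheme.openM, USVScheme.verifiedOpen, usvScheme, usvDerive, if_neg hν]
  rfl

end FischlinParams

/-! ### The experiments as expectations -/

/-- The indicator of an accepting run. -/
def accept {n : ℕ} (b : Bool) (_ : OracleLog n) : ℝ≥0∞ := if b = true then 1 else 0

theorem accept_le_one {n : ℕ} (b : Bool) (s : OracleLog n) : accept b s ≤ 1 := by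
  unfold accept
  split_ifs <;> simp

theorem accept_decide_of_not {n : ℕ} {p : Prop} {_ : Decidable p} (h : ¬ p) (s : OracleLog n) :
    accept (decide p) s = 0 := by
  simp [accept, h]

open Classical in
/-- The part of the equivocation experiment that follows the run of the adversary. -/
def USVScheme.eqvRest {𝒢 : GroupFamily} (U : USVScheme 𝒢) {n : ℕ} (H : 𝒢.carrier n) (v : Val) :
    ROM n Bool :=
  match Function.partialInv (U.encOutput n) v with
  | none => pure false
  | some (C, ζ, ζ') => do
      let b ← U.vcert H C ζ
      let b' ← U.vcert H C ζ'
      pure (decide (ζ ≠ ζ' ∧ b = true ∧ b' = true ∧ U.openM b H C ζ ≠ U.openM b' H C ζ'))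

theorem USVScheme.eqvExp_apply {𝒢 : GroupFamily} (U : USVScheme 𝒢) (𝒮 : TransparentSetup 𝒢)
    (A : Prog) (n : ℕ) : U.eqvExp 𝒮 A n true = ∑' H, 𝒮.samplePP n H *
      (A.run n (𝒢.encPP H)).expect [] fun v s => (U.eqvRest H v).expect s accept := by
  have h : U.eqvExp 𝒮 A n = ROM.exec (ROM.sample (𝒮.samplePP n) >>= fun H =>
      A.eval n (𝒢.encPP H) >>= fun r => U.eqvRest H r.1) := rfl
  rw [h, ROM.exec_apply, ROM.expect_bind, ROM.expect_sample]
  simp only [Prog.eval_bind_fst, ROM.expect_bind]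
  rfl

open Classical in
/-- The part of the extraction experiment that follows the run of the prover. -/
def ProofSystem.extractRest {𝒢 : GroupFamily} (Pi : ProofSystem 𝒢) (ctx : Val) (E : Prog) {n : ℕ}
    (H : 𝒢.carrier n) (v : Val) : ROM n Bool := do
  let log ← get
  let w ← E.run n (.pair (𝒢.encPP H) (.pair v (log.restrict ctx)))
  match Function.partialInv (Pi.encClaim n) v with
  | none => pure false
  | some (x, π) => do
      let b ← Pi.verify H x π
      pure (b && decide (¬ ∃ w', Pi.encWit n w' = w ∧ Pi.rel H x w'))

theorem ProofSystem.extractExp_apply {𝒢 : GroupFamily} (Pi : ProofSystem 𝒢)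
    (𝒮 : TransparentSetup 𝒢) (ctx : Val) (P E : Prog) (n : ℕ) :
    Pi.extractExp 𝒮 ctx P E n true = ∑' H, 𝒮.samplePP n H * (P.run n (𝒢.encPP H)).expect []
      fun v s => (Pi.extractRest ctx E H v).expect s accept := by
  have h : Pi.extractExp 𝒮 ctx P E n = ROM.exec (ROM.sample (𝒮.samplePP n) >>= fun H =>
      P.eval n (𝒢.encPP H) >>= fun r => Pi.extractRest ctx E H r.1) := by
    simp only [extractRest, ← Prog.eval_bind_fst]
    rfl
  rw [h, ROM.exec_apply, ROM.expect_bind, ROM.expect_sample]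
  simp only [Prog.eval_bind_fst, ROM.expect_bind]
  rfl

open Classical in
theorem TransparentSetup.distExp_apply {𝒢 : GroupFamily} (D : Prog) (n : ℕ)
    (d : PMF (𝒢.carrier n)) : TransparentSetup.distExp D n d true = ∑' H, d H *
      (D.run n (𝒢.encPP H)).expect [] fun v _ => if v = .num 1 then 1 else 0 := by
  have h : TransparentSetup.distExp D n d = ROM.exec (ROM.sample d >>= fun H =>
      D.eval n (𝒢.encPP H) >>= fun r => pure (decide (r.1 = .num 1))) := rfl
  rw [h, ROM.exec_apply, ROM.expect_bind, ROM.expect_sample]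
  refine tsum_congr fun H => ?_
  rw [Prog.eval_bind_fst D _ fun v => pure (decide (v = .num 1)), ROM.expect_bind]
  simp only [ROM.expect_pure, decide_eq_true_eq]

open Classical in
theorem GroupFamily.dlExp_apply (𝒢 : GroupFamily) (A : Prog) (n : ℕ) :
    𝒢.dlExp A n true = ∑' x, 𝒢.uniformNonzero n x *
      (A.run n (𝒢.encPP (𝒢.smul x (𝒢.gen n)))).expect []
        fun v _ => if v = 𝒢.encScalar x then 1 else 0 := by
  have h : 𝒢.dlExp A n = ROM.exec (ROM.sample (𝒢.uniformNonzero n) >>= fun x =>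
      A.eval n (𝒢.encPP (𝒢.smul x (𝒢.gen n))) >>= fun r =>
        pure (decide (r.1 = 𝒢.encScalar x))) := rfl
  rw [h, ROM.exec_apply, ROM.expect_bind, ROM.expect_sample]
  refine tsum_congr fun x => ?_
  rw [Prog.eval_bind_fst A _ fun v => pure (decide (v = 𝒢.encScalar x)), ROM.expect_bind]
  simp only [ROM.expect_pure, decide_eq_true_eq]

/-! ### The reduction -/

namespace Prog

/-- The prover that runs the adversary and outputs the claim of the selected tag. -/
def prover (A S tag : Prog) : Prog := comp (claim S tag) (pair A (prim .id))

/-- Given `((state, out), (1ⁿ, pp))` after the simulated run of the adversary: the extractor's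
answer for the selected tag. -/
def extract (S tag E : Prog) : Prog :=
  comp E (pair snd (pair (comp (claim S tag) (pair (comp snd fst) snd))
    (comp snd (comp snd (comp fst fst)))))

/-- The discrete logarithm algorithm: simulate the adversary, extract witnesses for both tags and
solve for the discrete logarithm of `H`. -/
def attack (ctx : Val) (A S E E' : Prog) : Prog :=
  comp (comp solve (pair (pair (extract S getTag₁ E) (extract S getTag₂ E'))
    (pair (comp snd fst) snd))) (pair (simStart ctx A) (prim .id))

theorem PPT.prover {A S tag : Prog} (hA : A.PPT) (hS : S.PPT) (ht : tag.PPT) :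
    (prover A S tag).PPT :=
  (hS.claim ht).comp (hA.pair (ppt_prim _))

theorem PPT.extract {S tag E : Prog} (hS : S.PPT) (ht : tag.PPT) (hE : E.PPT) :
    (extract S tag E).PPT :=
  hE.comp (ppt_snd.pair (((hS.claim ht).comp ((ppt_snd.comp ppt_fst).pair ppt_snd)).pair
    (ppt_snd.comp (ppt_snd.comp (ppt_fst.comp ppt_fst)))))

theorem PPT.attack {A S E E' : Prog} (ctx : Val) (hA : A.PPT) (hS : S.PPT) (hE : E.PPT)
    (hE' : E'.PPT) : (attack ctx A S E E').PPT :=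
  (ppt_solve.comp (((hS.extract ppt_getTag₁ hE).pair (hS.extract ppt_getTag₂ hE')).pair
    ((ppt_snd.comp ppt_fst).pair ppt_snd))).comp ((hA.simStart ctx).pair (ppt_prim _))

theorem OracleFree.attack {A S E E' : Prog} (ctx : Val) (hS : S.OracleFree) (hE : E.OracleFree)
    (hE' : E'.OracleFree) : (attack ctx A S E E').OracleFree := by
  simp [Prog.attack, Prog.extract, oracleFree_solve, oracleFree_simStart, hS.claim, hE, hE']

variable {𝒢 : GroupFamily} {n : ℕ}

theorem run_prover (A S tag : Prog) (x : Val) :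
    (prover A S tag).run n x = A.run n x >>= fun v => (claim S tag).run n (.pair v x) := by
  simp [prover, Op.eval]

/-- What `attack` does after the simulated run of the adversary with output `v` and log `s`. -/
def attackRest (ctx : Val) (S E E' : Prog) (H : 𝒢.carrier n) (v : Val) (s : OracleLog n) :
    ROM n Val := do
  let c ← (claim S getTag₁).run n (.pair v (𝒢.encPP H))
  let w ← E.run n (.pair (𝒢.encPP H) (.pair c (s.restrict ctx)))
  let c' ← (claim S getTag₂).run n (.pair v (𝒢.encPP H))
  let w' ← E'.run n (.pair (𝒢.encPP H) (.pair c' (s.restrict ctx)))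
  solve.run n (.pair (.pair w w') (.pair v (𝒢.encPP H)))

theorem expect_attack (ctx : Val) (A S E E' : Prog) (H : 𝒢.carrier n)
    (f : Val → OracleLog n → ℝ≥0∞) :
    ((attack ctx A S E E').run n (𝒢.encPP H)).expect [] f =
      (A.run n (𝒢.encPP H)).expect [] fun v s =>
        (attackRest ctx S E E' H v s).expect [] f := by
  have h : (simStart ctx A).run n (𝒢.encPP H) =
      ROM.sample ((A.run n (𝒢.encPP H) []).map (simOut ctx (.unary n))) := run_simStart _ _ _ _ _
  rw [attack, run_comp, run_pair, h, bind_assoc, ROM.sample_map_bind,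
    ROM.expect_bind, ROM.expect_sample]
  refine tsum_congr fun r => ?_
  congr 2
  simp [attackRest, extract, simOut, encState, Op.eval]

end Prog

open Classical in
/-- The success probability of `attack` against `H`, where the elements `0` and `G` count as
solved. -/
def attackProb {𝒢 : GroupFamily} {n : ℕ} (D : Prog) (H : 𝒢.carrier n) : ℝ≥0∞ :=
  (D.run n (𝒢.encPP H)).expect [] fun v _ => if Prog.Solves v H then 1 else 0

/-- If two independent extractors succeed with probabilities `g` and `g'`, then an event that is
contained in two acceptance events of probabilities `p` and `p'` is at most as likely as the sum of
the failures `h p`, `h' p'` and the joint success `g g'`. -/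
theorem ENNReal.le_failure_add_failure_add_success {m p p' g g' h h' : ℝ≥0∞} (hp : m ≤ p)
    (hp' : m ≤ p') (h1 : m ≤ 1) (hg : g + h = 1) (hg' : g' + h' = 1) :
    m ≤ h * p + h' * p' + g * g' := by
  have hg1 : g ≤ 1 := hg ▸ le_self_add
  calc m = m * ((g + h) * (g' + h')) := by rw [hg, hg', one_mul, mul_one]
    _ = h * m * (g' + h') + g * (h' * m) + g * g' * m := by ring
    _ ≤ h * p * 1 + 1 * (h' * p') + g * g' * 1 := by
        rw [hg']
        gcongr
    _ = h * p + h' * p' + g * g' := by ring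

namespace FischlinParams

variable {𝒢 : GroupFamily} (F : FischlinParams 𝒢) {n : ℕ}

/-- The probability that the proof of `ζ` is accepted when it is checked with log `s`. -/
def acceptProb (ctx : Val) (H C : 𝒢.carrier n) (ζ : F.USVTag n) (s : OracleLog n) : ℝ≥0∞ :=
  (F.verify ctx H (F.stmt C ζ) ζ.π).expect s accept

/-- `w` encodes a witness for the statement of `ζ`. -/
def IsWitness (ctx : Val) (H C : 𝒢.carrier n) (ζ : F.USVTag n) (w : Val) : Prop :=
  ∃ r, 𝒢.encScalar r = w ∧ (F.dleqProofSystem ctx).rel H (F.stmt C ζ) r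

/-- An output with an underivable opening, or with two equal openings, loses whatever the oracle
answers. -/
theorem expect_eqvRest_eq_zero (ctx : Val) (H C : 𝒢.carrier n) (ζ ζ' : F.USVTag n)
    (h : ζ.ν = -1 ∨ ζ'.ν = -1 ∨ F.message ζ = F.message ζ') (s : OracleLog n) :
    ((F.usvScheme ctx).eqvRest H ((F.usvScheme ctx).encOutput n (C, ζ, ζ'))).expect s accept =
      0 := by
  rw [USVScheme.eqvRest, Function.partialInv_left (F.encOutput_injective ctx)]
  by_cases hν : ζ.ν = -1
  · simp only [F.vcert_eq_pure ctx H C hν, ROM.expect_bind, ROM.expect_pure, accept]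
    simp
  by_cases hν' : ζ'.ν = -1
  · simp only [F.vcert_eq_pure ctx H C hν', ROM.expect_bind, ROM.expect_pure, accept]
    simp
  have hM : F.message ζ = F.message ζ' := by tauto
  have hfalse : ∀ b b' : Bool, ¬ (ζ ≠ ζ' ∧ b = true ∧ b' = true ∧
      (F.usvScheme ctx).openM b H C ζ ≠ (F.usvScheme ctx).openM b' H C ζ') := by
    rintro _ _ ⟨-, rfl, rfl, h⟩
    exact h (by rw [F.openM_eq ctx H C hν, F.openM_eq ctx H C hν', hM])
  simp only [ROM.expect_bind, ROM.expect_pure]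
  rw [← nonpos_iff_eq_zero]
  refine (ROM.expect_mono _ _ fun b s' => (ROM.expect_mono _ _ (g := fun _ _ => 0)
    fun b' s'' => ?_).trans_eq (ROM.expect_const _ _ _)).trans_eq (ROM.expect_const _ _ 0)
  exact le_of_eq (accept_decide_of_not (hfalse b b') _)

/-- An equivocation makes both proofs accepted. The second proof is checked after the first one; by
lazy sampling this is as likely to succeed as checking it right away. -/
theorem expect_eqvRest_le (ctx : Val) (H C : 𝒢.carrier n) (ζ ζ' : F.USVTag n) (hν : ζ.ν ≠ -1)
    (hν' : ζ'.ν ≠ -1) (s : OracleLog n) :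
    ((F.usvScheme ctx).eqvRest H ((F.usvScheme ctx).encOutput n (C, ζ, ζ'))).expect s accept ≤
      F.acceptProb ctx H C ζ s ∧
    ((F.usvScheme ctx).eqvRest H ((F.usvScheme ctx).encOutput n (C, ζ, ζ'))).expect s accept ≤
      F.acceptProb ctx H C ζ' s := by
  rw [USVScheme.eqvRest, Function.partialInv_left (F.encOutput_injective ctx)]
  simp only [ROM.expect_bind, ROM.expect_pure, F.vcert_eq ctx H C hν, F.vcert_eq ctx H C hν']
  constructor
  · refine ROM.expect_mono _ _ fun b s' => ?_
    refine (ROM.expect_mono _ _ (g := fun _ _ => accept b s') fun b' s'' => ?_).trans_eq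
      (ROM.expect_const _ _ _)
    cases b <;> simp [accept]
    split_ifs <;> simp
  · refine le_trans ?_ ((F.queryComp_verify ctx H (F.stmt C ζ) ζ.π).expect_after
      (F.queryComp_verify ctx H (F.stmt C ζ') ζ'.π) (fun b => if b = true then 1 else 0) s).le
    refine ROM.expect_mono _ _ fun b s' => ROM.expect_mono _ _ fun b' s'' => ?_
    cases b' <;> simp [accept]
    split_ifs <;> simp

open Classical in
/-- The extraction experiment after a run of the prover fails with the probability that the
extractor errs, times the probability that the proof is accepted. -/
theorem expect_extractRest {ctx : Val} {S tag E : Prog} (hS : 𝒢.ComputesSMulAdd S)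
    {H C : 𝒢.carrier n} {x : Val} {ζ : F.USVTag n} (hν : ζ.ν ≠ -1)
    (htag : tag.run n (.pair (.pair (𝒢.enc n C) x) (𝒢.encPP H)) =
      pure ((F.usvScheme ctx).encTag n ζ)) {s : OracleLog n} {d : PMF Val}
    (hE : E.run n (.pair (𝒢.encPP H) (.pair
      ((F.dleqProofSystem ctx).encClaim n (F.stmt C ζ, ζ.π)) (s.restrict ctx))) = ROM.sample d) :
    ((Prog.claim S tag).run n (.pair (.pair (𝒢.enc n C) x) (𝒢.encPP H)) >>=
      (F.dleqProofSystem ctx).extractRest ctx E H).expect s accept =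
        (∑' w, d w * if F.IsWitness ctx H C ζ w then 0 else 1) * F.acceptProb ctx H C ζ s := by
  have hc := Prog.run_claim (F := F) (S := S) (m := n) H hS hν htag
  change _ = pure ((F.dleqProofSystem ctx).encClaim n (F.stmt C ζ, ζ.π)) at hc
  rw [hc, pure_bind, ProofSystem.extractRest, ROM.expect_bind, ROM.expect_get, hE,
    Function.partialInv_left (F.encClaim_injective ctx), ROM.expect_bind, ROM.expect_sample,
    ← ENNReal.tsum_mul_right]
  refine tsum_congr fun w => ?_
  rw [mul_assoc]
  congr 1
  change ((F.verify ctx H (F.stmt C ζ) ζ.π) >>= fun b =>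
    (pure (b && decide (¬ F.IsWitness ctx H C ζ w)) : ROM n Bool)).expect s accept = _
  rw [ROM.expect_bind]
  simp only [ROM.expect_pure]
  by_cases hw : F.IsWitness ctx H C ζ w
  · simp [hw, accept]
  · simp only [hw, not_false_eq_true, decide_true, Bool.and_true, if_false, one_mul]
    rfl

open Classical in
/-- The attack succeeds at least when both extractors do. -/
theorem le_expect_attackRest {ctx : Val} {S E E' : Prog} (hS : 𝒢.ComputesSMulAdd S)
    {H C : 𝒢.carrier n} {ζ ζ' : F.USVTag n} (hν : ζ.ν ≠ -1) (hν' : ζ'.ν ≠ -1)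
    (hM : F.message ζ ≠ F.message ζ') {s : OracleLog n} {d d' : PMF Val}
    (hE : E.run n (.pair (𝒢.encPP H) (.pair
      ((F.dleqProofSystem ctx).encClaim n (F.stmt C ζ, ζ.π)) (s.restrict ctx))) = ROM.sample d)
    (hE' : E'.run n (.pair (𝒢.encPP H) (.pair
      ((F.dleqProofSystem ctx).encClaim n (F.stmt C ζ', ζ'.π)) (s.restrict ctx))) =
        ROM.sample d') :
    (∑' w, d w * if F.IsWitness ctx H C ζ w then 1 else 0) *
      (∑' w, d' w * if F.IsWitness ctx H C ζ' w then 1 else 0) ≤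
        (Prog.attackRest ctx S E E' H ((F.usvScheme ctx).encOutput n (C, ζ, ζ')) s).expect []
          fun v _ => if Prog.Solves v H then 1 else 0 := by
  have hc := Prog.run_claim (F := F) (S := S) (tag := Prog.getTag₁) (m := n) (ctx := ctx) (C := C)
    (x := .pair ((F.usvScheme ctx).encTag n ζ) ((F.usvScheme ctx).encTag n ζ')) H hS hν
    (by simp [Prog.getTag₁])
  have hc' := Prog.run_claim (F := F) (S := S) (tag := Prog.getTag₂) (m := n) (ctx := ctx) (C := C)
    (x := .pair ((F.usvScheme ctx).encTag n ζ) ((F.usvScheme ctx).encTag n ζ')) H hS hν'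
    (by simp [Prog.getTag₂])
  change (Prog.claim S Prog.getTag₁).run n (.pair ((F.usvScheme ctx).encOutput n (C, ζ, ζ')) _) =
    pure ((F.dleqProofSystem ctx).encClaim n (F.stmt C ζ, ζ.π)) at hc
  change (Prog.claim S Prog.getTag₂).run n (.pair ((F.usvScheme ctx).encOutput n (C, ζ, ζ')) _) =
    pure ((F.dleqProofSystem ctx).encClaim n (F.stmt C ζ', ζ'.π)) at hc'
  rw [Prog.attackRest, hc, pure_bind, hE, ROM.expect_bind, ROM.expect_sample,
    ← ENNReal.tsum_mul_right]
  refine ENNReal.tsum_le_tsum fun w => ?_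
  rw [mul_assoc, hc', pure_bind, hE', ROM.expect_bind, ROM.expect_sample,
    ← ENNReal.tsum_mul_left]
  refine mul_le_mul_right (ENNReal.tsum_le_tsum fun w' => ?_) _
  by_cases hw : F.IsWitness ctx H C ζ w
  · by_cases hw' : F.IsWitness ctx H C ζ' w'
    · obtain ⟨r, rfl, hr⟩ := id hw
      obtain ⟨r', rfl, hr'⟩ := id hw'
      obtain ⟨hne, hsol⟩ := F.solves_of_rel hν hν' hM hr hr'
      rw [Prog.run_solve H hne, ROM.expect_pure, if_pos hsol]
      simp [hw, hw']
    · simp [hw']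
  · simp [hw]

open Classical in
/-- For a fixed second generator and a fixed outcome of the adversary's run: an equivocation is at
most as likely as the failure of one of the extractors or the success of the attack. -/
theorem expect_eqvRest_le_add {ctx : Val} {S E E' : Prog} (hS : 𝒢.ComputesSMulAdd S)
    (hE : E.OracleFree) (hE' : E'.OracleFree) (H : 𝒢.carrier n) (v : Val) (s : OracleLog n) :
    ((F.usvScheme ctx).eqvRest H v).expect s accept ≤
      ((Prog.claim S Prog.getTag₁).run n (.pair v (𝒢.encPP H)) >>=
        (F.dleqProofSystem ctx).extractRest ctx E H).expect s accept +
      ((Prog.claim S Prog.getTag₂).run n (.pair v (𝒢.encPP H)) >>=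
        (F.dleqProofSystem ctx).extractRest ctx E' H).expect s accept +
      (Prog.attackRest ctx S E E' H v s).expect [] fun v _ =>
        if Prog.Solves v H then 1 else 0 := by
  by_cases hv : ∃ o, (F.usvScheme ctx).encOutput n o = v
  swap
  · have : Function.partialInv ((F.usvScheme ctx).encOutput n) v = none := dif_neg hv
    simp [USVScheme.eqvRest, this, accept]
  obtain ⟨⟨C, ζ, ζ'⟩, rfl⟩ := hv
  by_cases h : ζ.ν = -1 ∨ ζ'.ν = -1 ∨ F.message ζ = F.message ζ'
  · rw [F.expect_eqvRest_eq_zero ctx H C ζ ζ' h]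
    exact zero_le
  push Not at h
  obtain ⟨hν, hν', hM⟩ := h
  obtain ⟨d, hd⟩ := hE.exists_run_eq_sample (.pair (𝒢.encPP H) (.pair
    ((F.dleqProofSystem ctx).encClaim n (F.stmt C ζ, ζ.π)) (s.restrict ctx)))
  obtain ⟨d', hd'⟩ := hE'.exists_run_eq_sample (.pair (𝒢.encPP H) (.pair
    ((F.dleqProofSystem ctx).encClaim n (F.stmt C ζ', ζ'.π)) (s.restrict ctx)))
  have e₁ := F.expect_extractRest hS hν (H := H) (C := C) (tag := Prog.getTag₁)
    (x := .pair ((F.usvScheme ctx).encTag n ζ) ((F.usvScheme ctx).encTag n ζ'))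
    (by simp [Prog.getTag₁]) (hd n)
  have e₂ := F.expect_extractRest hS hν' (H := H) (C := C) (tag := Prog.getTag₂)
    (x := .pair ((F.usvScheme ctx).encTag n ζ) ((F.usvScheme ctx).encTag n ζ'))
    (by simp [Prog.getTag₂]) (hd' n)
  obtain ⟨b₁, b₂⟩ := F.expect_eqvRest_le ctx H C ζ ζ' hν hν' s
  have hsum : ∀ (d : PMF Val) (W : Val → Prop),
      (∑' w, d w * if W w then 1 else 0) + (∑' w, d w * if W w then 0 else 1) = 1 := by
    intro d W
    rw [← ENNReal.tsum_add, ← d.tsum_coe]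
    refine tsum_congr fun w => ?_
    split_ifs <;> simp
  have key := ENNReal.le_failure_add_failure_add_success b₁ b₂
    ((ROM.expect_mono _ _ accept_le_one).trans_eq (ROM.expect_const _ _ _))
    (hsum d (F.IsWitness ctx H C ζ)) (hsum d' (F.IsWitness ctx H C ζ'))
  rw [← e₁, ← e₂] at key
  exact key.trans (add_le_add_right (F.le_expect_attackRest hS hν hν' hM (hd n) (hd' n)) _)

/-- The equivocation probability is at most the sum of the extraction errors for the two provers and
the success probability of the attack. -/
theorem eqvExp_le (𝒮 : TransparentSetup 𝒢) {ctx : Val} {A S E E' : Prog}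
    (hS : 𝒢.ComputesSMulAdd S) (hE : E.OracleFree) (hE' : E'.OracleFree) (n : ℕ) :
    (F.usvScheme ctx).eqvExp 𝒮 A n true ≤
      (F.dleqProofSystem ctx).extractExp 𝒮 ctx (Prog.prover A S Prog.getTag₁) E n true +
      (F.dleqProofSystem ctx).extractExp 𝒮 ctx (Prog.prover A S Prog.getTag₂) E' n true +
      ∑' H, 𝒮.samplePP n H * attackProb (Prog.attack ctx A S E E') H := by
  rw [USVScheme.eqvExp_apply, ProofSystem.extractExp_apply, ProofSystem.extractExp_apply,
    ← ENNReal.tsum_add, ← ENNReal.tsum_add]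
  refine ENNReal.tsum_le_tsum fun H => ?_
  rw [← mul_add, ← mul_add]
  refine mul_le_mul_right ?_ _
  rw [attackProb, Prog.expect_attack, Prog.run_prover, Prog.run_prover, ROM.expect_bind,
    ROM.expect_bind, ← ROM.expect_add, ← ROM.expect_add]
  refine ROM.expect_mono _ _ fun v s => ?_
  rw [← ROM.expect_bind, ← ROM.expect_bind]
  exact F.expect_eqvRest_le_add hS hE hE' H v s

end FischlinParams

/-! ### From the setup to uniform group elements -/

theorem PMF.tsum_map_mul {α β : Type} (d : PMF α) (g : α → β) (f : β → ℝ≥0∞) :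
    ∑' b, d.map g b * f b = ∑' a, d a * f (g a) := by
  rw [PMF.map, PMF.tsum_bind_mul]
  simp only [Function.comp, PMF.tsum_pure_mul]

/-- The program that runs `D` on `(1ⁿ, pp)` and tests whether it found the discrete logarithm
of `H`. -/
def Prog.tester (P S D : Prog) : Prog := comp (check P S) (pair D (prim .id))

open Classical in
theorem distExp_tester {𝒢 : GroupFamily} {P S : Prog} (hP : 𝒢.ComputesAdd P)
    (hS : 𝒢.ComputesSMulAdd S) (D : Prog) (n : ℕ) (d : PMF (𝒢.carrier n)) :
    TransparentSetup.distExp (Prog.tester P S D) n d true = ∑' H, d H * attackProb D H := by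
  rw [TransparentSetup.distExp_apply]
  refine tsum_congr fun H => ?_
  rw [attackProb, Prog.tester, Prog.run_comp, Prog.run_pair, bind_assoc, ROM.expect_bind]
  simp only [Prog.run_id, pure_bind, Prog.run_check _ _ hP hS, ROM.expect_pure]
  congr 2
  funext v s
  split_ifs <;> simp_all

theorem attackProb_le_one {𝒢 : GroupFamily} {n : ℕ} (D : Prog) (H : 𝒢.carrier n) :
    attackProb D H ≤ 1 := by
  refine (ROM.expect_mono _ _ fun v s => ?_).trans_eq (ROM.expect_const _ _ 1)
  split_ifs <;> simp

theorem attackProb_eq_one {𝒢 : GroupFamily} {n : ℕ} (D : Prog) {H : 𝒢.carrier n}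
    (h : H = 0 ∨ H = 𝒢.gen n) : attackProb D H = 1 := by
  have hs : ∀ v, Prog.Solves v H := fun v => by
    unfold Prog.Solves
    tauto
  simp [attackProb, hs]

/-- The setup deviates from the first candidate only if that is `0` or `G`, which the test accepts
anyway. -/
theorem tsum_samplePP_le {𝒢 : GroupFamily} (𝒮 : TransparentSetup 𝒢) (D : Prog) (n : ℕ) :
    ∑' H, 𝒮.samplePP n H * attackProb D H ≤
      ∑' H, (𝒮.beacon n).map (fun seed => 𝒮.h2g n (usvLabel ++ seed)) H * attackProb D H := by
  classical
  have h : 𝒮.samplePP n = (𝒮.beacon n).map (𝒮.setup n) := rfl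
  rw [h, PMF.tsum_map_mul, PMF.tsum_map_mul]
  refine ENNReal.tsum_le_tsum fun seed => mul_le_mul_right ?_ _
  have hc : 𝒮.candidate n seed 0 = 𝒮.h2g n (usvLabel ++ seed) := by
    simp [TransparentSetup.candidate]
  by_cases hbad : 𝒮.h2g n (usvLabel ++ seed) = 0 ∨ 𝒮.h2g n (usvLabel ++ seed) = 𝒢.gen n
  · rw [attackProb_eq_one D hbad]
    exact attackProb_le_one D _
  · push Not at hbad
    rw [← hc] at hbad ⊢
    have hex : ∃ k, 𝒮.candidate n seed k ≠ 0 ∧ 𝒮.candidate n seed k ≠ 𝒢.gen n := ⟨0, hbad⟩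
    have hfind : 𝒮.setup n seed = 𝒮.candidate n seed 0 := by
      rw [TransparentSetup.setup, dif_pos hex]
      congr 1
      exact (Nat.find_eq_zero hex).2 hbad
    rw [hfind]

/-- On a uniform element `x G ≠ 0` the test succeeds only if the attack finds `x`, or if `x = 1`. -/
theorem tsum_uniform_le {𝒢 : GroupFamily} (D : Prog) (n : ℕ) :
    ∑' H, (𝒢.uniformNonzero n).map (fun x => 𝒢.smul x (𝒢.gen n)) H * attackProb D H ≤
      𝒢.dlExp D n true + 𝒢.dlExp (Prog.const (.num 1)) n true := by
  classical
  rw [PMF.tsum_map_mul, GroupFamily.dlExp_apply, GroupFamily.dlExp_apply, ← ENNReal.tsum_add]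
  refine ENNReal.tsum_le_tsum fun x => ?_
  rw [← mul_add]
  by_cases hx : x = 0
  · have : 𝒢.uniformNonzero n x = 0 := by
      rw [GroupFamily.uniformNonzero, PMF.uniformOfFinset_apply_of_notMem]
      simp [hx]
    simp [this]
  refine mul_le_mul_right ?_ _
  rw [attackProb, Prog.run_const, ROM.expect_pure, ← ROM.expect_const (D.run n _) []
    (if Val.num 1 = 𝒢.encScalar x then (1 : ℝ≥0∞) else 0), ← ROM.expect_add]
  refine ROM.expect_mono _ _ fun v s => ?_
  split_ifs with h₁ h₂ h₃ h₃ <;> try simp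
  rcases h₁ with h | h | ⟨k, hk, rfl, h⟩
  · rw [← 𝒢.smul_one (𝒢.gen n)] at h
    have : x = 1 := 𝒢.smul_gen_injective (by simpa [𝒢.smul_one] using h)
    exact h₃ (by rw [this, GroupFamily.encScalar, ZMod.val_one])
  · exact hx (𝒢.smul_gen_injective (h.trans (𝒢.smul_zero' _).symm))
  · exact h₂ (by rw [𝒢.nsmul_gen_inj hk (𝒢.val_lt x) h, GroupFamily.encScalar])

theorem probTrue_eq (d : PMF Bool) : ENNReal.ofReal (probTrue d) = d true :=
  ENNReal.ofReal_toReal (PMF.apply_ne_top d true)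

theorem probTrue_nonneg (d : PMF Bool) : 0 ≤ probTrue d := ENNReal.toReal_nonneg

theorem Negligible.add {f g : ℕ → ℝ} (hf : Negligible f) (hg : Negligible g) :
    Negligible fun n => f n + g n :=
  Asymptotics.SuperpolynomialDecay.add hf hg

theorem Negligible.of_le {f g : ℕ → ℝ} (hg : Negligible g) (h0 : ∀ n, 0 ≤ f n)
    (h : ∀ n, f n ≤ g n) : Negligible f :=
  Asymptotics.SuperpolynomialDecay.trans_abs_le hg fun n => by
    rw [abs_of_nonneg (h0 n), abs_of_nonneg ((h0 n).trans (h n))]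
    exact h n

end

theorem mainTheorem6 (𝒢 : GroupFamily) (𝒮 : TransparentSetup 𝒢) (F : FischlinParams 𝒢)
    (ctxDLEQ : Val) (hH2G : 𝒮.HashIndist) (hDL : 𝒢.DLHard)
    (hAoK : (F.dleqProofSystem ctxDLEQ).IsAoK 𝒮 ctxDLEQ) :
    (F.usvScheme ctxDLEQ).EquivocationResistant 𝒮 := by
  intro A hA
  obtain ⟨P, hP, hPfree, hPadd⟩ := 𝒢.exists_computesAdd
  obtain ⟨S, hS, hSfree, hSadd⟩ := 𝒢.exists_computesSMulAdd hP hPfree hPadd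
  obtain ⟨E, hE, hEfree, hEneg⟩ := hAoK _ (hA.prover hS Prog.ppt_getTag₁)
  obtain ⟨E', hE', hEfree', hEneg'⟩ := hAoK _ (hA.prover hS Prog.ppt_getTag₂)
  set D := Prog.attack ctxDLEQ A S E E' with hDdef
  have hD : D.PPT := hA.attack ctxDLEQ hS hE hE'
  have hDfree : D.OracleFree := Prog.OracleFree.attack ctxDLEQ hSfree hEfree hEfree'
  have hT : (Prog.tester P S D).PPT := (hP.check hS).comp (hD.pair (Prog.ppt_prim _))
  have hTfree : (Prog.tester P S D).OracleFree :=
    ⟨hPfree.check hSfree, hDfree, trivial⟩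
  -- The bound: two extraction errors, the distinguishing advantage of the test between the hashed
  -- seed and a uniform element, and the success of the attack and of the constant guess `1`.
  refine Negligible.of_le ((((hEneg.add hEneg').add (hH2G _ hT hTfree)).add (hDL D hD hDfree)).add
    (hDL (Prog.const (.num 1)) (Prog.ppt_const _) trivial)) (fun n => probTrue_nonneg _)
    fun n => ?_
  have h₁ := F.eqvExp_le 𝒮 (ctx := ctxDLEQ) (A := A) hSadd hEfree hEfree' n
  have h₂ := tsum_samplePP_le 𝒮 D n
  have h₃ := tsum_uniform_le (𝒢 := 𝒢) D n
  have h₄ := h₁.trans (add_le_add_right h₂ _)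
  rw [← distExp_tester hPadd hSadd] at h₃ h₄
  simp only [← probTrue_eq] at h₃ h₄
  rw [← ENNReal.ofReal_add (probTrue_nonneg _) (probTrue_nonneg _),
    ENNReal.ofReal_le_ofReal_iff (add_nonneg (probTrue_nonneg _) (probTrue_nonneg _))] at h₃
  rw [← ENNReal.ofReal_add (probTrue_nonneg _) (probTrue_nonneg _),
    ← ENNReal.ofReal_add (add_nonneg (probTrue_nonneg _) (probTrue_nonneg _)) (probTrue_nonneg _),
    ENNReal.ofReal_le_ofReal_iff (add_nonneg (add_nonneg (probTrue_nonneg _) (probTrue_nonneg _))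
      (probTrue_nonneg _))] at h₄
  have h₅ := le_abs_self
    (probTrue (TransparentSetup.distExp (Prog.tester P S D) n
      ((𝒮.beacon n).map (fun seed => 𝒮.h2g n (usvLabel ++ seed))))
    - probTrue (TransparentSetup.distExp (Prog.tester P S D) n
      ((𝒢.uniformNonzero n).map (fun x => 𝒢.smul x (𝒢.gen n)))))
  linarith
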